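/- **Setting.** Let $p\in\mathbb N\cup\{\infty\}$ and let $x=(x_k)_{k=1}^p$ be a random vector with law $\mu$ on $\mathbb R^p$ and $\mathbb E[xx^\top]=\Sigma=\mathrm{diag}(\lambda_1,\dots,\lambda_p)$, where $\lambda_1\ge\lambda_2\ge\dots>0$ and $\mathrm{tr}\,\Sigma<\infty$; let $z=\Sigma^{-1/2}x$. Let $X$ be the $n\times p$ matrix whose rows are $n$ i.i.d. draws of $x$, and let $\varepsilon\in\mathbb R^n$ have i.i.d. centered entries with variance $\sigma^2<\infty$, independent of $X$ and of a further independent draw $x\sim\mu$. For a ridge $\lambda>0$ put $\hat\theta(y)=X^\top(XX^\top+n\lambda I_n)^{-1}y$ and let $$\mathcal V=\mathbb E_{x,\varepsilon}\big[(x^\top\hat\theta(\varepsilon))^2\big]$$ be the variance term of the test error; it is a function of $X$. A subscript $>k$ (resp. $\le k$) denotes removal of (resp. restriction to) the first $k$ coordinates, and $\|v\|_M^2=v^\top Mv$. **Feature assumptions.** (GF) with constants $c,C>0$: for every integer $k$ with $0\le k<p$ both of $$\alpha_k=\operatorname*{ess\,inf}_z\frac{\|z_{>k}\|^2_{\Sigma_{>k}}}{\mathrm{tr}\,\Sigma_{>k}},\qquad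 \beta_k=\operatorname*{ess\,sup}_z\max\Big\{\frac{\|z_{\le k}\|_2^2}{k},\frac{\|z_{>k}\|^2_{\Sigma_{>k}}}{\mathrm{tr}\,\Sigma_{>k}},\frac{\|z_{>k}\|^2_{\Sigma_{>k}^2}}{\mathrm{tr}\,\Sigma_{>k}^2}\Big\}$$ lie in $[c,C]$ (for $k=0$ the first ratio is omitted). (IF) with constants $G>0$, $\eta>1$: $p<\infty$, $p>\eta n$, the coordinates $z_k$ are independent, and $\|z_k\|_{\psi_2}\le G$ for all $k$, where $\|Y\|_{\psi_2}=\inf\{t>0:\mathbb E e^{Y^2/t^2}\le2\}$. **Proposition.** Let $a>0$, $b\in(0,1+a)$ and $c,C>0$. Below, consider problems with $c\,k^{-1-a}\le\lambda_k\le C\,k^{-1-a}$ for all $1\le k\le p$ and $c\,n^{-b}\le\lambda\le C\,n^{-b}$ (that is, $\lambda_k=\Theta(k^{-1-a})$ and $\lambda=\Theta(n^{-b})$ with fixed constants). 1. There are $K>0$ and a sequence $\delta_n=o(1/n)$, depending only on $a,b,c,C$, such that for all large enough $n$ and every such problem satisfying (GF) with constants $c,C$ (any $p\in\mathbb N\cup\{\infty\}$),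 with probability at least $1-\delta_n$ over $X$, $$\mathcal V\le K\,\sigma^2\,n^{\frac{b}{1+a}-1}.$$ 2. For all $G>0$ and $\eta>1$ there are $K,c_1>0$, depending only on $a,b,c,C,G,\eta$, such that for all large enough $n$ and every such problem satisfying (IF) with constants $G,\eta$, with probability at least $1-3e^{-c_1n}$ over $X$, $$\mathcal V\le K\,\sigma^2\,n^{\frac{b}{1+a}-1}.$$ -/

import Mathlib

open MeasureTheory ProbabilityTheory Filter Asymptotics Matrix
open scoped ENNReal

noncomputable section

namespace RidgeRegression

/-- Coordinate indices `0, 1, …, p - 1` of `ℝ^p`, where `p ∈ ℕ ∪ {∞}`.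
The index `k` stands for the coordinate number `k + 1` in one-based numbering. -/
abbrev Idx (p : ℕ∞) : Type := {k : ℕ // (k : ℕ∞) < p}

/-- `μ` is the law of a random feature vector `x ∈ ℝ^p` whose (uncentered) covariance
`E[x xᵀ]` is the diagonal trace-class matrix `diag(lam 0, lam 1, …)` with
`lam 0 ≥ lam 1 ≥ … > 0`. -/
structure IsFeatureLaw {p : ℕ∞} (lam : Idx p → ℝ) (μ : Measure (Idx p → ℝ)) : Prop where
  prob : IsProbabilityMeasure μ
  pos : ∀ k, 0 < lam k
  anti : Antitone lam
  summable : Summable lam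
  memLp : ∀ k, MemLp (fun x : Idx p → ℝ => x k) 2 μ
  cov : ∀ k l, ∫ x, x k * x l ∂μ = if k = l then lam k else 0

/-- `ν` is the law of a centered noise variable with variance `σ ^ 2 < ∞`. -/
structure IsNoiseLaw (ν : Measure ℝ) (σ : ℝ) : Prop where
  prob : IsProbabilityMeasure ν
  memLp : MemLp (fun e : ℝ => e) 2 ν
  mean : ∫ e, e ∂ν = 0
  var : ∫ e, e ^ 2 ∂ν = σ ^ 2

/-- The law of `n` i.i.d. samples `x_1, …, x_n` of `μ` (the rows of the input matrix). -/
def sampleLaw {p : ℕ∞} (μ : Measure (Idx p → ℝ)) (n : ℕ) : Measure (Fin n → Idx p → ℝ) :=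
  Measure.pi fun _ => μ

/-- The matrix `X Xᵀ`. If `p = ∞` its entries are a.s. convergent series. -/
def gram {p : ℕ∞} {n : ℕ} (X : Fin n → Idx p → ℝ) : Matrix (Fin n) (Fin n) ℝ :=
  Matrix.of fun i j => ∑' k, X i k * X j k

/-- The ridge regressor `Xᵀ (X Xᵀ + n ρ I)⁻¹ y` with ridge `ρ`. -/
def regressor {p : ℕ∞} {n : ℕ} (ρ : ℝ) (X : Fin n → Idx p → ℝ) (y : Fin n → ℝ) : Idx p → ℝ :=
  fun k => ∑ i, X i k *
    ((gram X + ((n : ℝ) * ρ) • (1 : Matrix (Fin n) (Fin n) ℝ))⁻¹ *ᵥ y) i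

/-- The variance term `E_{x,ε} (xᵀ θ̂(ε))²` of the test error, as a function of the sample `X`:
the feature `x ∼ μ` and the noise vector `ε ∼ ν ^ n` are independent. -/
def varianceTerm {p : ℕ∞} {n : ℕ} (μ : Measure (Idx p → ℝ)) (ν : Measure ℝ) (ρ : ℝ)
    (X : Fin n → Idx p → ℝ) : ℝ≥0∞ :=
  ∫⁻ q : (Idx p → ℝ) × (Fin n → ℝ),
    ENNReal.ofReal ((∑' k, q.1 k * regressor ρ X q.2 k) ^ 2)
      ∂(μ.prod (Measure.pi fun _ : Fin n => ν))

/-- Polynomial eigen-decay `lam_k = Θ(k^{-1-a})` with constants `c`, `C`. -/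
def PolyDecay {p : ℕ∞} (a c C : ℝ) (lam : Idx p → ℝ) : Prop :=
  ∀ k : Idx p, c * ((k : ℕ) + 1 : ℝ) ^ (-1 - a) ≤ lam k ∧
    lam k ≤ C * ((k : ℕ) + 1 : ℝ) ^ (-1 - a)

/-- The isotropic feature vector `z = Σ^{-1/2} x`. -/
def whiten {p : ℕ∞} (lam : Idx p → ℝ) (x : Idx p → ℝ) : Idx p → ℝ :=
  fun k => x k / Real.sqrt (lam k)

/-- `tr[Σ_{>k} ^ m]`, the sum of `lam_l ^ m` over all but the first `k` coordinates. -/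
def tailTrace {p : ℕ∞} (lam : Idx p → ℝ) (m k : ℕ) : ℝ≥0∞ :=
  ∑' l : Idx p, if k ≤ (l : ℕ) then ENNReal.ofReal (lam l ^ m) else 0

/-- `‖z_{>k}‖²` in the norm of `Σ_{>k} ^ m`. -/
def tailNormSq {p : ℕ∞} (lam : Idx p → ℝ) (m k : ℕ) (z : Idx p → ℝ) : ℝ≥0∞ :=
  ∑' l : Idx p, if k ≤ (l : ℕ) then ENNReal.ofReal (lam l ^ m * z l ^ 2) else 0

/-- `‖z_{≤k}‖²` in the Euclidean norm. -/
def headNormSq {p : ℕ∞} (k : ℕ) (z : Idx p → ℝ) : ℝ≥0∞ :=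
  ∑' l : Idx p, if (l : ℕ) < k then ENNReal.ofReal (z l ^ 2) else 0

/-- `α_k = ess inf_z ‖z_{>k}‖²_{Σ_{>k}} / tr[Σ_{>k}]`. -/
def alphaCoef {p : ℕ∞} (lam : Idx p → ℝ) (μ : Measure (Idx p → ℝ)) (k : ℕ) : ℝ≥0∞ :=
  essInf (fun x => tailNormSq lam 1 k (whiten lam x) / tailTrace lam 1 k) μ

/-- `β_k`, the essential supremum of the maximum of `‖z_{≤k}‖² / k`,
`‖z_{>k}‖²_{Σ_{>k}} / tr[Σ_{>k}]` and `‖z_{>k}‖²_{Σ_{>k}²} / tr[Σ_{>k}²]`.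
For `k = 0` the first ratio is `0 / 0 = 0`, that is, it is left out. -/
def betaCoef {p : ℕ∞} (lam : Idx p → ℝ) (μ : Measure (Idx p → ℝ)) (k : ℕ) : ℝ≥0∞ :=
  essSup (fun x =>
    max (headNormSq k (whiten lam x) / (k : ℝ≥0∞))
      (max (tailNormSq lam 1 k (whiten lam x) / tailTrace lam 1 k)
        (tailNormSq lam 2 k (whiten lam x) / tailTrace lam 2 k))) μ

/-- Generic features: `α_k = Θ(1)` and `β_k = Θ(1)` with constants `c`, `C`, at every
truncation level `k` that leaves a nonempty tail. -/
def GenericFeatures {p : ℕ∞} (c C : ℝ) (lam : Idx p → ℝ) (μ : Measure (Idx p → ℝ)) : Prop :=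
  ∀ k : ℕ, (k : ℕ∞) < p →
    (ENNReal.ofReal c ≤ alphaCoef lam μ k ∧ alphaCoef lam μ k ≤ ENNReal.ofReal C) ∧
    (ENNReal.ofReal c ≤ betaCoef lam μ k ∧ betaCoef lam μ k ≤ ENNReal.ofReal C)

/-- The sub-Gaussian norm `‖Y‖_{ψ₂} = inf {t > 0 : E exp(Y² / t²) ≤ 2}`
(equal to `∞` if there is no such `t`). -/
def psi2Norm {Ω : Type*} [MeasurableSpace Ω] (Y : Ω → ℝ) (P : Measure Ω) : ℝ≥0∞ :=
  sInf {s : ℝ≥0∞ | ∃ t : ℝ, 0 < t ∧ s = ENNReal.ofReal t ∧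
    ∫⁻ ω, ENNReal.ofReal (Real.exp (Y ω ^ 2 / t ^ 2)) ∂P ≤ 2}

/-- Independent sub-Gaussian features: the coordinates of `z` are independent, with
sub-Gaussian norms at most `G`. -/
def IndependentFeatures {p : ℕ∞} (G : ℝ) (lam : Idx p → ℝ) (μ : Measure (Idx p → ℝ)) : Prop :=
  iIndepFun (fun (k : Idx p) (x : Idx p → ℝ) => whiten lam x k) μ ∧
    ∀ k : Idx p, psi2Norm (fun x : Idx p → ℝ => whiten lam x k) μ ≤ ENNReal.ofReal G

end RidgeRegression

end

/-!
The coordinates are split at `k = ⌈n ^ s⌉` with `s = b / (1 + a)`, where the eigenvalues are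
comparable to the ridge. Write `s₀ = n * ridge`, let `T` and `Z` be the sample matrices of the tail
coordinates and of the whitened head coordinates, and eliminate the tail: the matrix
`W = s₀ Zᵀ (s₀ + T Tᵀ)⁻¹ Z` (`headCov`) plays the role of the sample covariance of the head. If
`Q ≤ W` is positive definite, the variance is at most `σ ^ 2 * (tr Q⁻¹ + tr Σ_{>k} / s₀)`
(`varianceTerm_le`). The last summand is of order `n ^ (s - 1)` by the choice of `k`. As the head
has at most `k ≈ n ^ s` coordinates, it remains to show that `W` is of order `n`, in the sense that
`tr Q⁻¹` is of order `k / n` for some `Q`.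

Adding a sample `x` to `X` changes `W` by a multiple of `r rᵀ`, where `r` is the residual of the
head features of `x` after their regression on the tail (`headCov_cons`). Since the coordinates are
uncorrelated, `E[r rᵀ] ≥ I` whatever the previous samples are
(`IsHeadTailModel.trace_le_integral`). So `W` grows linearly in the mean, and what has to be
excluded are atypical samples.

For generic features nothing but boundedness of the samples is available. Here the barrier potential
`tr (L + W) ^ (-q)` is followed through the sequence of samples. One sample decreases it
in a controlled way by the Sherman-Morrison formula and a trace form of Jensen's inequality
(`trace_pow_inv_add_rankOne_le`), so that its power with exponent `-1 / q` has increments bounded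
below in the mean, with a lower bound that is small relative to the present value. An exponential
supermartingale then gives linear growth outside of an event of probability
`exp (-c n ^ ((1 - s) / 2))` (`measure_barrierPotential_le`). With `L = n ^ ((1 + s) / 2)`, a
large exponent `q` shows `W ≥ L`, which makes the shift harmless, and `q = 1` bounds the trace
(`measure_not_hasInverseTraceBound_le`).

For independent features the residual in a fixed direction is a linear form in independent
coordinates, whose kurtosis is bounded. This gives a lower bound for `W` in this direction outside
of an event of probability `exp (-c n)` (`measure_resolventForm_le`). A grid of directions of size
`exp (o n)` makes it uniform (`measure_headCov_lower_le`).
-/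

namespace RidgeRegression

/-! ### Powers of positive semidefinite matrices -/

lemma symm_dotProduct_mulVec {H : Type*} [Fintype H] {M : Matrix H H ℝ} (hM : Mᵀ = M)
    (u v : H → ℝ) : u ⬝ᵥ M *ᵥ v = (M *ᵥ u) ⬝ᵥ v := by
  rw [dotProduct_mulVec, ← mulVec_transpose, hM]

lemma vecMulVec_mulVec' {H : Type*} [Fintype H] (a b u : H → ℝ) :
    vecMulVec a b *ᵥ u = (b ⬝ᵥ u) • a := by
  ext i
  simp only [mulVec, dotProduct, vecMulVec_apply, Pi.smul_apply, smul_eq_mul, Finset.sum_mul]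
  exact Finset.sum_congr rfl fun j _ => by ring

section LinearAlgebra

variable {H : Type*} [Fintype H] [DecidableEq H]

lemma exists_spectral {Y : Matrix H H ℝ} (hY : Y.PosSemidef) :
    ∃ (O : Matrix H H ℝ) (d : H → ℝ), O * Oᵀ = 1 ∧ Oᵀ * O = 1 ∧ (∀ i, 0 ≤ d i) ∧
      Y = O * diagonal d * Oᵀ := by
  refine ⟨hY.1.eigenvectorUnitary, hY.1.eigenvalues, ?_, ?_, hY.eigenvalues_nonneg, ?_⟩
  · have := (Unitary.mem_iff.mp hY.1.eigenvectorUnitary.2).2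
    simpa [star_eq_conjTranspose] using this
  · have := (Unitary.mem_iff.mp hY.1.eigenvectorUnitary.2).1
    simpa [star_eq_conjTranspose] using this
  · have := hY.1.spectral_theorem
    simpa [Unitary.conjStarAlgAut_apply, star_eq_conjTranspose, Function.comp_def] using this

lemma spectral_pow {O : Matrix H H ℝ} {d : H → ℝ} (hO : Oᵀ * O = 1) (m : ℕ) :
    (O * diagonal d * Oᵀ) ^ m * (O * Oᵀ) = O * diagonal (fun i => d i ^ m) * Oᵀ := by
  induction m with
  | zero => simp
  | succ m ih =>
    have : O * Oᵀ * (O * diagonal d * Oᵀ) = O * diagonal d * Oᵀ * (O * Oᵀ) := by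
      simp only [Matrix.mul_assoc]
      rw [← Matrix.mul_assoc Oᵀ O, hO, ← Matrix.mul_assoc Oᵀ O, hO]
      simp
    rw [pow_succ, Matrix.mul_assoc, ← this, ← Matrix.mul_assoc, ih]
    simp only [Matrix.mul_assoc]
    rw [← Matrix.mul_assoc Oᵀ O, hO, Matrix.one_mul, ← Matrix.mul_assoc (diagonal _),
      diagonal_mul_diagonal]
    simp [pow_succ]

/-- The spectral theorem for all powers at once: in the eigenbasis `O` the quadratic form and the
trace of `Y ^ m` are weighted sums of the `m`-th powers of the eigenvalues `d`. -/
lemma exists_spectral_pow {Y : Matrix H H ℝ} (hY : Y.PosSemidef) :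
    ∃ (O : Matrix H H ℝ) (d : H → ℝ), O * Oᵀ = 1 ∧ Oᵀ * O = 1 ∧ (∀ i, 0 ≤ d i) ∧
      (∀ m : ℕ, Y ^ m = O * diagonal (fun i => d i ^ m) * Oᵀ) ∧
      (∀ m : ℕ, (Y ^ m).trace = ∑ i, d i ^ m) ∧
      (∀ (m : ℕ) (u : H → ℝ), u ⬝ᵥ (Y ^ m) *ᵥ u = ∑ i, d i ^ m * (Oᵀ *ᵥ u) i ^ 2) := by
  obtain ⟨O, d, h1, h2, h3, h4⟩ := exists_spectral hY
  have hp : ∀ m : ℕ, Y ^ m = O * diagonal (fun i => d i ^ m) * Oᵀ := by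
    intro m
    have := spectral_pow (d := d) h2 m
    rwa [h1, Matrix.mul_one, ← h4] at this
  refine ⟨O, d, h1, h2, h3, hp, ?_, ?_⟩
  · intro m
    rw [hp, trace_mul_comm, ← Matrix.mul_assoc, h2, Matrix.one_mul, trace_diagonal]
  · intro m u
    rw [hp, ← mulVec_mulVec, ← mulVec_mulVec, dotProduct_mulVec, ← mulVec_transpose]
    simp only [dotProduct, mulVec_diagonal]
    exact Finset.sum_congr rfl fun i _ => by ring

lemma sum_sq_orthogonal_mulVec {O : Matrix H H ℝ} (hO : O * Oᵀ = 1) (u : H → ℝ) :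
    ∑ i, (Oᵀ *ᵥ u) i ^ 2 = u ⬝ᵥ u := by
  have : (Oᵀ *ᵥ u) ⬝ᵥ (Oᵀ *ᵥ u) = u ⬝ᵥ u := by
    rw [dotProduct_mulVec, vecMul_transpose, mulVec_mulVec, hO, one_mulVec]
  rw [← this]
  simp [dotProduct, sq]

lemma dotProduct_pow_mulVec_nonneg {Y : Matrix H H ℝ} (hY : Y.PosSemidef) (m : ℕ) (u : H → ℝ) :
    0 ≤ u ⬝ᵥ (Y ^ m) *ᵥ u := by
  simpa using (hY.pow m).dotProduct_mulVec_nonneg u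

/-- Jensen's inequality for the spectral measure of a vector of length at most one. -/
lemma pow_dotProduct_mulVec_le {Y : Matrix H H ℝ} (hY : Y.PosSemidef) {q : ℕ} (hq : 1 ≤ q)
    (u : H → ℝ) (hu : u ⬝ᵥ u ≤ 1) : (u ⬝ᵥ Y *ᵥ u) ^ q ≤ u ⬝ᵥ (Y ^ q) *ᵥ u := by
  obtain ⟨O, d, h1, -, hd, -, -, hquad⟩ := exists_spectral_pow hY
  have e1 := hquad 1 u
  simp only [pow_one] at e1
  rw [e1, hquad q u]
  set w : H → ℝ := fun i => (Oᵀ *ᵥ u) i ^ 2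
  have hw : ∀ i, 0 ≤ w i := fun i => sq_nonneg _
  have hW : ∑ i, w i ≤ 1 := by rw [sum_sq_orthogonal_mulVec h1]; exact hu
  set W := ∑ i, w i with hWdef
  have hW0 : 0 ≤ W := Finset.sum_nonneg fun i _ => hw i
  change (∑ i, d i * w i) ^ q ≤ ∑ i, d i ^ q * w i
  rcases hW0.eq_or_lt with h0 | h0
  · have : ∀ i, w i = 0 := fun i =>
      (Finset.sum_eq_zero_iff_of_nonneg fun i _ => hw i).1 h0.symm i (Finset.mem_univ i)
    simp only [this, mul_zero, Finset.sum_const_zero]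
    exact (zero_pow (by omega)).le
  · have key := Real.pow_arith_mean_le_arith_mean_pow Finset.univ (fun i => w i / W) d
      (fun i _ => div_nonneg (hw i) h0.le)
      (by rw [← Finset.sum_div, ← hWdef, div_self h0.ne']) (fun i _ => hd i) q
    have e2 : ∑ i, w i / W * d i = (∑ i, d i * w i) / W := by
      rw [Finset.sum_div]; exact Finset.sum_congr rfl fun i _ => by ring
    have e3 : ∑ i, w i / W * d i ^ q = (∑ i, d i ^ q * w i) / W := by
      rw [Finset.sum_div]; exact Finset.sum_congr rfl fun i _ => by ring
    rw [e2, e3, div_pow, div_le_div_iff₀ (pow_pos h0 q) h0] at key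
    have hS : 0 ≤ ∑ i, d i ^ q * w i :=
      Finset.sum_nonneg fun i _ => mul_nonneg (pow_nonneg (hd i) q) (hw i)
    have hWq : W ^ q ≤ W := pow_le_of_le_one hW0 hW (by omega)
    have := key.trans (mul_le_mul_of_nonneg_left hWq hS)
    exact le_of_mul_le_mul_right this h0

/-- Jensen's trace inequality for powers and a symmetric contraction `Q`. -/
lemma trace_pow_contraction_le {Y Q : Matrix H H ℝ} (hY : Y.PosSemidef) (hQ : Qᵀ = Q)
    (hQ1 : ∀ u, (Q *ᵥ u) ⬝ᵥ (Q *ᵥ u) ≤ u ⬝ᵥ u) {q : ℕ} (hq : 1 ≤ q) :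
    ((Q * Y * Q) ^ q).trace ≤ (Q * Y ^ q * Q).trace := by
  have hW : (Q * Y * Q).PosSemidef := by
    have := hY.mul_mul_conjTranspose_same Q
    rwa [conjTranspose_eq_transpose_of_trivial, hQ] at this
  obtain ⟨O, d, h1, h2, hd, hpow, htr, -⟩ := exists_spectral_pow hW
  have hcol : ∀ i, O.col i ⬝ᵥ O.col i = 1 := by
    intro i
    have := congrFun (congrFun h2 i) i
    simpa [Matrix.mul_apply, dotProduct] using this
  have hentry : ∀ (M : Matrix H H ℝ) i,
      (Oᵀ * (Q * M * Q) * O) i i = (Q *ᵥ O.col i) ⬝ᵥ M *ᵥ (Q *ᵥ O.col i) := by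
    intro M i
    have : (Oᵀ * (Q * M * Q) * O) i i = O.col i ⬝ᵥ (Q * M * Q) *ᵥ O.col i := by
      rw [Matrix.mul_assoc, Matrix.mul_apply]
      rfl
    rw [this, ← mulVec_mulVec, ← mulVec_mulVec, dotProduct_mulVec, ← mulVec_transpose, hQ]
  have hdi : ∀ i, d i = (Q *ᵥ O.col i) ⬝ᵥ Y *ᵥ (Q *ᵥ O.col i) := by
    intro i
    rw [← hentry]
    have h := hpow 1
    simp only [pow_one] at h
    rw [h]
    have : Oᵀ * (O * diagonal d * Oᵀ) * O = diagonal d := by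
      simp only [Matrix.mul_assoc]
      rw [h2, Matrix.mul_one, ← Matrix.mul_assoc, h2, Matrix.one_mul]
    change d i = (Oᵀ * (O * diagonal d * Oᵀ) * O) i i
    rw [this, diagonal_apply_eq]
  rw [htr]
  calc ∑ i, d i ^ q ≤ ∑ i, (Q *ᵥ O.col i) ⬝ᵥ (Y ^ q) *ᵥ (Q *ᵥ O.col i) := by
        refine Finset.sum_le_sum fun i _ => ?_
        rw [hdi i]
        exact pow_dotProduct_mulVec_le hY hq _ ((hQ1 _).trans (hcol i).le)
    _ = (Oᵀ * (Q * Y ^ q * Q) * O).trace := by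
        simp only [Matrix.trace, diag_apply, hentry]
    _ = (Q * Y ^ q * Q).trace := by
        rw [trace_mul_comm, ← Matrix.mul_assoc, h1, Matrix.one_mul]

lemma trace_pow_mul_comm (A B : Matrix H H ℝ) (q : ℕ) :
    ((A * B) ^ q).trace = ((B * A) ^ q).trace := by
  cases q with
  | zero => simp
  | succ q =>
    have : ∀ m : ℕ, (A * B) ^ m * A = A * (B * A) ^ m := by
      intro m
      induction m with
      | zero => simp
      | succ m ih =>
        calc (A * B) ^ (m + 1) * A = (A * B) ^ m * A * (B * A) := by
              rw [pow_succ]; simp only [Matrix.mul_assoc]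
          _ = A * (B * A) ^ (m + 1) := by rw [ih, pow_succ]; simp only [Matrix.mul_assoc]
    rw [pow_succ, ← Matrix.mul_assoc, this, trace_mul_comm, ← Matrix.mul_assoc, pow_succ']

lemma exists_sqrt {Y : Matrix H H ℝ} (hY : Y.PosSemidef) :
    ∃ P : Matrix H H ℝ, Pᵀ = P ∧ P * P = Y := by
  obtain ⟨O, d, -, h2, hd, h4⟩ := exists_spectral hY
  refine ⟨O * diagonal (fun i => √(d i)) * Oᵀ, ?_, ?_⟩
  · simp [transpose_mul, Matrix.mul_assoc]
  · rw [h4]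
    simp only [Matrix.mul_assoc]
    rw [← Matrix.mul_assoc Oᵀ O, h2, Matrix.one_mul, ← Matrix.mul_assoc (diagonal _),
      diagonal_mul_diagonal]
    simp [Real.mul_self_sqrt, hd]

/-- The Sherman–Morrison formula for a positive rank-one update. -/
lemma inv_add_rankOne {B : Matrix H H ℝ} (hB : B.PosDef) (r : H → ℝ) {β : ℝ} (hβ : 0 ≤ β) :
    (B + β • vecMulVec r r)⁻¹ =
      B⁻¹ - (β / (1 + β * (r ⬝ᵥ B⁻¹ *ᵥ r))) • vecMulVec (B⁻¹ *ᵥ r) (B⁻¹ *ᵥ r) := by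
  have hu : IsUnit B.det := (Matrix.isUnit_iff_isUnit_det _).1 hB.isUnit
  have hsym : (B⁻¹)ᵀ = B⁻¹ := by
    have := hB.inv.isHermitian
    rwa [IsHermitian, conjTranspose_eq_transpose_of_trivial] at this
  have ht : 0 ≤ r ⬝ᵥ B⁻¹ *ᵥ r := by simpa using hB.inv.posSemidef.dotProduct_mulVec_nonneg r
  set t := r ⬝ᵥ B⁻¹ *ᵥ r with htdef
  have hden : (1 + β * t) ≠ 0 := by positivity
  apply inv_eq_right_inv
  have e1 : B * vecMulVec (B⁻¹ *ᵥ r) (B⁻¹ *ᵥ r) = vecMulVec r (B⁻¹ *ᵥ r) := by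
    rw [mul_vecMulVec, mulVec_mulVec, mul_nonsing_inv _ hu, one_mulVec]
  have e2 : vecMulVec r r * B⁻¹ = vecMulVec r (B⁻¹ *ᵥ r) := by
    rw [vecMulVec_mul, ← mulVec_transpose, hsym]
  have e3 : vecMulVec r r * vecMulVec (B⁻¹ *ᵥ r) (B⁻¹ *ᵥ r) = t • vecMulVec r (B⁻¹ *ᵥ r) := by
    rw [vecMulVec_mul_vecMulVec, ← htdef]
    ext i j
    simp [vecMulVec_apply]
    ring
  rw [Matrix.add_mul, Matrix.mul_sub, Matrix.mul_sub, Matrix.mul_smul, e1, mul_nonsing_inv _ hu,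
    Matrix.smul_mul, e2, Matrix.smul_mul, Matrix.mul_smul, e3]
  ext i j
  simp only [Matrix.add_apply, Matrix.sub_apply, Matrix.smul_apply, smul_eq_mul]
  field_simp
  ring

/-- How much a positive rank-one update of `B` decreases the trace of the `q`-th power of the
inverse. With `Y = P * P`, the updated inverse is `P * Q ^ 2 * P` for a symmetric contraction `Q`,
so that the claim reduces to Jensen's trace inequality for `Q * Y * Q`. -/
lemma trace_pow_inv_add_rankOne_le {B : Matrix H H ℝ} (hB : B.PosDef) (r : H → ℝ) {β : ℝ}
    (hβ : 0 ≤ β) {q : ℕ} (hq : 1 ≤ q) :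
    (((B + β • vecMulVec r r)⁻¹) ^ q).trace ≤ ((B⁻¹) ^ q).trace -
      β / (1 + β * (r ⬝ᵥ B⁻¹ *ᵥ r)) * (r ⬝ᵥ (B⁻¹) ^ (q + 1) *ᵥ r) := by
  rw [inv_add_rankOne hB r hβ]
  have hY : (B⁻¹).PosSemidef := hB.inv.posSemidef
  set Y := B⁻¹
  obtain ⟨P, hP, hPP⟩ := exists_sqrt hY
  have ht : 0 ≤ r ⬝ᵥ Y *ᵥ r := by simpa using hY.dotProduct_mulVec_nonneg r
  set t := r ⬝ᵥ Y *ᵥ r with htdef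
  set c := β / (1 + β * t) with hc
  have hc0 : 0 ≤ c := by positivity
  have hct : c * t ≤ 1 := by
    rw [hc, div_mul_eq_mul_div, div_le_one (by positivity)]; linarith
  set v := P *ᵥ r with hv
  have hvv : v ⬝ᵥ v = t := by
    rw [htdef, ← hPP, ← mulVec_mulVec, symm_dotProduct_mulVec hP r]
  -- `γ` is the root of `γ * (2 - γ * t) = c` that makes `(1 - γ v vᵀ) ^ 2 = 1 - c v vᵀ`.
  set w := √(1 - c * t) with hw
  have hw0 : 0 ≤ w := Real.sqrt_nonneg _
  have hw2 : w ^ 2 = 1 - c * t := Real.sq_sqrt (by linarith)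
  set γ := c / (1 + w) with hγ
  have hγc : 2 * γ - γ ^ 2 * t = c := by
    have h1 : γ * (1 + w) = c := by rw [hγ]; field_simp
    have h2 : c * t = (1 - w) * (1 + w) := by linarith
    have h3 : γ * t = 1 - w := by
      have h5 : γ * t * (1 + w) = (1 - w) * (1 + w) := by rw [← h2, ← h1]; ring
      exact mul_right_cancel₀ (by positivity) h5
    calc 2 * γ - γ ^ 2 * t = γ * (2 - γ * t) := by ring
      _ = c := by rw [h3, ← h1]; ring
  set Q : Matrix H H ℝ := 1 - γ • vecMulVec v v with hQdef
  have hQt : Qᵀ = Q := by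
    rw [hQdef, transpose_sub, transpose_smul, transpose_vecMulVec, transpose_one]
  have hQQ : Q * Q = 1 - c • vecMulVec v v := by
    have e3 : vecMulVec v v * vecMulVec v v = t • vecMulVec v v := by
      rw [vecMulVec_mul_vecMulVec, hvv]
      ext i j
      simp [vecMulVec_apply]
      ring
    rw [hQdef, Matrix.sub_mul, Matrix.mul_sub, Matrix.mul_sub, Matrix.one_mul, Matrix.one_mul,
      Matrix.mul_one, Matrix.smul_mul, Matrix.mul_smul, e3, ← hγc]
    ext i j
    simp only [Matrix.sub_apply, Matrix.smul_apply, smul_eq_mul]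
    ring
  have hQ1 : ∀ u, (Q *ᵥ u) ⬝ᵥ (Q *ᵥ u) ≤ u ⬝ᵥ u := by
    intro u
    rw [← symm_dotProduct_mulVec hQt, mulVec_mulVec, hQQ, sub_mulVec, one_mulVec, smul_mulVec,
      vecMulVec_mulVec', dotProduct_sub, dotProduct_smul, dotProduct_smul, dotProduct_comm u v]
    have : 0 ≤ c * (v ⬝ᵥ u * (v ⬝ᵥ u)) := mul_nonneg hc0 (mul_self_nonneg _)
    simp only [smul_eq_mul]
    linarith
  have hY' : Y - c • vecMulVec (Y *ᵥ r) (Y *ᵥ r) = (P * Q) * (Q * P) := by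
    have e1 : P * vecMulVec v v * P = vecMulVec (Y *ᵥ r) (Y *ᵥ r) := by
      rw [mul_vecMulVec, vecMulVec_mul, ← mulVec_transpose, hP, hv, mulVec_mulVec, hPP]
    rw [Matrix.mul_assoc, ← Matrix.mul_assoc Q Q, hQQ, Matrix.sub_mul, Matrix.mul_sub,
      Matrix.one_mul, hPP, Matrix.smul_mul, Matrix.mul_smul, ← Matrix.mul_assoc, e1]
  rw [hY', trace_pow_mul_comm, Matrix.mul_assoc, ← Matrix.mul_assoc P P, hPP, ← Matrix.mul_assoc]
  refine (trace_pow_contraction_le hY hQt hQ1 hq).trans ?_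
  rw [trace_mul_comm, ← Matrix.mul_assoc, hQQ, Matrix.sub_mul, Matrix.one_mul, trace_sub,
    Matrix.smul_mul, trace_smul, vecMulVec_mul, trace_vecMulVec]
  apply le_of_eq
  congr 1
  rw [smul_eq_mul]
  congr 1
  have hYP : ∀ m : ℕ, P * Y ^ m = Y ^ m * P := by
    intro m
    have hPY : Commute P Y := by
      rw [← hPP]
      exact (Commute.refl P).mul_right (Commute.refl P)
    exact (hPY.pow_right m).eq
  rw [dotProduct_comm, ← dotProduct_mulVec, hv, ← symm_dotProduct_mulVec hP, mulVec_mulVec,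
    mulVec_mulVec, hYP, Matrix.mul_assoc, hPP, pow_succ]

lemma dotProduct_pow_succ_mulVec_le {Y : Matrix H H ℝ} (hY : Y.PosSemidef) (q : ℕ) (r : H → ℝ) :
    r ⬝ᵥ (Y ^ (q + 1)) *ᵥ r ≤ (Y ^ q).trace * (r ⬝ᵥ Y *ᵥ r) := by
  obtain ⟨O, d, h1, -, hd, -, htr, hquad⟩ := exists_spectral_pow hY
  have e1 := hquad 1 r
  simp only [pow_one] at e1
  rw [hquad, htr, e1, Finset.mul_sum]
  refine Finset.sum_le_sum fun i _ => ?_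
  rw [pow_succ, mul_assoc]
  refine mul_le_mul_of_nonneg_right ?_ (mul_nonneg (hd i) (sq_nonneg _))
  exact Finset.single_le_sum (f := fun i => d i ^ q) (fun j _ => pow_nonneg (hd j) q)
    (Finset.mem_univ i)

/-- The largest eigenvalue is at most the `q`-th root of the trace of the `q`-th power. -/
lemma dotProduct_mulVec_le_rpow_trace {Y : Matrix H H ℝ} (hY : Y.PosSemidef) {q : ℕ}
    (hq : 1 ≤ q) (r : H → ℝ) :
    r ⬝ᵥ Y *ᵥ r ≤ ((Y ^ q).trace) ^ (1 / (q : ℝ)) * (r ⬝ᵥ r) := by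
  obtain ⟨O, d, h1, -, hd, -, htr, hquad⟩ := exists_spectral_pow hY
  have e1 := hquad 1 r
  simp only [pow_one] at e1
  rw [e1, htr, ← sum_sq_orthogonal_mulVec h1, Finset.mul_sum]
  refine Finset.sum_le_sum fun i _ => mul_le_mul_of_nonneg_right ?_ (sq_nonneg _)
  have h : d i ^ q ≤ ∑ j, d j ^ q :=
    Finset.single_le_sum (f := fun i => d i ^ q) (fun j _ => pow_nonneg (hd j) q)
      (Finset.mem_univ i)
  calc d i = (d i ^ q) ^ (1 / (q : ℝ)) := by
        rw [one_div, Real.pow_rpow_inv_natCast (hd i) (by omega)]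
    _ ≤ _ := Real.rpow_le_rpow (pow_nonneg (hd i) q) h (by positivity)

/-- The power mean inequality between the traces of consecutive powers. -/
lemma rpow_trace_pow_le {Y : Matrix H H ℝ} (hY : Y.PosSemidef) {q : ℕ} (hq : 1 ≤ q) :
    ((Y ^ q).trace) ^ (1 + 1 / (q : ℝ)) ≤
      (Fintype.card H : ℝ) ^ (1 / (q : ℝ)) * (Y ^ (q + 1)).trace := by
  obtain ⟨O, d, -, -, hd, -, htr, -⟩ := exists_spectral_pow hY
  rw [htr, htr]
  have := Real.rpow_sum_le_const_mul_sum_rpow_of_nonneg Finset.univ (f := fun i => d i ^ q)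
    (p := 1 + 1 / (q : ℝ)) (by simp) (fun i _ => pow_nonneg (hd i) q)
  refine this.trans (le_of_eq ?_)
  rw [Finset.card_univ, add_sub_cancel_left]
  congr 1
  refine Finset.sum_congr rfl fun i _ => ?_
  have hq' : (q : ℝ) ≠ 0 := by positivity
  rw [← Real.rpow_natCast, ← Real.rpow_mul (hd i), ← Real.rpow_natCast]
  congr 1
  push_cast
  field_simp

end LinearAlgebra

/-! ### Resolvents of the kernel matrix -/

section Resolvent

variable {H ι : Type*} [Fintype H] [DecidableEq H] [Fintype ι] [DecidableEq ι]

lemma transpose_eq_of_posDef {H : Type*} {A : Matrix H H ℝ} (hA : A.PosDef) : Aᵀ = A := by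
  have := hA.isHermitian
  rwa [IsHermitian, conjTranspose_eq_transpose_of_trivial] at this

lemma mulVec_inv_mulVec {A : Matrix ι ι ℝ} (hA : A.PosDef) (w : ι → ℝ) :
    A *ᵥ (A⁻¹ *ᵥ w) = w := by
  rw [mulVec_mulVec, mul_nonsing_inv _ ((Matrix.isUnit_iff_isUnit_det _).1 hA.isUnit), one_mulVec]

lemma inv_mulVec_eq {A : Matrix ι ι ℝ} (hA : A.PosDef) {w y : ι → ℝ} (h : A *ᵥ y = w) :
    A⁻¹ *ᵥ w = y := by
  rw [← h, mulVec_mulVec, nonsing_inv_mul _ ((Matrix.isUnit_iff_isUnit_det _).1 hA.isUnit),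
    one_mulVec]

lemma posDef_of_le {ι : Type*} [Fintype ι] {A : Matrix ι ι ℝ} (hA : Aᵀ = A) {s : ℝ} (hs : 0 < s)
    (h : ∀ x, s * (x ⬝ᵥ x) ≤ x ⬝ᵥ A *ᵥ x) : A.PosDef := by
  refine PosDef.of_dotProduct_mulVec_pos ?_ fun x hx => ?_
  · rwa [IsHermitian, conjTranspose_eq_transpose_of_trivial]
  · simp only [star_trivial]
    refine lt_of_lt_of_le (mul_pos hs ?_) (h x)
    refine lt_of_le_of_ne ?_ fun h0 => hx (dotProduct_self_eq_zero.1 h0.symm)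
    exact Finset.sum_nonneg fun i _ => mul_self_nonneg _

lemma dotProduct_inv_mulVec_nonneg {A : Matrix ι ι ℝ} (hA : A.PosDef) (w : ι → ℝ) :
    0 ≤ w ⬝ᵥ A⁻¹ *ᵥ w := by
  simpa using hA.inv.posSemidef.dotProduct_mulVec_nonneg w

/-- If `A` dominates both `s` and `w wᵀ`, then `A⁻¹ w` is short, whatever the length of `w`. -/
lemma normSq_inv_mulVec_le {A : Matrix ι ι ℝ} (hA : A.PosDef) {s : ℝ} (hs : 0 < s) (w : ι → ℝ)
    (h : ∀ x, (w ⬝ᵥ x) ^ 2 + s * (x ⬝ᵥ x) ≤ x ⬝ᵥ A *ᵥ x) :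
    (A⁻¹ *ᵥ w) ⬝ᵥ (A⁻¹ *ᵥ w) ≤ 1 / s := by
  have := h (A⁻¹ *ᵥ w)
  rw [mulVec_inv_mulVec hA, dotProduct_comm (A⁻¹ *ᵥ w) w] at this
  rw [le_div_iff₀ hs]
  nlinarith [sq_nonneg (w ⬝ᵥ A⁻¹ *ᵥ w - 1)]

/-- The contribution of the head column `a` to the variance: it is at most the diagonal entry of
`Q⁻¹`, where `Q` is any lower bound of the head covariance after the tail has been eliminated. -/
lemma head_resolvent_le {G : Matrix ι ι ℝ} (hG : G.PosDef) {s : ℝ} (hs : 0 < s)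
    (hGs : ∀ x, s * (x ⬝ᵥ x) ≤ x ⬝ᵥ G *ᵥ x) (Z : Matrix ι H ℝ) {lam : H → ℝ}
    (hlam : ∀ a, 0 < lam a) {Q : Matrix H H ℝ} (hQ : Q.PosDef)
    (hQW : ∀ c, c ⬝ᵥ Q *ᵥ c ≤ s * (c ⬝ᵥ (Zᵀ * G⁻¹ * Z) *ᵥ c)) (a : H)
    (hA : (G + Z * diagonal lam * Zᵀ).PosDef) :
    lam a ^ 2 * (((G + Z * diagonal lam * Zᵀ)⁻¹ *ᵥ fun i => Z i a) ⬝ᵥ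
      ((G + Z * diagonal lam * Zᵀ)⁻¹ *ᵥ fun i => Z i a)) ≤ Q⁻¹ a a := by
  set A := G + Z * diagonal lam * Zᵀ with hAdef
  set W := Zᵀ * G⁻¹ * Z with hWdef
  have hWsymm : Wᵀ = W := by
    rw [hWdef, transpose_mul, transpose_mul, transpose_transpose,
      transpose_eq_of_posDef hG.inv, Matrix.mul_assoc]
  have hW0 : ∀ c, 0 ≤ c ⬝ᵥ W *ᵥ c := by
    intro c
    rw [hWdef, ← mulVec_mulVec, ← mulVec_mulVec, dotProduct_mulVec, vecMul_transpose]
    exact dotProduct_inv_mulVec_nonneg hG _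
  have hWp : W.PosSemidef := by
    refine PosSemidef.of_dotProduct_mulVec_nonneg ?_ (by simpa using hW0)
    rwa [IsHermitian, conjTranspose_eq_transpose_of_trivial]
  have hD : (diagonal fun a => (lam a)⁻¹).PosDef :=
    PosDef.diagonal fun a => inv_pos.2 (hlam a)
  have hM : (diagonal (fun a => (lam a)⁻¹) + W).PosDef := hD.add_posSemidef hWp
  set e : H → ℝ := Pi.single a 1 with he
  set c := (diagonal (fun a => (lam a)⁻¹) + W)⁻¹ *ᵥ e with hc
  have hMc : (fun b => (lam b)⁻¹ * c b) + W *ᵥ c = e := by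
    have := mulVec_inv_mulVec hM e
    rw [← hc, add_mulVec] at this
    rw [← this]
    congr 1
    ext b
    rw [mulVec_diagonal]
  set y := G⁻¹ *ᵥ (Z *ᵥ c) with hy
  have hWc : Zᵀ *ᵥ y = W *ᵥ c := by rw [hy, hWdef, mulVec_mulVec, mulVec_mulVec, Matrix.mul_assoc]
  have hAy : A *ᵥ y = lam a • fun i => Z i a := by
    have h1 : A *ᵥ y = Z *ᵥ (c + fun b => lam b * (W *ᵥ c) b) := by
      rw [hAdef, add_mulVec, hy, mulVec_inv_mulVec hG, ← hy, ← mulVec_mulVec, ← mulVec_mulVec, hWc,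
        mulVec_add]
      congr 2
      ext b
      rw [mulVec_diagonal]
    have h2 : (c + fun b => lam b * (W *ᵥ c) b) = lam a • e := by
      ext b
      have hb := congrFun hMc b
      simp only [Pi.add_apply] at hb
      have hl := (hlam b).ne'
      have : c b + lam b * (W *ᵥ c) b = lam b * e b := by
        rw [← hb]; field_simp
      simp only [Pi.add_apply, Pi.smul_apply, smul_eq_mul, this]
      by_cases hba : b = a
      · rw [hba]
      · simp [he, Pi.single_eq_of_ne hba]
    rw [h1, h2, mulVec_smul, he, mulVec_single_one]
    rfl
  have hyA : lam a • (A⁻¹ *ᵥ fun i => Z i a) = y := by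
    rw [← mulVec_smul]
    exact inv_mulVec_eq hA hAy
  have hlhs : lam a ^ 2 * ((A⁻¹ *ᵥ fun i => Z i a) ⬝ᵥ (A⁻¹ *ᵥ fun i => Z i a)) = y ⬝ᵥ y := by
    rw [← hyA, smul_dotProduct, dotProduct_smul]
    simp only [smul_eq_mul]
    ring
  rw [hlhs]
  set α := c ⬝ᵥ W *ᵥ c with hα
  have h1 : s * (y ⬝ᵥ y) ≤ α := by
    refine (hGs y).trans (le_of_eq ?_)
    rw [hy, mulVec_inv_mulVec hG, ← hy, dotProduct_mulVec, ← mulVec_transpose, hWc,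
      dotProduct_comm]
  have h2 : α ≤ c ⬝ᵥ e := by
    rw [← hMc, dotProduct_add]
    refine le_add_of_nonneg_left (Finset.sum_nonneg fun b _ => ?_)
    have := inv_pos.2 (hlam b)
    nlinarith [mul_nonneg this.le (mul_self_nonneg (c b))]
  have h3 : 0 ≤ ((1 / s) • c - Q⁻¹ *ᵥ e) ⬝ᵥ Q *ᵥ ((1 / s) • c - Q⁻¹ *ᵥ e) := by
    simpa using hQ.posSemidef.dotProduct_mulVec_nonneg ((1 / s) • c - Q⁻¹ *ᵥ e)
  have h4 : e ⬝ᵥ Q⁻¹ *ᵥ e = Q⁻¹ a a := by simp [he]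
  rw [mulVec_sub, mulVec_inv_mulVec hQ, mulVec_smul, sub_dotProduct, dotProduct_sub,
    dotProduct_sub, smul_dotProduct, smul_dotProduct, dotProduct_smul,
    dotProduct_smul, symm_dotProduct_mulVec (transpose_eq_of_posDef hQ) (Q⁻¹ *ᵥ e),
    mulVec_inv_mulVec hQ, dotProduct_comm (Q⁻¹ *ᵥ e) e, h4, dotProduct_comm e c] at h3
  simp only [smul_eq_mul] at h3
  have h5 := hQW c
  have hs1 : 0 < 1 / s := by positivity
  have h6 : 1 / s * (1 / s * (c ⬝ᵥ Q *ᵥ c)) ≤ 1 / s * α := by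
    refine mul_le_mul_of_nonneg_left ?_ hs1.le
    calc 1 / s * (c ⬝ᵥ Q *ᵥ c) ≤ 1 / s * (s * α) := mul_le_mul_of_nonneg_left h5 hs1.le
      _ = α := by field_simp
  have h7 : y ⬝ᵥ y ≤ 1 / s * α := by
    rw [one_div, inv_mul_eq_div, le_div_iff₀ hs]; linarith
  have h8 : 1 / s * α ≤ 1 / s * (c ⬝ᵥ e) := mul_le_mul_of_nonneg_left h2 hs1.le
  linarith

end Resolvent

/-! ### Adding one sample to the kernel matrix -/

section Kernel

variable {E : Type*}

/-- A symmetric positive semidefinite kernel. -/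
structure IsPSDKernel (κ : E → E → ℝ) : Prop where
  symm : ∀ x y, κ x y = κ y x
  nonneg : ∀ (n : ℕ) (X : Fin n → E) (c : Fin n → ℝ), 0 ≤ ∑ i, ∑ j, c i * c j * κ (X i) (X j)

/-- The regularized kernel matrix `s I + κ(X, X)`. -/
noncomputable def kernelRidge (κ : E → E → ℝ) (s : ℝ) {n : ℕ} (X : Fin n → E) :
    Matrix (Fin n) (Fin n) ℝ :=
  s • (1 : Matrix (Fin n) (Fin n) ℝ) + Matrix.of fun i j => κ (X i) (X j)

/-- The bilinear form `f(X)ᵀ (s I + κ(X, X))⁻¹ g(X)`. -/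
noncomputable def resolventForm (κ : E → E → ℝ) (s : ℝ) (f g : E → ℝ) {n : ℕ} (X : Fin n → E) : ℝ :=
  (fun i => f (X i)) ⬝ᵥ (kernelRidge κ s X)⁻¹ *ᵥ fun i => g (X i)

/-- The residual at `x` of the kernel ridge regression of `f` on the sample `X`. -/
noncomputable def kernelResidual (κ : E → E → ℝ) (s : ℝ) (f : E → ℝ) {n : ℕ} (X : Fin n → E)
    (x : E) : ℝ :=
  f x - (fun i => κ x (X i)) ⬝ᵥ (kernelRidge κ s X)⁻¹ *ᵥ fun i => f (X i)

/-- The Schur complement of the new diagonal entry when `x` joins the sample `X`. -/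
noncomputable def kernelPivot (κ : E → E → ℝ) (s : ℝ) {n : ℕ} (X : Fin n → E) (x : E) : ℝ :=
  s + κ x x - (fun i => κ x (X i)) ⬝ᵥ (kernelRidge κ s X)⁻¹ *ᵥ fun i => κ x (X i)

variable {κ : E → E → ℝ} {s : ℝ} {n : ℕ}

lemma kernelRidge_mulVec (X : Fin n → E) (c : Fin n → ℝ) (i : Fin n) :
    (kernelRidge κ s X *ᵥ c) i = s * c i + ∑ j, κ (X i) (X j) * c j := by
  rw [kernelRidge, add_mulVec, smul_mulVec, one_mulVec]
  rfl

lemma kernelRidge_quadratic (X : Fin n → E) (c : Fin n → ℝ) :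
    c ⬝ᵥ kernelRidge κ s X *ᵥ c =
      s * (c ⬝ᵥ c) + ∑ i, ∑ j, c i * c j * κ (X i) (X j) := by
  simp only [dotProduct, kernelRidge_mulVec, mul_add, Finset.sum_add_distrib, Finset.mul_sum]
  congr 1
  · exact Finset.sum_congr rfl fun i _ => by ring
  · exact Finset.sum_congr rfl fun i _ => Finset.sum_congr rfl fun j _ => by ring

lemma kernelRidge_lower (hκ : IsPSDKernel κ) (X : Fin n → E) (c : Fin n → ℝ) :
    s * (c ⬝ᵥ c) ≤ c ⬝ᵥ kernelRidge κ s X *ᵥ c := by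
  have h := hκ.nonneg n X c
  rw [kernelRidge_quadratic]
  linarith

lemma kernelRidge_posDef (hκ : IsPSDKernel κ) (hs : 0 < s) (X : Fin n → E) :
    (kernelRidge κ s X).PosDef := by
  refine posDef_of_le ?_ hs (kernelRidge_lower hκ X)
  ext i j
  simp [kernelRidge, Matrix.one_apply, hκ.symm (X j) (X i), eq_comm]

lemma le_kernelPivot (hκ : IsPSDKernel κ) (hs : 0 < s) (X : Fin n → E) (x : E) :
    s ≤ kernelPivot κ s X x := by
  have hG := kernelRidge_posDef hκ hs X
  set k : Fin n → ℝ := fun i => κ x (X i) with hk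
  set y := (kernelRidge κ s X)⁻¹ *ᵥ k with hy
  have h := hκ.nonneg (n + 1) (Fin.cons x X) (Fin.cons 1 (-y))
  simp only [Fin.sum_univ_succ, Fin.cons_zero, Fin.cons_succ, Pi.neg_apply] at h
  have h1 : y ⬝ᵥ kernelRidge κ s X *ᵥ y = k ⬝ᵥ y := by
    rw [hy, mulVec_inv_mulVec hG, dotProduct_comm]
  have h2 := kernelRidge_quadratic (κ := κ) (s := s) X y
  have h3 : ∑ i, -y i * 1 * κ (X i) x = -(k ⬝ᵥ y) := by
    simp only [dotProduct, ← Finset.sum_neg_distrib, hk]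
    exact Finset.sum_congr rfl fun i _ => by rw [hκ.symm]; ring
  have h4 : ∑ i, 1 * -y i * κ x (X i) = -(k ⬝ᵥ y) := by
    simp only [dotProduct, ← Finset.sum_neg_distrib, hk]
    exact Finset.sum_congr rfl fun i _ => by ring
  have h5 : 0 ≤ y ⬝ᵥ y := Finset.sum_nonneg fun i _ => mul_self_nonneg _
  simp only [neg_mul_neg, Finset.sum_add_distrib] at h
  rw [h3, h4] at h
  have h6 : kernelPivot κ s X x = s + κ x x - k ⬝ᵥ y := rfl
  have h7 := mul_nonneg hs.le h5
  linarith

lemma kernelPivot_le (hκ : IsPSDKernel κ) (hs : 0 < s) (X : Fin n → E) (x : E) :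
    kernelPivot κ s X x ≤ s + κ x x := by
  have := dotProduct_inv_mulVec_nonneg (kernelRidge_posDef hκ hs X) fun i => κ x (X i)
  unfold kernelPivot
  linarith

/-- Block elimination: a new sample changes the form by a product of residuals. -/
lemma resolventForm_cons (hκ : IsPSDKernel κ) (hs : 0 < s) (f g : E → ℝ) (X : Fin n → E) (x : E) :
    resolventForm κ s f g (Fin.cons x X : Fin (n + 1) → E) = resolventForm κ s f g X +
      kernelResidual κ s f X x * kernelResidual κ s g X x / kernelPivot κ s X x := by
  have hG := kernelRidge_posDef hκ hs X
  have hG' := kernelRidge_posDef hκ hs (Fin.cons x X : Fin (n + 1) → E)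
  have hp := hs.trans_le (le_kernelPivot hκ hs X x)
  set p := kernelPivot κ s X x with hpdef
  set k : Fin n → ℝ := fun i => κ x (X i) with hk
  set y := (kernelRidge κ s X)⁻¹ *ᵥ k with hy
  set η := (kernelRidge κ s X)⁻¹ *ᵥ fun i => g (X i) with hη
  have hpe : p = s + κ x x - k ⬝ᵥ y := rfl
  have hr : kernelResidual κ s g X x = g x - k ⬝ᵥ η := rfl
  set t := kernelResidual κ s g X x / p with ht
  have hsol : (kernelRidge κ s (Fin.cons x X : Fin (n + 1) → E))⁻¹ *ᵥ
      (fun i => g ((Fin.cons x X : Fin (n + 1) → E) i)) = Fin.cons t (η - t • y) := by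
    refine inv_mulVec_eq hG' ?_
    have htp : t * p = g x - k ⬝ᵥ η := by rw [ht, ← hr]; field_simp
    ext i
    rw [kernelRidge_mulVec]
    refine Fin.cases ?_ (fun i => ?_) i
    · simp only [Fin.sum_univ_succ, Fin.cons_zero, Fin.cons_succ]
      have : ∑ j, κ x (X j) * (η - t • y) j = k ⬝ᵥ η - t * (k ⬝ᵥ y) := by
        change k ⬝ᵥ (η - t • y) = _
        rw [dotProduct_sub, dotProduct_smul, smul_eq_mul]
      rw [this]
      rw [hpe] at htp
      linarith
    · simp only [Fin.sum_univ_succ, Fin.cons_zero, Fin.cons_succ]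
      have h1 := congrFun (mulVec_inv_mulVec hG fun i => g (X i)) i
      have h2 := congrFun (mulVec_inv_mulVec hG k) i
      rw [← hη, kernelRidge_mulVec] at h1
      rw [← hy, kernelRidge_mulVec] at h2
      have : ∑ j, κ (X i) (X j) * (η - t • y) j =
          ∑ j, κ (X i) (X j) * η j - t * ∑ j, κ (X i) (X j) * y j := by
        rw [Finset.mul_sum, ← Finset.sum_sub_distrib]
        refine Finset.sum_congr rfl fun j _ => ?_
        simp only [Pi.sub_apply, Pi.smul_apply, smul_eq_mul]
        ring
      rw [this, hκ.symm (X i) x]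
      simp only [Pi.sub_apply, Pi.smul_apply, smul_eq_mul]
      have h3 : k i = κ x (X i) := rfl
      rw [← h3, ← h1, ← h2]
      ring
  unfold resolventForm
  rw [hsol]
  have hfy : (fun i => f (X i)) ⬝ᵥ y = k ⬝ᵥ (kernelRidge κ s X)⁻¹ *ᵥ fun i => f (X i) := by
    rw [hy, symm_dotProduct_mulVec (transpose_eq_of_posDef hG.inv), dotProduct_comm]
  have hrf : kernelResidual κ s f X x = f x - (fun i => f (X i)) ⬝ᵥ y := by rw [hfy]; rfl
  have hexp : (fun i => f ((Fin.cons x X : Fin (n + 1) → E) i)) ⬝ᵥ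
      (Fin.cons t (η - t • y) : Fin (n + 1) → ℝ) =
      f x * t + (fun i => f (X i)) ⬝ᵥ (η - t • y) := by
    simp [dotProduct, Fin.sum_univ_succ]
  rw [hexp, dotProduct_sub, dotProduct_smul, smul_eq_mul, mul_div_assoc, ← ht, hrf]
  ring

lemma resolventForm_self_nonneg (hκ : IsPSDKernel κ) (hs : 0 < s) (f : E → ℝ) (X : Fin n → E) :
    0 ≤ resolventForm κ s f f X :=
  dotProduct_inv_mulVec_nonneg (kernelRidge_posDef hκ hs X) _

lemma resolventForm_symm (hκ : IsPSDKernel κ) (hs : 0 < s) (f g : E → ℝ) (X : Fin n → E) :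
    resolventForm κ s f g X = resolventForm κ s g f X := by
  unfold resolventForm
  rw [symm_dotProduct_mulVec (transpose_eq_of_posDef (kernelRidge_posDef hκ hs X).inv),
    dotProduct_comm]

end Kernel

/-! ### Integrating out one sample at a time -/

section Recursion

variable {E : Type*} [MeasurableSpace E]

/-- A functional of the sample that is multiplied by at most `r`, in the mean, whenever a sample is
added. -/
lemma lintegral_pi_le_pow (μ : Measure E) [IsProbabilityMeasure μ]
    (F : ∀ n : ℕ, (Fin n → E) → ℝ≥0∞) (hF : ∀ n, Measurable (F n)) (r : ℝ≥0∞)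
    (hstep : ∀ n X, ∫⁻ x, F (n + 1) (Fin.cons x X : Fin (n + 1) → E) ∂μ ≤ r * F n X) (n : ℕ) :
    ∫⁻ X, F n X ∂(Measure.pi fun _ : Fin n => μ) ≤ r ^ n * F 0 Fin.elim0 := by
  induction n with
  | zero =>
    have : ∀ X : Fin 0 → E, F 0 X = F 0 Fin.elim0 := fun X => congrArg _ (Subsingleton.elim _ _)
    simp [this]
  | succ n ih =>
    have hmp := (measurePreserving_piFinSuccAbove (fun _ : Fin (n + 1) => μ) 0).symm
    rw [← hmp.lintegral_comp (hF (n + 1))]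
    have hmeas : Measurable fun q : E × (Fin n → E) =>
        F (n + 1) (Fin.cons q.1 q.2 : Fin (n + 1) → E) := by
      refine (hF (n + 1)).comp (measurable_pi_iff.2 fun i => ?_)
      refine Fin.cases ?_ (fun i => ?_) i
      · exact measurable_fst
      · exact (measurable_pi_apply i).comp measurable_snd
    have heq : ∀ q : E × (Fin n → E),
        F (n + 1) ((MeasurableEquiv.piFinSuccAbove (fun _ : Fin (n + 1) => E) 0).symm q) =
          F (n + 1) (Fin.cons q.1 q.2 : Fin (n + 1) → E) := by
      intro q
      congr 1
      funext i
      refine Fin.cases ?_ (fun i => ?_) i <;> rfl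
    simp only [heq]
    change ∫⁻ q : E × (Fin n → E), F (n + 1) (Fin.cons q.1 q.2 : Fin (n + 1) → E)
      ∂(μ.prod (Measure.pi fun _ : Fin n => μ)) ≤ _
    rw [lintegral_prod_symm _ hmeas.aemeasurable]
    calc ∫⁻ X, ∫⁻ x, F (n + 1) (Fin.cons x X : Fin (n + 1) → E) ∂μ
          ∂(Measure.pi fun _ : Fin n => μ)
        ≤ ∫⁻ X, r * F n X ∂(Measure.pi fun _ : Fin n => μ) := lintegral_mono fun X => hstep n X
      _ = r * ∫⁻ X, F n X ∂(Measure.pi fun _ : Fin n => μ) := lintegral_const_mul _ (hF n)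
      _ ≤ r * (r ^ n * F 0 Fin.elim0) := by gcongr
      _ = r ^ (n + 1) * F 0 Fin.elim0 := by rw [pow_succ']; ring

variable {κ : E → E → ℝ}

lemma measurable_inv_matrix {Ω m : Type*} [MeasurableSpace Ω] [Fintype m] [DecidableEq m]
    {M : Ω → Matrix m m ℝ} (hM : ∀ i j, Measurable fun ω => M ω i j) (i j : m) :
    Measurable fun ω => (M ω)⁻¹ i j := by
  have hdet : ∀ {N : Ω → Matrix m m ℝ}, (∀ i j, Measurable fun ω => N ω i j) →
      Measurable fun ω => (N ω).det := by
    intro N hN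
    simp only [det_apply]
    refine Finset.measurable_sum _ fun σ _ => ?_
    exact (Finset.measurable_prod _ fun a _ => hN _ _).const_smul _
  simp only [inv_def, Ring.inverse_eq_inv', Matrix.smul_apply, smul_eq_mul, adjugate_apply]
  refine (hdet hM).inv.mul (hdet (N := fun ω => (M ω).updateRow j (Pi.single i 1)) fun a b => ?_)
  simp only [updateRow_apply]
  split_ifs
  · exact measurable_const
  · exact hM a b

lemma measurable_pow_matrix {Ω m : Type*} [MeasurableSpace Ω] [Fintype m] [DecidableEq m]
    {M : Ω → Matrix m m ℝ} (hM : ∀ i j, Measurable fun ω => M ω i j) (q : ℕ) (i j : m) :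
    Measurable fun ω => ((M ω) ^ q) i j := by
  induction q generalizing i j with
  | zero => simp only [pow_zero]; exact measurable_const
  | succ q ih =>
    simp only [pow_succ, Matrix.mul_apply]
    exact Finset.measurable_sum _ fun k _ => (ih i k).mul (hM k j)

lemma measurable_resolventForm (hκ : Measurable fun q : E × E => κ q.1 q.2) (s : ℝ)
    {f g : E → ℝ} (hf : Measurable f) (hg : Measurable g) (n : ℕ) :
    Measurable fun X : Fin n → E => resolventForm κ s f g X := by
  have hM : ∀ i j : Fin n, Measurable fun X : Fin n → E => kernelRidge κ s X i j := by
    intro i j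
    have h : Measurable fun X : Fin n → E => (X i, X j) :=
      (measurable_pi_apply i).prodMk (measurable_pi_apply j)
    have h2 : Measurable fun X : Fin n → E => κ (X i) (X j) := hκ.comp h
    exact measurable_const.add h2
  simp only [resolventForm, dotProduct, mulVec]
  refine Finset.measurable_sum _ fun i _ => (hf.comp (measurable_pi_apply i)).mul ?_
  exact Finset.measurable_sum _ fun j _ =>
    (measurable_inv_matrix hM i j).mul (hg.comp (measurable_pi_apply j))

end Recursion

/-! ### The head covariance after elimination of the tail -/

section HeadCov

variable {E H : Type*}

/-- The matrix `s Zᵀ (s I + κ(X, X))⁻¹ Z`, where the columns of `Z` are the head features `z a`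
evaluated at the sample. It is the Schur complement of the tail block in the regularized sample
covariance of head and tail. -/
noncomputable def headCov (κ : E → E → ℝ) (s : ℝ) (z : H → E → ℝ) {n : ℕ} (X : Fin n → E) :
    Matrix H H ℝ :=
  Matrix.of fun a b => s * resolventForm κ s (z a) (z b) X

variable {κ : E → E → ℝ} {s : ℝ} {n : ℕ} {z : H → E → ℝ}

lemma headCov_cons (hκ : IsPSDKernel κ) (hs : 0 < s) (X : Fin n → E) (x : E) :
    headCov κ s z (Fin.cons x X : Fin (n + 1) → E) = headCov κ s z X +
      (s / kernelPivot κ s X x) • vecMulVec (fun a => kernelResidual κ s (z a) X x)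
        (fun a => kernelResidual κ s (z a) X x) := by
  ext a b
  simp only [headCov, of_apply, Matrix.add_apply, Matrix.smul_apply, vecMulVec_apply, smul_eq_mul]
  rw [resolventForm_cons hκ hs]
  ring

variable [Fintype H]

lemma resolventForm_sum (c : H → ℝ) (X : Fin n → E) :
    resolventForm κ s (fun x => ∑ a, c a * z a x) (fun x => ∑ a, c a * z a x) X =
      ∑ a, ∑ b, c a * c b * resolventForm κ s (z a) (z b) X := by
  have h1 : (fun i => ∑ a, c a * z a (X i)) = ∑ a, c a • fun i => z a (X i) := by
    ext i; simp
  unfold resolventForm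
  rw [h1, sum_dotProduct]
  refine Finset.sum_congr rfl fun a _ => ?_
  have h2 : (kernelRidge κ s X)⁻¹ *ᵥ (∑ b, c b • fun i => z b (X i)) =
      ∑ b, c b • ((kernelRidge κ s X)⁻¹ *ᵥ fun i => z b (X i)) := by
    rw [mulVec_sum]
    exact Finset.sum_congr rfl fun b _ => mulVec_smul _ _ _
  rw [h2, dotProduct_sum]
  refine Finset.sum_congr rfl fun b _ => ?_
  rw [smul_dotProduct, dotProduct_smul, smul_eq_mul, smul_eq_mul, mul_assoc]

lemma kernelResidual_sum (c : H → ℝ) (X : Fin n → E) (x : E) :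
    kernelResidual κ s (fun x => ∑ a, c a * z a x) X x =
      c ⬝ᵥ fun a => kernelResidual κ s (z a) X x := by
  have h1 : (fun i => ∑ a, c a * z a (X i)) = ∑ a, c a • fun i => z a (X i) := by
    ext i; simp
  unfold kernelResidual
  have h2 : (kernelRidge κ s X)⁻¹ *ᵥ (∑ b, c b • fun i => z b (X i)) =
      ∑ b, c b • ((kernelRidge κ s X)⁻¹ *ᵥ fun i => z b (X i)) := by
    rw [mulVec_sum]
    exact Finset.sum_congr rfl fun b _ => mulVec_smul _ _ _
  rw [h1, h2, dotProduct_sum]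
  simp only [dotProduct_smul, smul_eq_mul]
  rw [← Finset.sum_sub_distrib]
  simp only [dotProduct, mul_sub]

lemma dotProduct_headCov_mulVec (c : H → ℝ) (X : Fin n → E) :
    c ⬝ᵥ headCov κ s z X *ᵥ c =
      s * resolventForm κ s (fun x => ∑ a, c a * z a x) (fun x => ∑ a, c a * z a x) X := by
  rw [resolventForm_sum]
  simp only [dotProduct, mulVec, headCov, of_apply, Finset.mul_sum]
  exact Finset.sum_congr rfl fun a _ => Finset.sum_congr rfl fun b _ => by ring

lemma headCov_posSemidef (hκ : IsPSDKernel κ) (hs : 0 < s) (X : Fin n → E) :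
    (headCov κ s z X).PosSemidef := by
  refine PosSemidef.of_dotProduct_mulVec_nonneg ?_ fun c => ?_
  · rw [IsHermitian, conjTranspose_eq_transpose_of_trivial]
    ext a b
    simp [headCov, resolventForm_symm hκ hs (z b) (z a)]
  · simp only [star_trivial]
    rw [dotProduct_headCov_mulVec]
    exact mul_nonneg hs.le (resolventForm_self_nonneg hκ hs _ X)

variable [DecidableEq H]

lemma barrier_posDef (hκ : IsPSDKernel κ) (hs : 0 < s) {L : ℝ} (hL : 0 < L) (X : Fin n → E) :
    (L • (1 : Matrix H H ℝ) + headCov κ s z X).PosDef :=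
  (PosDef.one.smul hL).add_posSemidef (headCov_posSemidef hκ hs X)

/-- The residual is bounded in the norm of the inverse barrier matrix by the size of the new sample
alone, whatever the previous samples are. -/
lemma residual_inv_barrier_le (hκ : IsPSDKernel κ) (hs : 0 < s) {L : ℝ} (hL : 0 < L)
    (X : Fin n → E) (x : E) :
    s * ((fun a => kernelResidual κ s (z a) X x) ⬝ᵥ
      (L • (1 : Matrix H H ℝ) + headCov κ s z X)⁻¹ *ᵥ fun a => kernelResidual κ s (z a) X x) +
      kernelPivot κ s X x ≤ s * (1 + ((∑ a, z a x ^ 2) / L + κ x x / s)) := by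
  have hB := barrier_posDef (z := z) hκ hs hL X
  set r : H → ℝ := fun a => kernelResidual κ s (z a) X x with hr
  set u := (L • (1 : Matrix H H ℝ) + headCov κ s z X)⁻¹ *ᵥ r with hu
  set f : E → ℝ := fun x => ∑ a, u a * z a x with hf
  have h1 : u ⬝ᵥ (L • (1 : Matrix H H ℝ) + headCov κ s z X) *ᵥ u = r ⬝ᵥ u := by
    rw [hu, mulVec_inv_mulVec hB, dotProduct_comm]
  rw [add_mulVec, dotProduct_add, dotProduct_headCov_mulVec, ← hf, smul_mulVec, one_mulVec,
    dotProduct_smul, smul_eq_mul] at h1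
  have h2 : r ⬝ᵥ u = kernelResidual κ s f X x := by
    rw [hf, kernelResidual_sum, dotProduct_comm]
  have hG := kernelRidge_posDef hκ hs X
  set k : Fin n → ℝ := fun i => κ x (X i) with hk
  set w : Fin n → ℝ := fun i => f (X i) with hw
  have h3 : 0 ≤ (k + s • w) ⬝ᵥ (kernelRidge κ s X)⁻¹ *ᵥ (k + s • w) :=
    dotProduct_inv_mulVec_nonneg hG _
  have hwk : w ⬝ᵥ (kernelRidge κ s X)⁻¹ *ᵥ k = k ⬝ᵥ (kernelRidge κ s X)⁻¹ *ᵥ w := by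
    rw [symm_dotProduct_mulVec (transpose_eq_of_posDef hG.inv), dotProduct_comm]
  rw [mulVec_add, mulVec_smul, add_dotProduct, dotProduct_add, dotProduct_add, smul_dotProduct,
    smul_dotProduct, dotProduct_smul, dotProduct_smul, hwk] at h3
  simp only [smul_eq_mul] at h3
  have h4 : kernelResidual κ s f X x = f x - k ⬝ᵥ (kernelRidge κ s X)⁻¹ *ᵥ w := rfl
  have h5 : kernelPivot κ s X x = s + κ x x - k ⬝ᵥ (kernelRidge κ s X)⁻¹ *ᵥ k := rfl
  have h6 : resolventForm κ s f f X = w ⬝ᵥ (kernelRidge κ s X)⁻¹ *ᵥ w := rfl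
  have h7 : 2 * f x - L * (u ⬝ᵥ u) ≤ (∑ a, z a x ^ 2) / L := by
    have : 2 * f x - L * (u ⬝ᵥ u) = ∑ a, (2 * (u a * z a x) - L * (u a * u a)) := by
      rw [hf, Finset.sum_sub_distrib, ← Finset.mul_sum, ← Finset.mul_sum]
      rfl
    rw [this, Finset.sum_div]
    refine Finset.sum_le_sum fun a _ => ?_
    rw [le_div_iff₀ hL]
    nlinarith [sq_nonneg (L * u a - z a x)]
  have h8 : s * (r ⬝ᵥ u) ≤ s * ((∑ a, z a x ^ 2) / L) +
      k ⬝ᵥ (kernelRidge κ s X)⁻¹ *ᵥ k := by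
    have h9 : r ⬝ᵥ u = (2 * f x - L * (u ⬝ᵥ u)) - 2 * (k ⬝ᵥ (kernelRidge κ s X)⁻¹ *ᵥ w) -
        s * (w ⬝ᵥ (kernelRidge κ s X)⁻¹ *ᵥ w) := by
      rw [h2, h4, h6] at h1
      rw [h2, h4]
      linarith
    have h10 := mul_le_mul_of_nonneg_left h7 hs.le
    rw [h9]
    linarith
  have h11 : s * (1 + ((∑ a, z a x ^ 2) / L + κ x x / s)) =
      s + s * ((∑ a, z a x ^ 2) / L) + κ x x := by
    field_simp
    ring
  rw [h11, h5]
  linarith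

end HeadCov

/-! ### Second moments of the residuals -/

section Moments

variable {E H : Type*} [MeasurableSpace E]

/-- Square integrable, orthonormal head features `z`, uncorrelated with the tail features whose
inner product is the kernel `κ`. -/
structure IsHeadTailModel (μ : Measure E) (κ : E → E → ℝ) (z : H → E → ℝ) : Prop where
  psd : IsPSDKernel κ
  measurable_kernel : Measurable fun q : E × E => κ q.1 q.2
  measurable_head : ∀ a, Measurable (z a)
  memLp_head : ∀ a, MemLp (z a) 2 μ
  memLp_kernel : ∀ y, MemLp (fun x => κ x y) 2 μ
  orthonormal : ∀ a b, ∫ x, z a x * z b x ∂μ = open Classical in if a = b then 1 else 0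
  uncorrelated : ∀ a y, ∫ x, z a x * κ x y ∂μ = 0

variable {μ : Measure E} {κ : E → E → ℝ} {z : H → E → ℝ} {s : ℝ} {n : ℕ}

lemma IsHeadTailModel.memLp_residual (hm : IsHeadTailModel μ κ z) (X : Fin n → E) (a : H) :
    MemLp (kernelResidual κ s (z a) X) 2 μ := by
  refine (hm.memLp_head a).sub ?_
  simp only [dotProduct]
  exact memLp_finsetSum _ fun i _ => (hm.memLp_kernel (X i)).mul_const _

variable [Fintype H]

/-- The residuals have second moments at least as large as those of the head features: a
regression on the tail features cannot explain anything, as these are uncorrelated. -/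
lemma IsHeadTailModel.trace_le_integral (hm : IsHeadTailModel μ κ z) (X : Fin n → E)
    {Q : Matrix H H ℝ} (hQ : Q.PosSemidef) :
    Q.trace ≤ ∫ x, (fun a => kernelResidual κ s (z a) X x) ⬝ᵥ
      Q *ᵥ (fun a => kernelResidual κ s (z a) X x) ∂μ := by
  classical
  set g : H → E → ℝ := fun a x =>
    (fun i => κ x (X i)) ⬝ᵥ (kernelRidge κ s X)⁻¹ *ᵥ fun i => z a (X i) with hg
  have hr : ∀ a x, kernelResidual κ s (z a) X x = z a x - g a x := fun a x => rfl
  have hgL : ∀ a, MemLp (g a) 2 μ := by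
    intro a
    simp only [hg, dotProduct]
    exact memLp_finsetSum _ fun i _ => (hm.memLp_kernel (X i)).mul_const _
  have hzg : ∀ a b, ∫ x, z a x * g b x ∂μ = 0 := by
    intro a b
    have : ∀ x, z a x * g b x = ∑ i, (z a x * κ x (X i)) *
        ((kernelRidge κ s X)⁻¹ *ᵥ fun i => z b (X i)) i := by
      intro x
      simp only [hg, dotProduct, Finset.mul_sum]
      exact Finset.sum_congr rfl fun i _ => by ring
    simp only [this]
    have hi : ∀ i, Integrable (fun x => z a x * κ x (X i)) μ := fun i =>
      (hm.memLp_head a).integrable_mul (hm.memLp_kernel (X i))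
    rw [integral_finsetSum _ fun i _ => (hi i).mul_const _]
    refine Finset.sum_eq_zero fun i _ => ?_
    rw [integral_mul_const, hm.uncorrelated, zero_mul]
  have hmom : ∀ a b, ∫ x, kernelResidual κ s (z a) X x * kernelResidual κ s (z b) X x ∂μ =
      (if a = b then 1 else 0) + ∫ x, g a x * g b x ∂μ := by
    intro a b
    have h1 : Integrable (fun x => z a x * z b x) μ :=
      (hm.memLp_head a).integrable_mul (hm.memLp_head b)
    have h2 : Integrable (fun x => z a x * g b x) μ := (hm.memLp_head a).integrable_mul (hgL b)
    have h3 : Integrable (fun x => z b x * g a x) μ := (hm.memLp_head b).integrable_mul (hgL a)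
    have h4 : Integrable (fun x => g a x * g b x) μ := (hgL a).integrable_mul (hgL b)
    have e : ∀ x, kernelResidual κ s (z a) X x * kernelResidual κ s (z b) X x =
        z a x * z b x - z a x * g b x - z b x * g a x + g a x * g b x := by
      intro x
      rw [hr, hr]
      ring
    simp only [e]
    have h12 : Integrable (fun x => z a x * z b x - z a x * g b x) μ := h1.sub h2
    have h123 : Integrable (fun x => z a x * z b x - z a x * g b x - z b x * g a x) μ := h12.sub h3
    rw [integral_add h123 h4, integral_sub h12 h3, integral_sub h1 h2,
      hzg, hzg, hm.orthonormal]
    simp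
  have hexp : ∀ v : H → ℝ, v ⬝ᵥ Q *ᵥ v = ∑ a, ∑ b, Q a b * (v a * v b) := by
    intro v
    simp only [dotProduct, mulVec, Finset.mul_sum]
    exact Finset.sum_congr rfl fun a _ => Finset.sum_congr rfl fun b _ => by ring
  have hint : ∀ {f : H → E → ℝ}, (∀ a, MemLp (f a) 2 μ) →
      ∫ x, (fun a => f a x) ⬝ᵥ Q *ᵥ (fun a => f a x) ∂μ =
        ∑ a, ∑ b, Q a b * ∫ x, f a x * f b x ∂μ := by
    intro f hf
    simp only [hexp]
    have h1 : ∀ a b, Integrable (fun x => Q a b * (f a x * f b x)) μ := fun a b =>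
      ((hf a).integrable_mul (hf b)).const_mul _
    rw [integral_finsetSum _ fun a _ => integrable_finsetSum _ fun b _ => h1 a b]
    refine Finset.sum_congr rfl fun a _ => ?_
    rw [integral_finsetSum _ fun b _ => h1 a b]
    exact Finset.sum_congr rfl fun b _ => integral_const_mul _ _
  rw [hint (f := fun a x => kernelResidual κ s (z a) X x) fun a => hm.memLp_residual X a]
  have hgg : 0 ≤ ∑ a, ∑ b, Q a b * ∫ x, g a x * g b x ∂μ := by
    rw [← hint hgL]
    refine integral_nonneg fun x => ?_
    simpa using hQ.dotProduct_mulVec_nonneg fun a => g a x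
  simp only [hmom, mul_add, Finset.sum_add_distrib]
  have : ∑ a, ∑ b, Q a b * (if a = b then (1 : ℝ) else 0) = Q.trace := by
    simp [Matrix.trace]
  rw [this]
  linarith

lemma IsHeadTailModel.integrable_quadratic (hm : IsHeadTailModel μ κ z) (X : Fin n → E)
    (Q : Matrix H H ℝ) :
    Integrable (fun x => (fun a => kernelResidual κ s (z a) X x) ⬝ᵥ
      Q *ᵥ (fun a => kernelResidual κ s (z a) X x)) μ := by
  simp only [dotProduct, mulVec]
  refine integrable_finsetSum _ fun a _ => ?_
  simp only [Finset.mul_sum]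
  refine integrable_finsetSum _ fun b _ => ?_
  have := ((hm.memLp_residual (s := s) X a).integrable_mul
    (hm.memLp_residual (s := s) X b)).const_mul (Q a b)
  refine this.congr (Eventually.of_forall fun x => ?_)
  simp only [Pi.mul_apply]
  ring

end Moments

/-! ### Concentration of the barrier potential -/

/-- Decreasing `Φ` by the fraction `m / Φ` increases `Φ ^ (-e)` by at least the fraction
`e * (m / Φ)`. -/
lemma rpow_neg_growth {Φ Φ' m e : ℝ} (hΦ' : 0 < Φ') (hm : 0 ≤ m) (hΦ : Φ' ≤ Φ - m) (he : 0 < e)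
    (he1 : e ≤ 1) : Φ ^ (-e) * (1 + e * (m / Φ)) ≤ Φ' ^ (-e) := by
  have hΦ0 : 0 < Φ := by linarith
  set x := m / Φ with hx
  have hx0 : 0 ≤ x := div_nonneg hm hΦ0.le
  have hx1 : x < 1 := by rw [hx, div_lt_one hΦ0]; linarith
  have hmx : Φ - m = Φ * (1 - x) := by rw [hx]; field_simp
  have h1 : Φ' ^ e ≤ Φ ^ e * (1 - e * x) := by
    calc Φ' ^ e ≤ (Φ * (1 - x)) ^ e := Real.rpow_le_rpow hΦ'.le (hmx ▸ hΦ) he.le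
      _ = Φ ^ e * (1 - x) ^ e := Real.mul_rpow hΦ0.le (by linarith)
      _ ≤ Φ ^ e * (1 - e * x) := by
          refine mul_le_mul_of_nonneg_left ?_ (Real.rpow_nonneg hΦ0.le _)
          have := rpow_one_add_le_one_add_mul_self (s := -x) (by linarith) he.le he1
          rw [← sub_eq_add_neg] at this
          linarith
  have hex : e * x < 1 := by nlinarith
  have hp : 0 < Φ ^ e := Real.rpow_pos_of_pos hΦ0 _
  have hp' : 0 < Φ' ^ e := Real.rpow_pos_of_pos hΦ' _
  rw [Real.rpow_neg hΦ0.le, Real.rpow_neg hΦ'.le, inv_mul_eq_div, div_le_iff₀ hp,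
    inv_mul_eq_div, le_div_iff₀ hp']
  calc (1 + e * x) * Φ' ^ e ≤ (1 + e * x) * (Φ ^ e * (1 - e * x)) :=
        mul_le_mul_of_nonneg_left h1 (by positivity)
    _ = Φ ^ e * (1 - (e * x) ^ 2) := by ring
    _ ≤ Φ ^ e * 1 := mul_le_mul_of_nonneg_left (by nlinarith [sq_nonneg (e * x)]) hp.le
    _ = Φ ^ e := mul_one _

lemma exp_neg_le_one_sub_half {y : ℝ} (hy : 0 ≤ y) (hy1 : y ≤ 1) :
    Real.exp (-y) ≤ 1 - y / 2 := by
  have h1 : 1 + y ≤ Real.exp y := by linarith [Real.add_one_le_exp y]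
  rw [Real.exp_neg, inv_le_comm₀ (Real.exp_pos y) (by linarith)]
  refine le_trans ?_ h1
  rw [inv_le_iff_one_le_mul₀ (by linarith)]
  nlinarith

section Barrier

variable {E H : Type*} [Fintype H] [DecidableEq H]

/-- The trace of the `q`-th power of the inverse of the head covariance shifted by `L`. -/
noncomputable def barrierPotential (κ : E → E → ℝ) (s : ℝ) (z : H → E → ℝ) (L : ℝ) (q : ℕ) {n : ℕ}
    (X : Fin n → E) : ℝ :=
  (((L • (1 : Matrix H H ℝ) + headCov κ s z X)⁻¹) ^ q).trace

variable {κ : E → E → ℝ} {s : ℝ} {n : ℕ} {z : H → E → ℝ} {L : ℝ} {q : ℕ}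

lemma barrierPotential_pos [Nonempty H] (hκ : IsPSDKernel κ) (hs : 0 < s) (hL : 0 < L)
    (X : Fin n → E) : 0 < barrierPotential κ s z L q X := by
  have h := (barrier_posDef (z := z) hκ hs hL X).inv
  have hpow : ((((L • (1 : Matrix H H ℝ) + headCov κ s z X)⁻¹) ^ q)).PosDef := by
    refine (h.posSemidef.pow q).posDef_iff_isUnit.2 ?_
    exact h.isUnit.pow q
  exact hpow.trace_pos

lemma barrierPotential_cons_le (hκ : IsPSDKernel κ) (hs : 0 < s) (hL : 0 < L) (hq : 1 ≤ q)
    (X : Fin n → E) (x : E) {d : ℝ} (hd : (∑ a, z a x ^ 2) / L + κ x x / s ≤ d) :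
    barrierPotential κ s z L q (Fin.cons x X : Fin (n + 1) → E) ≤ barrierPotential κ s z L q X -
      ((fun a => kernelResidual κ s (z a) X x) ⬝ᵥ
        ((L • (1 : Matrix H H ℝ) + headCov κ s z X)⁻¹ ^ (q + 1)) *ᵥ
          (fun a => kernelResidual κ s (z a) X x)) / (1 + d) := by
  have hB := barrier_posDef (z := z) hκ hs hL X
  set r : H → ℝ := fun a => kernelResidual κ s (z a) X x with hr
  have hp := le_kernelPivot hκ hs X x
  have hp0 := hs.trans_le hp
  have key := trace_pow_inv_add_rankOne_le hB r (div_nonneg hs.le hp0.le) hq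
  have hres := residual_inv_barrier_le (z := z) hκ hs hL X x
  rw [← hr] at hres
  set p := kernelPivot κ s X x with hpdef
  set t := r ⬝ᵥ (L • (1 : Matrix H H ℝ) + headCov κ s z X)⁻¹ *ᵥ r with ht
  have ht0 : 0 ≤ t := dotProduct_inv_mulVec_nonneg hB r
  have hkey2 : s * t + p ≤ s * (1 + d) :=
    hres.trans (mul_le_mul_of_nonneg_left (by linarith) hs.le)
  have hd1 : 0 < 1 + d := by
    have : 0 < s * (1 + d) := by
      have := mul_nonneg hs.le ht0
      linarith
    exact pos_of_mul_pos_right this hs.le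
  have hcoef : 1 / (1 + d) ≤ s / p / (1 + s / p * t) := by
    have e : s / p / (1 + s / p * t) = s / (s * t + p) := by
      have : p ≠ 0 := hp0.ne'
      field_simp
      ring
    rw [e, div_le_div_iff₀ hd1 (by positivity)]
    linarith
  have hnn := dotProduct_pow_mulVec_nonneg hB.inv.posSemidef (q + 1) r
  unfold barrierPotential
  rw [headCov_cons hκ hs, ← add_assoc]
  refine key.trans ?_
  have := mul_le_mul_of_nonneg_right hcoef hnn
  rw [div_eq_mul_one_div _ (1 + d), mul_comm _ (1 / (1 + d))]
  linarith

lemma quadratic_residual_le (hκ : IsPSDKernel κ) (hs : 0 < s) (hL : 0 < L)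
    (X : Fin n → E) (x : E) {d : ℝ} (hd : (∑ a, z a x ^ 2) / L + κ x x / s ≤ d) :
    ((fun a => kernelResidual κ s (z a) X x) ⬝ᵥ
        ((L • (1 : Matrix H H ℝ) + headCov κ s z X)⁻¹ ^ (q + 1)) *ᵥ
          (fun a => kernelResidual κ s (z a) X x)) ≤ barrierPotential κ s z L q X * d := by
  have hB := barrier_posDef (z := z) hκ hs hL X
  have hres := residual_inv_barrier_le (z := z) hκ hs hL X x
  have hp := le_kernelPivot hκ hs X x
  refine (dotProduct_pow_succ_mulVec_le hB.inv.posSemidef q _).trans ?_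
  refine mul_le_mul_of_nonneg_left ?_ (hB.inv.posSemidef.pow q).trace_nonneg
  refine le_trans ?_ hd
  refine le_of_mul_le_mul_left ?_ hs
  linarith

variable [MeasurableSpace E] {μ : Measure E}

lemma measurable_barrierPotential (hm : IsHeadTailModel μ κ z) (s L : ℝ) (q n : ℕ) :
    Measurable fun X : Fin n → E => barrierPotential κ s z L q X := by
  simp only [barrierPotential, Matrix.trace, diag_apply]
  refine Finset.measurable_sum _ fun a _ => measurable_pow_matrix (fun i j => ?_) q a a
  refine measurable_inv_matrix (fun i j => ?_) i j
  simp only [Matrix.add_apply, headCov, of_apply]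
  exact measurable_const.add ((measurable_resolventForm hm.measurable_kernel s
    (hm.measurable_head i) (hm.measurable_head j) n).const_mul s)

/-- The `-1/q`-th power `U` of the barrier potential grows linearly in the sample size, except
with exponentially small probability. One sample increases `U` by at least some `ζ` in `[0, d U]`
whose mean is bounded below; so `exp (-θ U)`, set to `0` once `U` exceeds the target, is a
supermartingale decreasing geometrically, if `θ` is the inverse of `d` times the target. -/
theorem measure_barrierPotential_le [Nonempty H] [IsProbabilityMeasure μ]
    (hm : IsHeadTailModel μ κ z) (hs : 0 < s) (hL : 0 < L) (hq : 1 ≤ q) {d : ℝ} (hd0 : 0 < d)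
    (hd1 : d ≤ 1) (hd : ∀ᵐ x ∂μ, (∑ a, z a x ^ 2) / L + κ x x / s ≤ d) {n : ℕ} (hn : 1 ≤ n) :
    (Measure.pi fun _ : Fin n => μ) {X | barrierPotential κ s z L q X ^ (-(1 / (q : ℝ))) ≤
        n * (Fintype.card H : ℝ) ^ (-(1 / (q : ℝ))) / (8 * q)} ≤
      ENNReal.ofReal (Real.exp (-(1 / d))) := by
  have hκ := hm.psd
  have hqR : (1 : ℝ) ≤ q := by exact_mod_cast hq
  set e : ℝ := 1 / (q : ℝ) with he
  have he0 : 0 < e := by positivity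
  have he1 : e ≤ 1 := by rw [he, div_le_one (by linarith)]; exact hqR
  have hcard : (0 : ℝ) < Fintype.card H := by exact_mod_cast Fintype.card_pos
  set h : ℝ := (Fintype.card H : ℝ) ^ (-e) with hh
  have hh0 : 0 < h := Real.rpow_pos_of_pos hcard _
  set T : ℝ := n * h / (8 * q) with hT
  have hn0 : (0 : ℝ) < n := by exact_mod_cast hn
  have hT0 : 0 < T := by positivity
  set θ : ℝ := 1 / (d * T) with hθ
  have hθ0 : 0 < θ := by positivity
  have hθT : θ * T = 1 / d := by rw [hθ]; field_simp
  set mean : ℝ := e * h / 2 with hmean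
  have hTm : T = n * mean / 4 := by rw [hT, hmean, he]; field_simp; ring
  set U : ∀ {j : ℕ}, (Fin j → E) → ℝ := fun {j} X => barrierPotential κ s z L q X ^ (-e)
  have hU0 : ∀ {j : ℕ} (X : Fin j → E), 0 < U X := fun X =>
    Real.rpow_pos_of_pos (barrierPotential_pos hκ hs hL X) _
  set F : ∀ j : ℕ, (Fin j → E) → ℝ≥0∞ := fun j X =>
    if U X ≤ T then ENNReal.ofReal (Real.exp (-(θ * U X))) else 0 with hF
  have hUm : ∀ j, Measurable fun X : Fin j → E => U X := fun j =>
    (measurable_barrierPotential hm s L q j).pow_const _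
  have hFm : ∀ j, Measurable (F j) := by
    intro j
    refine Measurable.ite (measurableSet_le (hUm j) measurable_const) ?_ measurable_const
    exact (((hUm j).const_mul θ).neg.exp).ennreal_ofReal
  set ρ : ℝ := 1 - θ * mean / 2 with hρ
  have hstep : ∀ j (X : Fin j → E), ∫⁻ x, F (j + 1) (Fin.cons x X : Fin (j + 1) → E) ∂μ ≤
      ENNReal.ofReal ρ * F j X := by
    intro j X
    set Φ := barrierPotential κ s z L q X with hΦ
    have hΦ0 : 0 < Φ := barrierPotential_pos hκ hs hL X
    set Y := (L • (1 : Matrix H H ℝ) + headCov κ s z X)⁻¹ with hY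
    have hYp : Y.PosSemidef := (barrier_posDef hκ hs hL X).inv.posSemidef
    set Qf : E → ℝ := fun x => (fun a => kernelResidual κ s (z a) X x) ⬝ᵥ
      (Y ^ (q + 1)) *ᵥ (fun a => kernelResidual κ s (z a) X x) with hQf
    have hQf0 : ∀ x, 0 ≤ Qf x := fun x => dotProduct_pow_mulVec_nonneg hYp _ _
    have hQfi : Integrable Qf μ := hm.integrable_quadratic X _
    -- a lower bound for the growth of `U` when `x` is added
    set ζ : E → ℝ := fun x => U X * (e * (Qf x / (1 + d) / Φ)) with hζ
    have hζ0 : ∀ x, 0 ≤ ζ x := fun x =>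
      mul_nonneg (hU0 X).le (mul_nonneg he0.le (div_nonneg (div_nonneg (hQf0 x) (by linarith))
        hΦ0.le))
    have hζi : Integrable ζ μ := (((hQfi.div_const _).div_const _).const_mul _).const_mul _
    have hgrow : ∀ᵐ x ∂μ, U X + ζ x ≤ U (Fin.cons x X : Fin (j + 1) → E) ∧ ζ x ≤ U X * d := by
      filter_upwards [hd] with x hx
      constructor
      · have := rpow_neg_growth (barrierPotential_pos hκ hs hL (Fin.cons x X : Fin (j + 1) → E))
          (div_nonneg (hQf0 x) (by linarith)) (barrierPotential_cons_le hκ hs hL hq X x hx) he0 he1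
        refine le_trans (le_of_eq ?_) this
        rw [mul_add, mul_one]
      · refine mul_le_mul_of_nonneg_left ?_ (hU0 X).le
        have h1 : Qf x / (1 + d) / Φ ≤ d := by
          rw [div_div, div_le_iff₀ (by positivity)]
          have := quadratic_residual_le (q := q) hκ hs hL X x hx
          calc Qf x ≤ Φ * d := this
            _ ≤ d * ((1 + d) * Φ) := by nlinarith [mul_pos hΦ0 hd0]
        calc e * (Qf x / (1 + d) / Φ) ≤ 1 * d :=
              mul_le_mul he1 h1 (div_nonneg (div_nonneg (hQf0 x) (by linarith)) hΦ0.le) one_pos.le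
          _ = d := one_mul d
    have hζmean : mean ≤ ∫ x, ζ x ∂μ := by
      have h1 : (Y ^ (q + 1)).trace ≤ ∫ x, Qf x ∂μ := hm.trace_le_integral X (hYp.pow _)
      have h2 : ∫ x, ζ x ∂μ = U X * (e * ((∫ x, Qf x ∂μ) / (1 + d) / Φ)) := by
        simp only [hζ]
        rw [integral_const_mul, integral_const_mul, integral_div, integral_div]
      have h3 : Φ ^ (1 + e) * h ≤ (Y ^ (q + 1)).trace := by
        have := rpow_trace_pow_le hYp hq
        rw [hh, Real.rpow_neg hcard.le, ← div_eq_mul_inv,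
          div_le_iff₀ (Real.rpow_pos_of_pos hcard _), mul_comm]
        exact this
      have h4 : U X * Φ ^ (1 + e) = Φ := by
        change Φ ^ (-e) * Φ ^ (1 + e) = Φ
        rw [← Real.rpow_add hΦ0]
        simp
      rw [h2]
      have h5 : mean = U X * (e * (Φ ^ (1 + e) * h / 2 / Φ)) := by
        calc mean = e * h / 2 * (U X * Φ ^ (1 + e)) / Φ := by rw [h4, hmean]; field_simp
          _ = _ := by ring
      rw [h5]
      have hnn : 0 ≤ ∫ x, Qf x ∂μ := integral_nonneg hQf0
      gcongr
      · exact h3.trans h1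
      · linarith
    by_cases hUX : U X ≤ T
    · have hθζ : ∀ᵐ x ∂μ, F (j + 1) (Fin.cons x X : Fin (j + 1) → E) ≤
          ENNReal.ofReal (Real.exp (-(θ * U X))) * ENNReal.ofReal (1 - θ * ζ x / 2) := by
        filter_upwards [hgrow] with x hx
        simp only [hF]
        split_ifs with h1
        · rw [← ENNReal.ofReal_mul (Real.exp_pos _).le]
          refine ENNReal.ofReal_le_ofReal ?_
          have h2 : θ * ζ x ≤ 1 := by
            calc θ * ζ x ≤ θ * (T * d) := mul_le_mul_of_nonneg_left
                  (hx.2.trans (mul_le_mul_of_nonneg_right hUX hd0.le)) hθ0.le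
              _ = 1 := by rw [← mul_assoc, hθT]; field_simp
          calc Real.exp (-(θ * U (Fin.cons x X : Fin (j + 1) → E)))
              ≤ Real.exp (-(θ * (U X + ζ x))) := by
                refine Real.exp_le_exp.2 (neg_le_neg (mul_le_mul_of_nonneg_left hx.1 hθ0.le))
            _ = Real.exp (-(θ * U X)) * Real.exp (-(θ * ζ x)) := by
                rw [← Real.exp_add]; ring_nf
            _ ≤ _ := mul_le_mul_of_nonneg_left
                (exp_neg_le_one_sub_half (mul_nonneg hθ0.le (hζ0 x)) h2) (Real.exp_pos _).le
        · exact zero_le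
      refine (lintegral_mono_ae hθζ).trans ?_
      have hFX : F j X = ENNReal.ofReal (Real.exp (-(θ * U X))) := by simp only [hF, if_pos hUX]
      rw [lintegral_const_mul' _ _ ENNReal.ofReal_ne_top, hFX, mul_comm]
      refine mul_le_mul_left ?_ _
      have hint : Integrable (fun x => 1 - θ * ζ x / 2) μ :=
        (integrable_const _).sub ((hζi.const_mul θ).div_const 2)
      have hnn : 0 ≤ᵐ[μ] fun x => 1 - θ * ζ x / 2 := by
        filter_upwards [hgrow] with x hx
        have h2 : θ * ζ x ≤ 1 := by
          calc θ * ζ x ≤ θ * (T * d) := mul_le_mul_of_nonneg_left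
                (hx.2.trans (mul_le_mul_of_nonneg_right hUX hd0.le)) hθ0.le
            _ = 1 := by rw [← mul_assoc, hθT]; field_simp
        simp only [Pi.zero_apply]
        linarith
      rw [← ofReal_integral_eq_lintegral_ofReal hint hnn]
      refine ENNReal.ofReal_le_ofReal ?_
      rw [integral_sub (integrable_const _) ((hζi.const_mul θ).div_const 2), integral_div,
        integral_const_mul, hρ]
      have := mul_le_mul_of_nonneg_left hζmean hθ0.le
      simp only [integral_const, probReal_univ, smul_eq_mul, mul_one]
      linarith
    · have : ∀ᵐ x ∂μ, F (j + 1) (Fin.cons x X : Fin (j + 1) → E) = 0 := by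
        filter_upwards [hgrow] with x hx
        have : ¬ U (Fin.cons x X : Fin (j + 1) → E) ≤ T := by
          have := hx.1
          have := hζ0 x
          push Not at hUX ⊢
          linarith
        simp only [hF, if_neg this]
      rw [lintegral_congr_ae this]
      simp
  have hrec := lintegral_pi_le_pow μ F hFm (ENNReal.ofReal ρ) hstep n
  have hF0 : F 0 Fin.elim0 ≤ 1 := by
    simp only [hF]
    split_ifs
    · rw [ENNReal.ofReal_le_one, Real.exp_le_one_iff]
      exact neg_nonpos.2 (mul_nonneg hθ0.le (hU0 _).le)
    · exact zero_le
  have hset : MeasurableSet {X : Fin n → E | U X ≤ T} := measurableSet_le (hUm n) measurable_const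
  have hlow : ENNReal.ofReal (Real.exp (-(θ * T))) *
      (Measure.pi fun _ : Fin n => μ) {X : Fin n → E | U X ≤ T} ≤
      ∫⁻ X, F n X ∂(Measure.pi fun _ : Fin n => μ) := by
    rw [← setLIntegral_const, ← lintegral_indicator hset]
    refine lintegral_mono fun X => ?_
    by_cases hX : U X ≤ T
    · rw [Set.indicator_of_mem (by exact hX)]
      simp only [hF, if_pos hX]
      exact ENNReal.ofReal_le_ofReal (Real.exp_le_exp.2 (neg_le_neg
        (mul_le_mul_of_nonneg_left hX hθ0.le)))
    · rw [Set.indicator_of_notMem (by exact hX)]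
      exact zero_le
  have hρn : ENNReal.ofReal ρ ^ n ≤ ENNReal.ofReal (Real.exp (-(2 * (θ * T)))) := by
    have h1 : ρ ≤ Real.exp (-(θ * mean / 2)) := by
      rw [hρ]
      linarith [Real.add_one_le_exp (-(θ * mean / 2))]
    have h2 : Real.exp (-(2 * (θ * T))) = Real.exp (-(θ * mean / 2)) ^ n := by
      rw [← Real.exp_nat_mul, hTm]
      congr 1
      ring
    rw [h2, ENNReal.ofReal_pow (Real.exp_pos _).le]
    exact pow_le_pow_left' (ENNReal.ofReal_le_ofReal h1) n
  have hfin : ENNReal.ofReal (Real.exp (-(θ * T))) *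
      (Measure.pi fun _ : Fin n => μ) {X : Fin n → E | U X ≤ T} ≤
      ENNReal.ofReal (Real.exp (-(2 * (θ * T)))) := by
    refine hlow.trans (hrec.trans ?_)
    calc _ ≤ ENNReal.ofReal (Real.exp (-(2 * (θ * T)))) * 1 := mul_le_mul' hρn hF0
      _ = _ := mul_one _
  have hsplit : Real.exp (-(2 * (θ * T))) = Real.exp (-(θ * T)) * Real.exp (-(θ * T)) := by
    rw [← Real.exp_add]; ring_nf
  rw [hsplit, ENNReal.ofReal_mul (Real.exp_pos _).le] at hfin
  rw [← hθT]
  exact (ENNReal.mul_le_mul_iff_right (ENNReal.ofReal_pos.2 (Real.exp_pos _)).ne'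
    ENNReal.ofReal_ne_top).1 hfin

end Barrier

/-! ### Lower tails in a fixed direction -/

section Direction

variable {E : Type*} [MeasurableSpace E] {μ : Measure E} [IsProbabilityMeasure μ]

/-- A damped square `r ^ 2 / (1 + d)` is not concentrated near `0` when the fourth moment of `r` is
controlled by the second one and the damping `d` is small in the mean. -/
lemma lintegral_exp_neg_damped_sq_le {r d : E → ℝ} {C : ℝ} (hC : 1 ≤ C) (hd0 : ∀ x, 0 ≤ d x)
    (hdi : Integrable d μ) (hd : ∫ x, d x ∂μ ≤ 7 / (64 * C)) (hr2 : Integrable (fun x => r x ^ 2) μ)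
    (hr4 : Integrable (fun x => r x ^ 4) μ) (hm : 1 / 4 ≤ ∫ x, r x ^ 2 ∂μ)
    (h4 : ∫ x, r x ^ 4 ∂μ ≤ C * (∫ x, r x ^ 2 ∂μ) ^ 2) :
    ∫⁻ x, ENNReal.ofReal (Real.exp (-(r x ^ 2 / (1 + d x)))) ∂μ ≤
      ENNReal.ofReal (Real.exp (-(1 / (16 * C)))) := by
  set m := ∫ x, r x ^ 2 ∂μ with hmdef
  have hm0 : 0 < m := by linarith
  have hC0 : 0 < C := by linarith
  set y : E → ℝ := fun x => r x ^ 2 / (4 * m) with hy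
  have hy0 : ∀ x, 0 ≤ y x := fun x => div_nonneg (sq_nonneg _) (by linarith)
  set g : E → ℝ := fun x => 1 - (y x / C - (y x) ^ 2 / (4 * C ^ 2) - d x) / 2 with hg
  have hpt : ∀ x, Real.exp (-(r x ^ 2 / (1 + d x))) ≤ g x := by
    intro x
    have h1d : 0 < 1 + d x := by linarith [hd0 x]
    set v := r x ^ 2 / (1 + d x) with hv
    have hv0 : 0 ≤ v := div_nonneg (sq_nonneg _) h1d.le
    set t := y x / C with ht
    have ht0 : 0 ≤ t := div_nonneg (hy0 x) hC0.le
    have hyr : y x ≤ r x ^ 2 := by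
      rw [hy, div_le_iff₀ (by linarith)]
      nlinarith [sq_nonneg (r x)]
    have hty : t ≤ y x := by rw [ht, div_le_iff₀ hC0]; nlinarith [hy0 x]
    have hmin : t - t ^ 2 / 4 ≤ min (r x ^ 2) 1 :=
      le_min (by nlinarith [sq_nonneg t]) (by nlinarith [sq_nonneg (t - 2)])
    set a := min (r x ^ 2) 1
    have ha1 : a ≤ 1 := min_le_right _ _
    have ha0 : 0 ≤ a := le_min (sq_nonneg _) zero_le_one
    have hmv : a - d x ≤ min v 1 := by
      have h1 : a - d x ≤ a / (1 + d x) := by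
        rw [le_div_iff₀ h1d]
        nlinarith [mul_nonneg (hd0 x) (hd0 x), hd0 x, mul_nonneg (hd0 x) (sub_nonneg.2 ha1)]
      refine h1.trans (le_min ?_ ?_)
      · rw [hv]
        exact div_le_div_of_nonneg_right (min_le_left _ _) h1d.le
      · rw [div_le_one h1d]
        linarith [hd0 x]
    have hmin0 : 0 ≤ min v 1 := le_min hv0 zero_le_one
    calc Real.exp (-v) ≤ Real.exp (-(min v 1)) :=
          Real.exp_le_exp.2 (neg_le_neg (min_le_left _ _))
      _ ≤ 1 - min v 1 / 2 := exp_neg_le_one_sub_half hmin0 (min_le_right _ _)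
      _ ≤ 1 - (t - t ^ 2 / 4 - d x) / 2 := by linarith
      _ = g x := by
          simp only [hg, ht]
          field_simp
  have hyi : Integrable y μ := hr2.div_const _
  have hy2e : ∀ x, y x ^ 2 = r x ^ 4 / (16 * m ^ 2) := by
    intro x
    simp only [hy]
    field_simp
    ring
  have hy2i : Integrable (fun x => y x ^ 2) μ := by
    simp only [hy2e]
    exact hr4.div_const _
  have hi1 : Integrable (fun x => y x / C) μ := hyi.div_const _
  have hi2 : Integrable (fun x => y x ^ 2 / (4 * C ^ 2)) μ := hy2i.div_const _
  have hi3 : Integrable (fun x => y x / C - y x ^ 2 / (4 * C ^ 2)) μ := hi1.sub hi2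
  have hi4 : Integrable (fun x => y x / C - y x ^ 2 / (4 * C ^ 2) - d x) μ := hi3.sub hdi
  have hgi : Integrable g μ := (integrable_const _).sub (hi4.div_const 2)
  have hint : ∫ x, g x ∂μ ≤ 1 - 1 / (16 * C) := by
    have e1 : ∫ x, y x ∂μ = 1 / 4 := by
      simp only [hy]
      rw [integral_div, ← hmdef]
      field_simp
    have e2 : ∫ x, y x ^ 2 ∂μ ≤ C / 16 := by
      simp only [hy2e]
      rw [integral_div, div_le_div_iff₀ (by positivity) (by norm_num)]
      nlinarith
    have e3 : ∫ x, g x ∂μ =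
        1 - ((∫ x, y x ∂μ) / C - (∫ x, y x ^ 2 ∂μ) / (4 * C ^ 2) - ∫ x, d x ∂μ) / 2 := by
      simp only [hg]
      rw [integral_sub (integrable_const _) (hi4.div_const 2), integral_div,
        integral_sub hi3 hdi, integral_sub hi1 hi2, integral_div C y,
        integral_div (4 * C ^ 2) fun x => y x ^ 2]
      simp
    rw [e3, e1]
    have e4 : (∫ x, y x ^ 2 ∂μ) / (4 * C ^ 2) ≤ 1 / (64 * C) := by
      rw [div_le_div_iff₀ (by positivity) (by positivity)]
      nlinarith
    have e5 : (1 : ℝ) / 4 / C = 16 * (1 / (64 * C)) := by field_simp; norm_num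
    have e6 : (7 : ℝ) / (64 * C) = 7 * (1 / (64 * C)) := by ring
    have e7 : (1 : ℝ) / (16 * C) = 4 * (1 / (64 * C)) := by field_simp; norm_num
    rw [e5, e7]
    rw [e6] at hd
    linarith
  calc ∫⁻ x, ENNReal.ofReal (Real.exp (-(r x ^ 2 / (1 + d x)))) ∂μ
      ≤ ∫⁻ x, ENNReal.ofReal (g x) ∂μ := lintegral_mono fun x => ENNReal.ofReal_le_ofReal (hpt x)
    _ = ENNReal.ofReal (∫ x, g x ∂μ) := (ofReal_integral_eq_lintegral_ofReal hgi
        (Eventually.of_forall fun x => (Real.exp_pos _).le.trans (hpt x))).symm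
    _ ≤ _ := by
        refine ENNReal.ofReal_le_ofReal (hint.trans ?_)
        linarith [Real.add_one_le_exp (-(1 / (16 * C)))]

/-- A Chernoff bound for the form `s f(X)ᵀ (s I + κ(X, X))⁻¹ f(X)`, the increments of which are
damped squares of residuals. -/
theorem measure_resolventForm_le {κ : E → E → ℝ} (hκ : IsPSDKernel κ)
    (hκm : Measurable fun q : E × E => κ q.1 q.2) {s : ℝ} (hs : 0 < s) {f : E → ℝ}
    (hf : Measurable f) {C : ℝ} (hC : 1 ≤ C) (hκi : Integrable (fun x => κ x x) μ)
    (hκ1 : (∫ x, κ x x ∂μ) / s ≤ 7 / (64 * C))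
    (hres : ∀ (j : ℕ) (X : Fin j → E), Integrable (fun x => kernelResidual κ s f X x ^ 2) μ ∧
      Integrable (fun x => kernelResidual κ s f X x ^ 4) μ ∧
      1 / 4 ≤ ∫ x, kernelResidual κ s f X x ^ 2 ∂μ ∧
      ∫ x, kernelResidual κ s f X x ^ 4 ∂μ ≤ C * (∫ x, kernelResidual κ s f X x ^ 2 ∂μ) ^ 2)
    (n : ℕ) :
    (Measure.pi fun _ : Fin n => μ) {X | s * resolventForm κ s f f X ≤ n / (32 * C)} ≤
      ENNReal.ofReal (Real.exp (-(n / (32 * C)))) := by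
  have hC0 : 0 < C := by linarith
  have hκ0 : ∀ x, 0 ≤ κ x x := by
    intro x
    have := hκ.nonneg 1 (fun _ => x) fun _ => 1
    simpa using this
  set B : ∀ j : ℕ, (Fin j → E) → ℝ := fun j X => s * resolventForm κ s f f X with hB
  have hBm : ∀ j, Measurable (B j) := fun j => (measurable_resolventForm hκm s hf hf j).const_mul s
  set F : ∀ j : ℕ, (Fin j → E) → ℝ≥0∞ := fun j X => ENNReal.ofReal (Real.exp (-(B j X))) with hF
  have hFm : ∀ j, Measurable (F j) := fun j => ((hBm j).neg.exp).ennreal_ofReal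
  have hstep : ∀ j (X : Fin j → E), ∫⁻ x, F (j + 1) (Fin.cons x X : Fin (j + 1) → E) ∂μ ≤
      ENNReal.ofReal (Real.exp (-(1 / (16 * C)))) * F j X := by
    intro j X
    obtain ⟨h2, h4, hm, h42⟩ := hres j X
    have hpt : ∀ x, F (j + 1) (Fin.cons x X : Fin (j + 1) → E) ≤
        F j X * ENNReal.ofReal (Real.exp (-(kernelResidual κ s f X x ^ 2 / (1 + κ x x / s)))) := by
      intro x
      simp only [hF]
      rw [← ENNReal.ofReal_mul (Real.exp_pos _).le, ← Real.exp_add]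
      refine ENNReal.ofReal_le_ofReal (Real.exp_le_exp.2 ?_)
      have hp := hs.trans_le (le_kernelPivot hκ hs X x)
      have hp2 := kernelPivot_le hκ hs X x
      have h1 : kernelResidual κ s f X x ^ 2 / (1 + κ x x / s) ≤
          s * (kernelResidual κ s f X x * kernelResidual κ s f X x / kernelPivot κ s X x) := by
        have e : 1 + κ x x / s = (s + κ x x) / s := by field_simp
        have h0 := hκ0 x
        rw [e, div_div_eq_mul_div, ← sq, mul_comm, ← mul_div_assoc]
        exact div_le_div_of_nonneg_left (by positivity) hp hp2
      simp only [hB]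
      rw [resolventForm_cons hκ hs, mul_add]
      linarith
    refine (lintegral_mono hpt).trans ?_
    rw [lintegral_const_mul' _ _ ENNReal.ofReal_ne_top, mul_comm]
    refine mul_le_mul_left ?_ _
    refine lintegral_exp_neg_damped_sq_le hC (fun x => div_nonneg (hκ0 x) hs.le)
      (hκi.div_const s) ?_ h2 h4 hm h42
    rw [integral_div]
    exact hκ1
  have hrec := lintegral_pi_le_pow μ F hFm _ hstep n
  have hF0 : F 0 Fin.elim0 ≤ 1 := by
    simp only [hF]
    rw [ENNReal.ofReal_le_one, Real.exp_le_one_iff]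
    exact neg_nonpos.2 (mul_nonneg hs.le (resolventForm_self_nonneg hκ hs f _))
  have hset : MeasurableSet {X : Fin n → E | B n X ≤ n / (32 * C)} :=
    measurableSet_le (hBm n) measurable_const
  have hlow : ENNReal.ofReal (Real.exp (-(n / (32 * C)))) *
      (Measure.pi fun _ : Fin n => μ) {X : Fin n → E | B n X ≤ n / (32 * C)} ≤
      ∫⁻ X, F n X ∂(Measure.pi fun _ : Fin n => μ) := by
    rw [← setLIntegral_const, ← lintegral_indicator hset]
    refine lintegral_mono fun X => ?_
    by_cases hX : B n X ≤ n / (32 * C)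
    · rw [Set.indicator_of_mem (by exact hX)]
      exact ENNReal.ofReal_le_ofReal (Real.exp_le_exp.2 (neg_le_neg hX))
    · rw [Set.indicator_of_notMem (by exact hX)]
      exact zero_le
  have hpow : ENNReal.ofReal (Real.exp (-(1 / (16 * C)))) ^ n =
      ENNReal.ofReal (Real.exp (-(n / (32 * C)))) *
        ENNReal.ofReal (Real.exp (-(n / (32 * C)))) := by
    rw [← ENNReal.ofReal_pow (Real.exp_pos _).le, ← Real.exp_nat_mul,
      ← ENNReal.ofReal_mul (Real.exp_pos _).le, ← Real.exp_add]
    congr 2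
    field_simp
    ring
  have hfin := hlow.trans (hrec.trans (mul_le_mul' le_rfl hF0))
  rw [mul_one, hpow] at hfin
  exact (ENNReal.mul_le_mul_iff_right (ENNReal.ofReal_pos.2 (Real.exp_pos _)).ne'
    ENNReal.ofReal_ne_top).1 hfin

/-- A Chernoff bound for sums of independent variables with an exponential moment. -/
lemma measure_two_mul_le_sum {w : E → ℝ} (hw : Measurable w)
    (hexp : ∫⁻ x, ENNReal.ofReal (Real.exp (w x)) ∂μ ≤ 2) (n : ℕ) :
    (Measure.pi fun _ : Fin n => μ) {X | 2 * (n : ℝ) ≤ ∑ i, w (X i)} ≤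
      ENNReal.ofReal (Real.exp (-n)) := by
  set F : ∀ j : ℕ, (Fin j → E) → ℝ≥0∞ := fun j X =>
    ENNReal.ofReal (Real.exp (∑ i, w (X i))) with hF
  have hSm : ∀ j, Measurable fun X : Fin j → E => ∑ i, w (X i) := fun j =>
    Finset.measurable_sum _ fun i _ => hw.comp (measurable_pi_apply i)
  have hFm : ∀ j, Measurable (F j) := fun j => ((hSm j).exp).ennreal_ofReal
  have hstep : ∀ j (X : Fin j → E), ∫⁻ x, F (j + 1) (Fin.cons x X : Fin (j + 1) → E) ∂μ ≤
      2 * F j X := by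
    intro j X
    simp only [hF, Fin.sum_univ_succ, Fin.cons_zero, Fin.cons_succ, Real.exp_add]
    simp only [ENNReal.ofReal_mul (Real.exp_pos _).le]
    rw [lintegral_mul_const' _ _ ENNReal.ofReal_ne_top]
    exact mul_le_mul_left hexp _
  have hrec := lintegral_pi_le_pow μ F hFm 2 hstep n
  have hF0 : F 0 Fin.elim0 = 1 := by simp [hF]
  rw [hF0, mul_one] at hrec
  have hset : MeasurableSet {X : Fin n → E | 2 * (n : ℝ) ≤ ∑ i, w (X i)} :=
    measurableSet_le measurable_const (hSm n)
  have hlow : ENNReal.ofReal (Real.exp (2 * n)) *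
      (Measure.pi fun _ : Fin n => μ) {X : Fin n → E | 2 * (n : ℝ) ≤ ∑ i, w (X i)} ≤
      ∫⁻ X, F n X ∂(Measure.pi fun _ : Fin n => μ) := by
    rw [← setLIntegral_const, ← lintegral_indicator hset]
    refine lintegral_mono fun X => ?_
    by_cases hX : 2 * (n : ℝ) ≤ ∑ i, w (X i)
    · rw [Set.indicator_of_mem (by exact hX)]
      exact ENNReal.ofReal_le_ofReal (Real.exp_le_exp.2 hX)
    · rw [Set.indicator_of_notMem (by exact hX)]
      exact zero_le
  have h2 : (2 : ℝ≥0∞) ^ n ≤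
      ENNReal.ofReal (Real.exp (2 * n)) * ENNReal.ofReal (Real.exp (-n)) := by
    rw [← ENNReal.ofReal_mul (Real.exp_pos _).le, ← Real.exp_add]
    have e : Real.exp (2 * (n : ℝ) + -n) = Real.exp 1 ^ n := by
      rw [← Real.exp_nat_mul]; congr 1; ring
    rw [e, ENNReal.ofReal_pow (Real.exp_pos _).le]
    refine pow_le_pow_left' ?_ n
    have : (2 : ℝ≥0∞) = ENNReal.ofReal 2 := by simp
    rw [this]
    exact ENNReal.ofReal_le_ofReal (by linarith [Real.add_one_le_exp (1 : ℝ)])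
  exact (ENNReal.mul_le_mul_iff_right (ENNReal.ofReal_pos.2 (Real.exp_pos _)).ne'
    ENNReal.ofReal_ne_top).1 (hlow.trans (hrec.trans h2))

end Direction

/-! ### Uniformity over directions by a grid -/

section Net

variable {E H : Type*} [Fintype H] {κ : E → E → ℝ} {s : ℝ} {n : ℕ} {z : H → E → ℝ}

lemma resolventForm_le_sum_sq (hκ : IsPSDKernel κ) (hs : 0 < s) (f : E → ℝ) (X : Fin n → E) :
    s * resolventForm κ s f f X ≤ ∑ i, f (X i) ^ 2 := by
  have hG := kernelRidge_posDef hκ hs X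
  set w : Fin n → ℝ := fun i => f (X i) with hw
  set y := (kernelRidge κ s X)⁻¹ *ᵥ w with hy
  have h1 := kernelRidge_lower (s := s) hκ X y
  rw [hy, mulVec_inv_mulVec hG, ← hy] at h1
  have h2 : resolventForm κ s f f X = w ⬝ᵥ y := rfl
  have h3 : (∑ i, f (X i) ^ 2) = w ⬝ᵥ w := by simp [dotProduct, hw, sq]
  have h4 : 0 ≤ (w - s • y) ⬝ᵥ (w - s • y) := Finset.sum_nonneg fun i _ => mul_self_nonneg _
  rw [sub_dotProduct, dotProduct_sub, dotProduct_sub, smul_dotProduct, smul_dotProduct,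
    dotProduct_smul, dotProduct_smul, dotProduct_comm y w] at h4
  simp only [smul_eq_mul] at h4
  rw [h2, h3]
  rw [dotProduct_comm y w] at h1
  have h5 := mul_le_mul_of_nonneg_left h1 hs.le
  linarith

lemma headCov_quadratic_le (hκ : IsPSDKernel κ) (hs : 0 < s) (X : Fin n → E) (c : H → ℝ) :
    c ⬝ᵥ headCov κ s z X *ᵥ c ≤ (c ⬝ᵥ c) * ∑ i, ∑ a, z a (X i) ^ 2 := by
  rw [dotProduct_headCov_mulVec]
  refine (resolventForm_le_sum_sq hκ hs _ X).trans ?_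
  rw [Finset.mul_sum]
  refine Finset.sum_le_sum fun i _ => ?_
  have := Finset.sum_mul_sq_le_sq_mul_sq Finset.univ c fun a => z a (X i)
  simpa [dotProduct, sq] using this

/-- The points of the cubic grid of mesh `1 / M`, indexed by integer vectors. -/
noncomputable def gridPoint (M : ℕ) (m : H → ℤ) : H → ℝ := fun a => (m a : ℝ) / M

lemma exists_gridPoint [DecidableEq H] {M : ℕ} (hM : 0 < M) {v : H → ℝ} (hv : v ⬝ᵥ v = 1) :
    ∃ m ∈ Fintype.piFinset fun _ : H => Finset.Icc (-(M : ℤ)) M,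
      (v - gridPoint M m) ⬝ᵥ (v - gridPoint M m) ≤ (Fintype.card H : ℝ) / (M : ℝ) ^ 2 := by
  have hM0 : (0 : ℝ) < M := by exact_mod_cast hM
  have hva : ∀ a, |v a| ≤ 1 := by
    intro a
    rw [← sq_le_one_iff_abs_le_one]
    have : v a * v a ≤ v ⬝ᵥ v :=
      Finset.single_le_sum (f := fun a => v a * v a) (fun b _ => mul_self_nonneg _)
        (Finset.mem_univ a)
    nlinarith
  refine ⟨fun a => ⌊M * v a⌋, ?_, ?_⟩
  · rw [Fintype.mem_piFinset]
    intro a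
    have h := abs_le.1 (hva a)
    rw [Finset.mem_Icc]
    constructor
    · rw [Int.le_floor]
      push_cast
      nlinarith
    · have h1 : (⌊(M : ℝ) * v a⌋ : ℝ) ≤ M := (Int.floor_le _).trans (by nlinarith)
      exact_mod_cast h1
  · have : ∀ a, (v a - (⌊(M : ℝ) * v a⌋ : ℝ) / M) * (v a - (⌊(M : ℝ) * v a⌋ : ℝ) / M) ≤
        1 / (M : ℝ) ^ 2 := by
      intro a
      have h1 := Int.floor_le ((M : ℝ) * v a)
      have h2 := Int.lt_floor_add_one ((M : ℝ) * v a)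
      have e : v a - (⌊(M : ℝ) * v a⌋ : ℝ) / M = (M * v a - ⌊(M : ℝ) * v a⌋) / M := by
        field_simp
      rw [e, div_mul_div_comm, ← sq (M : ℝ)]
      refine div_le_div_of_nonneg_right ?_ (by positivity)
      nlinarith
    calc (v - gridPoint M fun a => ⌊(M : ℝ) * v a⌋) ⬝ᵥ (v - gridPoint M fun a => ⌊(M : ℝ) * v a⌋)
        ≤ ∑ _a : H, 1 / (M : ℝ) ^ 2 := Finset.sum_le_sum fun a _ => this a
      _ = _ := by simp [div_eq_mul_inv]

lemma quadratic_add_le {S : Matrix H H ℝ} (hS : S.PosSemidef) (u v : H → ℝ) :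
    u ⬝ᵥ S *ᵥ u ≤ 2 * (v ⬝ᵥ S *ᵥ v) + 2 * ((v - u) ⬝ᵥ S *ᵥ (v - u)) := by
  have h : 0 ≤ ((v + (v - u))) ⬝ᵥ S *ᵥ ((v + (v - u))) := by
    simpa using hS.dotProduct_mulVec_nonneg (v + (v - u))
  have hsym : Sᵀ = S := by
    have := hS.isHermitian
    rwa [IsHermitian, conjTranspose_eq_transpose_of_trivial] at this
  have huv : v ⬝ᵥ S *ᵥ u = u ⬝ᵥ S *ᵥ v := by
    rw [symm_dotProduct_mulVec hsym, dotProduct_comm]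
  simp only [mulVec_add, mulVec_sub, add_dotProduct, dotProduct_add, sub_dotProduct,
    dotProduct_sub, huv] at h ⊢
  linarith

/-- A lower bound of the head covariance on the grid extends to all directions. -/
lemma headCov_lower_of_grid [DecidableEq H] (hκ : IsPSDKernel κ) (hs : 0 < s)
    (X : Fin n → E) {M : ℕ} (hM : 0 < M) {b R : ℝ} (hR : ∑ i, ∑ a, z a (X i) ^ 2 ≤ R)
    (hcard : 4 * (Fintype.card H : ℝ) ≤ (M : ℝ) ^ 2)
    (hbR : 4 * R * (Fintype.card H : ℝ) ≤ b * (M : ℝ) ^ 2)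
    (hgrid : ∀ m ∈ Fintype.piFinset fun _ : H => Finset.Icc (-(M : ℤ)) M,
      1 / 4 ≤ gridPoint M m ⬝ᵥ gridPoint M m →
        b ≤ gridPoint M m ⬝ᵥ headCov κ s z X *ᵥ gridPoint M m) (v : H → ℝ) :
    b / 4 * (v ⬝ᵥ v) ≤ v ⬝ᵥ headCov κ s z X *ᵥ v := by
  have hM0 : (0 : ℝ) < (M : ℝ) ^ 2 := by positivity
  have hS := headCov_posSemidef (z := z) hκ hs X
  have hunit : ∀ v : H → ℝ, v ⬝ᵥ v = 1 → b / 4 ≤ v ⬝ᵥ headCov κ s z X *ᵥ v := by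
    intro v hv
    obtain ⟨m, hm, hvm⟩ := exists_gridPoint hM hv
    set u := gridPoint M m with hu
    have hR0 : 0 ≤ R := le_trans (Finset.sum_nonneg fun i _ => Finset.sum_nonneg fun a _ =>
      sq_nonneg _) hR
    have h1 : (Fintype.card H : ℝ) / (M : ℝ) ^ 2 ≤ 1 / 4 := by
      rw [div_le_div_iff₀ hM0 (by norm_num)]; linarith
    have h2 : 1 / 4 ≤ u ⬝ᵥ u := by
      have : v ⬝ᵥ v ≤ 2 * (u ⬝ᵥ u) + 2 * ((v - u) ⬝ᵥ (v - u)) := by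
        have h : 0 ≤ (u - (v - u)) ⬝ᵥ (u - (v - u)) :=
          Finset.sum_nonneg fun i _ => mul_self_nonneg _
        simp only [sub_dotProduct, dotProduct_sub, dotProduct_comm u v] at h ⊢
        linarith
      linarith
    have h3 := hgrid m hm h2
    have h4 := quadratic_add_le hS u v
    have h5 := headCov_quadratic_le (z := z) hκ hs X (v - u)
    have h6 : (v - u) ⬝ᵥ (v - u) * ∑ i, ∑ a, z a (X i) ^ 2 ≤ b / 4 := by
      calc (v - u) ⬝ᵥ (v - u) * ∑ i, ∑ a, z a (X i) ^ 2
          ≤ (Fintype.card H : ℝ) / (M : ℝ) ^ 2 * R := mul_le_mul hvm hR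
            (Finset.sum_nonneg fun i _ => Finset.sum_nonneg fun a _ => sq_nonneg _)
            (by positivity)
        _ ≤ b / 4 := by
            rw [div_mul_eq_mul_div, div_le_iff₀ hM0]
            linarith
    linarith
  rcases eq_or_ne v 0 with rfl | hv
  · simp
  · have hvv : 0 < v ⬝ᵥ v := by
      refine lt_of_le_of_ne (Finset.sum_nonneg fun i _ => mul_self_nonneg _) fun h0 => hv ?_
      exact dotProduct_self_eq_zero.1 h0.symm
    have hsq : √(v ⬝ᵥ v) * √(v ⬝ᵥ v) = v ⬝ᵥ v := Real.mul_self_sqrt hvv.le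
    have hsq0 : 0 < √(v ⬝ᵥ v) := Real.sqrt_pos.2 hvv
    have h := hunit ((√(v ⬝ᵥ v))⁻¹ • v) (by
      rw [smul_dotProduct, dotProduct_smul, smul_eq_mul, smul_eq_mul, ← mul_assoc, ← mul_inv, hsq]
      exact inv_mul_cancel₀ hvv.ne')
    rw [mulVec_smul, smul_dotProduct, dotProduct_smul, smul_eq_mul, smul_eq_mul, ← mul_assoc,
      ← mul_inv, hsq, inv_mul_eq_div, le_div_iff₀ hvv] at h
    exact h

end Net

/-! ### The kernel of the tail coordinates -/

section TailKernel

variable {p : ℕ∞}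

/-- The first `k` coordinates. -/
abbrev Head (p : ℕ∞) (k : ℕ) : Type := {l : Idx p // (l : ℕ) < k}

instance (k : ℕ) : Finite (Head p k) :=
  Finite.of_injective (fun l : Head p k => (⟨l.1.1, l.2⟩ : Fin k)) fun a b h => by
    have := congrArg Fin.val h
    exact Subtype.ext (Subtype.ext this)

noncomputable instance (k : ℕ) : Fintype (Head p k) := Fintype.ofFinite _

lemma card_head_le (k : ℕ) : Fintype.card (Head p k) ≤ k := by
  have := Fintype.card_le_of_injective (fun l : Head p k => (⟨l.1.1, l.2⟩ : Fin k)) fun a b h => by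
    have := congrArg Fin.val h
    exact Subtype.ext (Subtype.ext this)
  simpa using this

open Classical in
/-- The vector `x`, replaced by `0` if it is not square summable. -/
noncomputable def tame (x : Idx p → ℝ) : Idx p → ℝ := if Summable fun l => x l ^ 2 then x else 0

lemma summable_tame (x : Idx p → ℝ) : Summable fun l => tame x l ^ 2 := by
  unfold tame
  split_ifs with h
  · exact h
  · simp

lemma tame_eq {x : Idx p → ℝ} (h : Summable fun l => x l ^ 2) : tame x = x := if_pos h

lemma summable_mul_of_sq {ι : Type*} {f g : ι → ℝ} (hf : Summable fun l => f l ^ 2)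
    (hg : Summable fun l => g l ^ 2) : Summable fun l => f l * g l := by
  refine Summable.of_norm_bounded (hf.add hg) fun l => ?_
  rw [Real.norm_eq_abs, abs_le]
  constructor <;> nlinarith [sq_nonneg (f l + g l), sq_nonneg (f l - g l), sq_nonneg (f l),
    sq_nonneg (g l)]

lemma summable_ite {ι : Type*} {f : ι → ℝ} (P : ι → Prop) [DecidablePred P] (hf : Summable f) :
    Summable fun l => if P l then f l else 0 := by
  have := hf.indicator {l | P l}
  refine this.congr fun l => ?_
  simp [Set.indicator_apply]

lemma summable_sum_sq {ι : Type*} {n : ℕ} {f : Fin n → ι → ℝ} (c : Fin n → ℝ)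
    (hf : ∀ i, Summable fun l => f i l ^ 2) : Summable fun l => (∑ i, c i * f i l) ^ 2 := by
  have : ∀ l, (∑ i, c i * f i l) ^ 2 = ∑ i, ∑ j, (c i * c j) * (f i l * f j l) := by
    intro l
    rw [sq, Finset.sum_mul_sum]
    exact Finset.sum_congr rfl fun i _ => Finset.sum_congr rfl fun j _ => by ring
  simp only [this]
  exact summable_sum fun i _ => summable_sum fun j _ =>
    (summable_mul_of_sq (hf i) (hf j)).mul_left _

/-- The inner product of the coordinates after the first `k`. Vectors that are not square summable
are treated as `0`, which makes the kernel positive semidefinite everywhere. -/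
noncomputable def tailKernel (k : ℕ) (x y : Idx p → ℝ) : ℝ :=
  ∑' l : Idx p, if k ≤ (l : ℕ) then tame x l * tame y l else 0

lemma summable_tailKernel (k : ℕ) (x y : Idx p → ℝ) :
    Summable fun l : Idx p => if k ≤ (l : ℕ) then tame x l * tame y l else 0 :=
  summable_ite _ (summable_mul_of_sq (summable_tame x) (summable_tame y))

lemma sum_tailKernel (k : ℕ) {n : ℕ} (X : Fin n → Idx p → ℝ) (c : Fin n → ℝ) :
    ∑ i, ∑ j, c i * c j * tailKernel k (X i) (X j) =
      ∑' l : Idx p, if k ≤ (l : ℕ) then (∑ i, c i * tame (X i) l) ^ 2 else 0 := by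
  have h1 : ∀ i j, c i * c j * tailKernel k (X i) (X j) =
      ∑' l : Idx p, c i * c j * (if k ≤ (l : ℕ) then tame (X i) l * tame (X j) l else 0) :=
    fun i j => (tsum_mul_left).symm
  simp only [h1]
  have h2 : ∀ i, ∑ j, ∑' l : Idx p,
      c i * c j * (if k ≤ (l : ℕ) then tame (X i) l * tame (X j) l else 0) =
      ∑' l : Idx p, ∑ j, c i * c j * (if k ≤ (l : ℕ) then tame (X i) l * tame (X j) l else 0) :=
    fun i => (Summable.tsum_finsetSum fun j _ =>
      (summable_tailKernel k (X i) (X j)).mul_left _).symm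
  simp only [h2]
  rw [← Summable.tsum_finsetSum fun i _ => summable_sum fun j _ =>
      (summable_tailKernel k (X i) (X j)).mul_left _]
  refine tsum_congr fun l => ?_
  split_ifs
  · rw [sq, Finset.sum_mul_sum]
    exact Finset.sum_congr rfl fun i _ => Finset.sum_congr rfl fun j _ => by ring
  · simp

lemma sq_le_sum_tailKernel (k : ℕ) {n : ℕ} (X : Fin n → Idx p → ℝ) (c : Fin n → ℝ) {l : Idx p}
    (hl : k ≤ (l : ℕ)) :
    (∑ i, c i * tame (X i) l) ^ 2 ≤ ∑ i, ∑ j, c i * c j * tailKernel k (X i) (X j) := by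
  rw [sum_tailKernel]
  have hs : Summable fun l : Idx p => if k ≤ (l : ℕ) then (∑ i, c i * tame (X i) l) ^ 2 else 0 :=
    summable_ite _ (summable_sum_sq c fun i => summable_tame (X i))
  have := hs.le_tsum l fun j _ => by split_ifs <;> positivity
  simpa [hl] using this

lemma isPSDKernel_tailKernel (k : ℕ) : IsPSDKernel (tailKernel (p := p) k) where
  symm x y := by
    unfold tailKernel
    refine tsum_congr fun l => ?_
    rw [mul_comm]
  nonneg n X c := by
    rw [sum_tailKernel]
    exact tsum_nonneg fun l => by split_ifs <;> positivity

lemma tailKernel_self_nonneg (k : ℕ) (x : Idx p → ℝ) : 0 ≤ tailKernel k x x :=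
  tsum_nonneg fun l => by split_ifs; exacts [mul_self_nonneg _, le_rfl]

lemma sq_tailKernel_le (k : ℕ) (x y : Idx p → ℝ) :
    tailKernel k x y ^ 2 ≤ tailKernel k x x * tailKernel k y y := by
  have hκ := isPSDKernel_tailKernel (p := p) k
  have hx := tailKernel_self_nonneg k x
  have h : ∀ a b : ℝ, 0 ≤ a ^ 2 * tailKernel k x x + 2 * (a * b) * tailKernel k x y +
      b ^ 2 * tailKernel k y y := by
    intro a b
    have := hκ.nonneg 2 ![x, y] ![a, b]
    simp only [Fin.sum_univ_two, Matrix.cons_val_zero, Matrix.cons_val_one] at this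
    rw [hκ.symm y x] at this
    nlinarith
  rcases hx.eq_or_lt with h0 | h0
  · have hy := tailKernel_self_nonneg k y
    rw [← h0, zero_mul]
    by_contra hne
    push Not at hne
    have hne' : tailKernel k x y ≠ 0 := fun h => by rw [h] at hne; simp at hne
    have := h (-(tailKernel k y y + 1) / (2 * tailKernel k x y)) 1
    rw [← h0] at this
    have e : 2 * (-(tailKernel k y y + 1) / (2 * tailKernel k x y) * 1) * tailKernel k x y =
        -(tailKernel k y y + 1) := by field_simp
    rw [e] at this
    linarith
  · have := h (tailKernel k x y) (-(tailKernel k x x))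
    have e : tailKernel k x x * (tailKernel k x x * tailKernel k y y - tailKernel k x y ^ 2) =
        tailKernel k x y ^ 2 * tailKernel k x x + 2 * (tailKernel k x y * -(tailKernel k x x)) *
          tailKernel k x y + (-(tailKernel k x x)) ^ 2 * tailKernel k y y := by ring
    rw [← e] at this
    have := nonneg_of_mul_nonneg_right this h0
    linarith

lemma measurableSet_sqSummable :
    MeasurableSet {x : Idx p → ℝ | Summable fun l => x l ^ 2} := by
  have : {x : Idx p → ℝ | Summable fun l => x l ^ 2} =
      {x | ∑' l, ENNReal.ofReal (x l ^ 2) ≠ ⊤} := by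
    ext x
    simp only [Set.mem_ofPred_eq]
    constructor
    · intro h
      exact h.tsum_ofReal_ne_top
    · intro h
      have := ENNReal.summable_toReal h
      simpa [ENNReal.toReal_ofReal, sq_nonneg] using this
  rw [this]
  have hm : Measurable fun x : Idx p → ℝ => ∑' l, ENNReal.ofReal (x l ^ 2) :=
    Measurable.tsum fun l => ((measurable_pi_apply l).pow_const 2).ennreal_ofReal
  exact (hm (measurableSet_singleton ⊤)).compl

lemma measurable_tame (l : Idx p) : Measurable fun x : Idx p → ℝ => tame x l := by
  classical
  have : (fun x : Idx p → ℝ => tame x l) = fun x =>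
      if x ∈ {x : Idx p → ℝ | Summable fun l => x l ^ 2} then x l else 0 := by
    ext x
    by_cases h : Summable fun l => x l ^ 2 <;> simp [tame, h]
  rw [this]
  exact Measurable.ite measurableSet_sqSummable (measurable_pi_apply l) measurable_const

lemma measurable_tailKernel (k : ℕ) :
    Measurable fun q : (Idx p → ℝ) × (Idx p → ℝ) => tailKernel k q.1 q.2 := by
  unfold tailKernel
  refine Measurable.tsum fun l => ?_
  split_ifs
  · exact ((measurable_tame l).comp measurable_fst).mul ((measurable_tame l).comp measurable_snd)
  · exact measurable_const

end TailKernel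

/-! ### Moments of the features -/

section FeatureMoments

variable {p : ℕ∞} {lam : Idx p → ℝ} {μ : Measure (Idx p → ℝ)}

/-- The trace of the tail covariance, as a real number. -/
noncomputable def tailSum (lam : Idx p → ℝ) (k : ℕ) : ℝ :=
  ∑' l : Idx p, if k ≤ (l : ℕ) then lam l else 0

lemma lintegral_sq_coord (hμ : IsFeatureLaw lam μ) (l : Idx p) :
    ∫⁻ x, ENNReal.ofReal (x l ^ 2) ∂μ = ENNReal.ofReal (lam l) := by
  rw [← ofReal_integral_eq_lintegral_ofReal (hμ.memLp l).integrable_sq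
    (Eventually.of_forall fun x => sq_nonneg _)]
  congr 1
  have := hμ.cov l l
  simpa [sq] using this

lemma ae_sqSummable (hμ : IsFeatureLaw lam μ) : ∀ᵐ x ∂μ, Summable fun l => x l ^ 2 := by
  have hm : ∀ l, Measurable fun x : Idx p → ℝ => ENNReal.ofReal (x l ^ 2) := fun l =>
    ((measurable_pi_apply l).pow_const 2).ennreal_ofReal
  have h1 : ∫⁻ x, ∑' l, ENNReal.ofReal (x l ^ 2) ∂μ ≠ ⊤ := by
    rw [lintegral_tsum fun l => (hm l).aemeasurable]
    simp only [lintegral_sq_coord hμ]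
    exact hμ.summable.tsum_ofReal_ne_top
  filter_upwards [ae_lt_top (Measurable.tsum hm) h1] with x hx
  have := ENNReal.summable_toReal hx.ne
  simpa [ENNReal.toReal_ofReal, sq_nonneg] using this

lemma ofReal_tailKernel_self (k : ℕ) {x : Idx p → ℝ} (hx : Summable fun l => x l ^ 2) :
    ENNReal.ofReal (tailKernel k x x) =
      ∑' l : Idx p, if k ≤ (l : ℕ) then ENNReal.ofReal (x l ^ 2) else 0 := by
  unfold tailKernel
  rw [ENNReal.ofReal_tsum_of_nonneg _ (summable_tailKernel k x x)]
  · refine tsum_congr fun l => ?_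
    rw [tame_eq hx, ← sq]
    split_ifs <;> simp
  · intro l
    split_ifs
    exacts [mul_self_nonneg _, le_rfl]

lemma ofReal_tailSum (hμ : IsFeatureLaw lam μ) (k : ℕ) :
    ENNReal.ofReal (tailSum lam k) =
      ∑' l : Idx p, if k ≤ (l : ℕ) then ENNReal.ofReal (lam l) else 0 := by
  unfold tailSum
  rw [ENNReal.ofReal_tsum_of_nonneg _ (summable_ite _ hμ.summable)]
  · refine tsum_congr fun l => ?_
    split_ifs <;> simp
  · intro l
    split_ifs
    exacts [(hμ.pos l).le, le_rfl]

lemma tailSum_nonneg (hμ : IsFeatureLaw lam μ) (k : ℕ) : 0 ≤ tailSum lam k :=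
  tsum_nonneg fun l => by split_ifs; exacts [(hμ.pos l).le, le_rfl]

lemma measurable_tailKernel_self (k : ℕ) :
    Measurable fun x : Idx p → ℝ => tailKernel k x x := by
  unfold tailKernel
  refine Measurable.tsum fun l => ?_
  split_ifs
  · exact (measurable_tame l).mul (measurable_tame l)
  · exact measurable_const

lemma lintegral_tailKernel_self (hμ : IsFeatureLaw lam μ) (k : ℕ) :
    ∫⁻ x, ENNReal.ofReal (tailKernel k x x) ∂μ = ENNReal.ofReal (tailSum lam k) := by
  have h1 : ∀ᵐ x ∂μ, ENNReal.ofReal (tailKernel k x x) =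
      ∑' l : Idx p, if k ≤ (l : ℕ) then ENNReal.ofReal (x l ^ 2) else 0 := by
    filter_upwards [ae_sqSummable hμ] with x hx using ofReal_tailKernel_self k hx
  rw [lintegral_congr_ae h1, lintegral_tsum, ofReal_tailSum hμ]
  · refine tsum_congr fun l => ?_
    split_ifs
    · exact lintegral_sq_coord hμ l
    · simp
  · intro l
    split_ifs
    · exact ((measurable_pi_apply l).pow_const 2).ennreal_ofReal.aemeasurable
    · exact aemeasurable_const

lemma integrable_tailKernel_self (hμ : IsFeatureLaw lam μ) (k : ℕ) :
    Integrable (fun x => tailKernel k x x) μ := by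
  refine ⟨(measurable_tailKernel_self k).aestronglyMeasurable, ?_⟩
  rw [hasFiniteIntegral_iff_ofReal (Eventually.of_forall fun x => tailKernel_self_nonneg k x),
    lintegral_tailKernel_self hμ]
  exact ENNReal.ofReal_lt_top

lemma integral_tailKernel_self (hμ : IsFeatureLaw lam μ) (k : ℕ) :
    ∫ x, tailKernel k x x ∂μ = tailSum lam k := by
  rw [integral_eq_lintegral_of_nonneg_ae (Eventually.of_forall fun x => tailKernel_self_nonneg k x)
    (measurable_tailKernel_self k).aestronglyMeasurable, lintegral_tailKernel_self hμ,
    ENNReal.toReal_ofReal (tailSum_nonneg hμ k)]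

/-- The whitened head coordinates as feature functions. -/
noncomputable def headFeature (lam : Idx p → ℝ) (k : ℕ) (a : Head p k) (x : Idx p → ℝ) : ℝ :=
  whiten lam x a.1

lemma headFeature_eq (lam : Idx p → ℝ) (k : ℕ) (a : Head p k) (x : Idx p → ℝ) :
    headFeature lam k a x = (√(lam a.1))⁻¹ * x a.1 := by
  rw [headFeature, whiten, div_eq_inv_mul]

lemma isHeadTailModel (hμ : IsFeatureLaw lam μ) (k : ℕ) :
    IsHeadTailModel μ (tailKernel k) (headFeature lam k) where
  psd := isPSDKernel_tailKernel k
  measurable_kernel := measurable_tailKernel k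
  measurable_head a := by
    simp only [funext fun x => headFeature_eq lam k a x]
    exact (measurable_pi_apply _).const_mul _
  memLp_head a := by
    simp only [funext fun x => headFeature_eq lam k a x]
    exact (hμ.memLp a.1).const_mul _
  memLp_kernel y := by
    have hm : Measurable fun x : Idx p → ℝ => tailKernel k x y := by
      unfold tailKernel
      refine Measurable.tsum fun l => ?_
      split_ifs
      · exact (measurable_tame l).mul measurable_const
      · exact measurable_const
    rw [memLp_two_iff_integrable_sq hm.aestronglyMeasurable]
    refine ((integrable_tailKernel_self hμ k).mul_const (tailKernel k y y)).mono'
      (hm.pow_const 2).aestronglyMeasurable (Eventually.of_forall fun x => ?_)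
    rw [Real.norm_eq_abs, abs_of_nonneg (sq_nonneg _)]
    exact sq_tailKernel_le k x y
  orthonormal a b := by
    have e : ∀ x, headFeature lam k a x * headFeature lam k b x =
        (√(lam a.1))⁻¹ * (√(lam b.1))⁻¹ * (x a.1 * x b.1) := by
      intro x
      rw [headFeature_eq, headFeature_eq]
      ring
    simp only [e]
    rw [integral_const_mul, hμ.cov]
    by_cases hab : a = b
    · subst hab
      have h2 := Real.mul_self_sqrt (hμ.pos a.1).le
      simp only [if_true]
      rw [← mul_inv, h2]
      exact inv_mul_cancel₀ (hμ.pos a.1).ne'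
    · have : a.1 ≠ b.1 := fun h => hab (Subtype.ext h)
      simp [hab, this]
  uncorrelated a y := by
    set F : Idx p → (Idx p → ℝ) → ℝ := fun l x =>
      if k ≤ (l : ℕ) then tame y l * ((√(lam a.1))⁻¹ * (x a.1 * x l)) else 0 with hF
    have hprod : ∀ l, Integrable (fun x : Idx p → ℝ => x a.1 * x l) μ := fun l =>
      (hμ.memLp a.1).integrable_mul (hμ.memLp l)
    have hFi : ∀ l, Integrable (F l) μ := by
      intro l
      simp only [hF]
      split_ifs
      · exact ((hprod l).const_mul _).const_mul _
      · exact integrable_zero _ _ _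
    have hF0 : ∀ l, ∫ x, F l x ∂μ = 0 := by
      intro l
      simp only [hF]
      split_ifs with hl
      · rw [integral_const_mul, integral_const_mul, hμ.cov, if_neg, mul_zero, mul_zero]
        intro h
        have h1 := a.2
        rw [h] at h1
        omega
      · simp
    have hsq : ∀ l, ∫ x, x l ^ 2 ∂μ = lam l := fun l => by
      have := hμ.cov l l
      simpa [sq] using this
    have hFn : ∀ l, ∫ x, ‖F l x‖ ∂μ ≤ tame y l ^ 2 + lam l := by
      intro l
      have hl0 := hμ.pos l
      have ha0 := hμ.pos a.1
      have hpt : ∀ x, ‖F l x‖ ≤ tame y l ^ 2 * (x a.1 ^ 2 / lam a.1) / 2 + x l ^ 2 / 2 := by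
        intro x
        simp only [hF]
        split_ifs
        · have e : tame y l ^ 2 * (x a.1 ^ 2 / lam a.1) =
              (tame y l * ((√(lam a.1))⁻¹ * x a.1)) ^ 2 := by
            rw [mul_pow, mul_pow, inv_pow, Real.sq_sqrt ha0.le]
            ring
          rw [e, Real.norm_eq_abs, abs_le]
          set u := tame y l * ((√(lam a.1))⁻¹ * x a.1) with hu
          have e2 : tame y l * ((√(lam a.1))⁻¹ * (x a.1 * x l)) = u * x l := by rw [hu]; ring
          rw [e2]
          constructor <;> nlinarith [sq_nonneg (u + x l), sq_nonneg (u - x l)]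
        · rw [norm_zero]
          positivity
      have hi1 : Integrable (fun x : Idx p → ℝ => tame y l ^ 2 * (x a.1 ^ 2 / lam a.1) / 2) μ :=
        (((hμ.memLp a.1).integrable_sq.div_const _).const_mul _).div_const _
      have hi2 : Integrable (fun x : Idx p → ℝ => x l ^ 2 / 2) μ :=
        (hμ.memLp l).integrable_sq.div_const _
      refine (integral_mono (hFi l).norm (hi1.add hi2) hpt).trans ?_
      have e3 : ∫ x, (fun x : Idx p → ℝ => tame y l ^ 2 * (x a.1 ^ 2 / lam a.1) / 2) x +
          (fun x : Idx p → ℝ => x l ^ 2 / 2) x ∂μ = tame y l ^ 2 / 2 + lam l / 2 := by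
        rw [integral_add hi1 hi2, integral_div, integral_div, integral_const_mul, integral_div,
          hsq, hsq, div_self ha0.ne', mul_one]
      refine (le_of_eq e3).trans ?_
      nlinarith [sq_nonneg (tame y l)]
    have hsum : Summable fun l => ∫ x, ‖F l x‖ ∂μ :=
      Summable.of_nonneg_of_le (fun l => integral_nonneg fun x => norm_nonneg _) hFn
        ((summable_tame y).add hμ.summable)
    have hkey := integral_tsum_of_summable_integral_norm hFi hsum
    simp only [hF0, tsum_zero] at hkey
    rw [hkey]
    refine integral_congr_ae ?_
    filter_upwards [ae_sqSummable hμ] with x hx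
    rw [tailKernel, ← tsum_mul_left]
    refine tsum_congr fun l => ?_
    simp only [hF, tame_eq hx, headFeature_eq]
    split_ifs
    · ring
    · simp

end FeatureMoments

/-! ### The variance term -/

section Variance

variable {p : ℕ∞} {lam : Idx p → ℝ} {μ : Measure (Idx p → ℝ)} {ν : Measure ℝ} {σ : ℝ} {n : ℕ}

lemma lintegral_sq_noise (hν : IsNoiseLaw ν σ) (b : Fin n → ℝ) :
    ∫⁻ e, ENNReal.ofReal ((b ⬝ᵥ e) ^ 2) ∂(Measure.pi fun _ : Fin n => ν) =
      ENNReal.ofReal (σ ^ 2 * (b ⬝ᵥ b)) := by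
  have := hν.prob
  have hL : ∀ i, MemLp (fun e : Fin n → ℝ => e i) 2 (Measure.pi fun _ : Fin n => ν) := fun i =>
    hν.memLp.comp_measurePreserving (measurePreserving_eval (fun _ : Fin n => ν) i)
  have hind := iIndepFun_pi (μ := fun _ : Fin n => ν) (X := fun _ e => e)
    fun _ => aemeasurable_id
  have hm : ∀ i j, ∫ e : Fin n → ℝ, e i * e j ∂(Measure.pi fun _ : Fin n => ν) =
      if i = j then σ ^ 2 else 0 := by
    intro i j
    split_ifs with hij
    · subst hij
      have h := integral_comp_eval (μ := fun _ : Fin n => ν) (i := i) (f := fun e : ℝ => e ^ 2)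
        (measurable_id.pow_const 2).aestronglyMeasurable
      simp only [← sq]
      exact h.trans hν.var
    · rw [(hind.indepFun hij).integral_fun_mul_eq_mul_integral (hL i).aestronglyMeasurable
        (hL j).aestronglyMeasurable]
      have h := integral_comp_eval (μ := fun _ : Fin n => ν) (i := i) (f := fun e : ℝ => e)
        measurable_id.aestronglyMeasurable
      rw [h, hν.mean, zero_mul]
  have hi : ∀ i j, Integrable (fun e : Fin n → ℝ => (b i * b j) * (e i * e j))
      (Measure.pi fun _ : Fin n => ν) := fun i j => ((hL i).integrable_mul (hL j)).const_mul _
  have e1 : ∀ e : Fin n → ℝ, (b ⬝ᵥ e) ^ 2 = ∑ i, ∑ j, (b i * b j) * (e i * e j) := by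
    intro e
    rw [dotProduct, sq, Finset.sum_mul_sum]
    exact Finset.sum_congr rfl fun i _ => Finset.sum_congr rfl fun j _ => by ring
  have hint : Integrable (fun e : Fin n → ℝ => (b ⬝ᵥ e) ^ 2) (Measure.pi fun _ : Fin n => ν) := by
    simp only [e1]
    exact integrable_finsetSum _ fun i _ => integrable_finsetSum _ fun j _ => hi i j
  rw [← ofReal_integral_eq_lintegral_ofReal hint (Eventually.of_forall fun e => sq_nonneg _)]
  congr 1
  simp only [e1]
  rw [integral_finsetSum _ fun i _ => integrable_finsetSum _ fun j _ => hi i j]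
  rw [dotProduct, Finset.mul_sum]
  refine Finset.sum_congr rfl fun i _ => ?_
  rw [integral_finsetSum _ fun j _ => hi i j]
  simp only [integral_const_mul, hm]
  simp
  ring

/-- The second moment of a linear functional with square summable coefficients, by Fatou's lemma
from the finite case. -/
lemma lintegral_sq_tsum_le (hμ : IsFeatureLaw lam μ) {h : Idx p → ℝ}
    (hh : Summable fun l => h l ^ 2) :
    ∫⁻ x, ENNReal.ofReal ((∑' l, x l * h l) ^ 2) ∂μ ≤ ∑' l, ENNReal.ofReal (lam l * h l ^ 2) := by
  set f : Finset (Idx p) → (Idx p → ℝ) → ℝ≥0∞ := fun t x =>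
    ENNReal.ofReal ((∑ l ∈ t, x l * h l) ^ 2) with hf
  have hfm : ∀ t, Measurable (f t) := by
    intro t
    refine Measurable.ennreal_ofReal (Measurable.pow_const ?_ 2)
    exact Finset.measurable_sum _ fun l _ => (measurable_pi_apply l).mul_const _
  have hft : ∀ t, ∫⁻ x, f t x ∂μ ≤ ∑' l, ENNReal.ofReal (lam l * h l ^ 2) := by
    intro t
    have hi : ∀ i j, Integrable (fun x : Idx p → ℝ => (h i * h j) * (x i * x j)) μ := fun i j =>
      ((hμ.memLp i).integrable_mul (hμ.memLp j)).const_mul _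
    have e1 : ∀ x : Idx p → ℝ, (∑ l ∈ t, x l * h l) ^ 2 =
        ∑ i ∈ t, ∑ j ∈ t, (h i * h j) * (x i * x j) := by
      intro x
      rw [sq, Finset.sum_mul_sum]
      exact Finset.sum_congr rfl fun i _ => Finset.sum_congr rfl fun j _ => by ring
    have hint : Integrable (fun x : Idx p → ℝ => (∑ l ∈ t, x l * h l) ^ 2) μ := by
      simp only [e1]
      exact integrable_finsetSum _ fun i _ => integrable_finsetSum _ fun j _ => hi i j
    have e2 : ∫ x, (∑ l ∈ t, x l * h l) ^ 2 ∂μ = ∑ l ∈ t, lam l * h l ^ 2 := by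
      simp only [e1]
      rw [integral_finsetSum _ fun i _ => integrable_finsetSum _ fun j _ => hi i j]
      refine Finset.sum_congr rfl fun i hit => ?_
      rw [integral_finsetSum _ fun j _ => hi i j]
      simp only [integral_const_mul, hμ.cov]
      simp [hit]
      ring
    rw [← ofReal_integral_eq_lintegral_ofReal hint (Eventually.of_forall fun x => sq_nonneg _), e2,
      ENNReal.ofReal_sum_of_nonneg fun l _ => mul_nonneg (hμ.pos l).le (sq_nonneg _)]
    exact ENNReal.sum_le_tsum t
  have hlim : ∀ᵐ x ∂μ, ENNReal.ofReal ((∑' l, x l * h l) ^ 2) = liminf (fun t => f t x) atTop := by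
    filter_upwards [ae_sqSummable hμ] with x hx
    have h1 : Tendsto (fun t => f t x) atTop (nhds (ENNReal.ofReal ((∑' l, x l * h l) ^ 2))) :=
      ENNReal.tendsto_ofReal (((summable_mul_of_sq hx hh).hasSum).pow 2)
    exact h1.liminf_eq.symm
  rw [lintegral_congr_ae hlim]
  refine (lintegral_liminf_le hfm).trans ?_
  refine (liminf_le_liminf (Eventually.of_forall hft)).trans ?_
  simp

lemma kernelRidge_zero_eq {s : ℝ} {X : Fin n → Idx p → ℝ}
    (hX : ∀ i, Summable fun l => X i l ^ 2) :
    gram X + s • (1 : Matrix (Fin n) (Fin n) ℝ) = kernelRidge (tailKernel 0) s X := by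
  rw [kernelRidge, add_comm]
  congr 1
  ext i j
  simp only [gram, of_apply, tailKernel, tame_eq (hX i), tame_eq (hX j)]
  simp

/-- The variance, with the expectation over the noise and over the test point carried out. -/
lemma varianceTerm_le_tsum (hμ : IsFeatureLaw lam μ) (hν : IsNoiseLaw ν σ) {ρ : ℝ}
    (hρ : 0 < (n : ℝ) * ρ) {X : Fin n → Idx p → ℝ} (hX : ∀ i, Summable fun l => X i l ^ 2) :
    varianceTerm μ ν ρ X ≤ ENNReal.ofReal (σ ^ 2) * ∑' l, ENNReal.ofReal (lam l *
      (((kernelRidge (tailKernel 0) (n * ρ) X)⁻¹ *ᵥ fun i => X i l) ⬝ᵥ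
        ((kernelRidge (tailKernel 0) (n * ρ) X)⁻¹ *ᵥ fun i => X i l))) := by
  have := hμ.prob
  have := hν.prob
  have hA := kernelRidge_posDef (isPSDKernel_tailKernel (p := p) 0) hρ X
  unfold varianceTerm
  unfold regressor
  rw [kernelRidge_zero_eq hX]
  set R := (kernelRidge (tailKernel 0) (n * ρ) X)⁻¹ with hR
  have hRt : Rᵀ = R := transpose_eq_of_posDef hA.inv
  set h : Fin n → Idx p → ℝ := fun i l => (R *ᵥ fun j => X j l) i with hh
  have hhs : ∀ i, Summable fun l => h i l ^ 2 := fun i => summable_sum_sq (R i) hX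
  refine (lintegral_prod_le _).trans ?_
  have hinner : ∀ᵐ x ∂μ, ∫⁻ e, ENNReal.ofReal
      ((∑' l, x l * ∑ i, X i l * (R *ᵥ e) i) ^ 2) ∂(Measure.pi fun _ : Fin n => ν) =
        ENNReal.ofReal (σ ^ 2) * ∑ i, ENNReal.ofReal ((∑' l, x l * h i l) ^ 2) := by
    filter_upwards [ae_sqSummable hμ] with x hx
    set b : Fin n → ℝ := fun i => ∑' l, x l * h i l with hb
    have hsum : ∀ i, Summable fun l => x l * h i l := fun i => summable_mul_of_sq hx (hhs i)
    have e1 : ∀ e : Fin n → ℝ, ∑' l, x l * ∑ i, X i l * (R *ᵥ e) i = b ⬝ᵥ e := by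
      intro e
      have : ∀ l, x l * ∑ i, X i l * (R *ᵥ e) i = ∑ i, x l * h i l * e i := by
        intro l
        have h1 : ∑ i, X i l * (R *ᵥ e) i = ∑ i, h i l * e i := by
          change (fun i => X i l) ⬝ᵥ R *ᵥ e = (R *ᵥ fun j => X j l) ⬝ᵥ e
          exact symm_dotProduct_mulVec hRt _ _
        rw [h1, Finset.mul_sum]
        exact Finset.sum_congr rfl fun i _ => by ring
      simp only [this]
      rw [Summable.tsum_finsetSum fun i _ => (hsum i).mul_right _]
      exact Finset.sum_congr rfl fun i _ => tsum_mul_right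
    simp only [e1]
    rw [lintegral_sq_noise hν, ENNReal.ofReal_mul (sq_nonneg _)]
    congr 1
    rw [dotProduct, ENNReal.ofReal_sum_of_nonneg fun i _ => mul_self_nonneg _]
    exact Finset.sum_congr rfl fun i _ => by rw [← sq]
  have hmeas : ∀ i, Measurable fun x : Idx p → ℝ => ENNReal.ofReal ((∑' l, x l * h i l) ^ 2) :=
    fun i => ((Measurable.tsum fun l =>
      (measurable_pi_apply l).mul_const (h i l)).pow_const 2).ennreal_ofReal
  refine (lintegral_congr_ae hinner).le.trans ?_
  rw [lintegral_const_mul' _ _ ENNReal.ofReal_ne_top, lintegral_finsetSum _ fun i _ => hmeas i]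
  refine mul_le_mul_right ?_ _
  refine (Finset.sum_le_sum fun i _ => lintegral_sq_tsum_le hμ (hhs i)).trans ?_
  rw [← Summable.tsum_finsetSum fun i _ => ENNReal.summable]
  refine ENNReal.tsum_le_tsum fun l => ?_
  rw [← ENNReal.ofReal_sum_of_nonneg fun i _ => mul_nonneg (hμ.pos l).le (sq_nonneg _),
    ← Finset.mul_sum]
  refine le_of_eq ?_
  congr 2
  exact Finset.sum_congr rfl fun i _ => sq _

lemma tsum_head {k : ℕ} (g : Idx p → ℝ≥0∞) :
    ∑' l : Idx p, (if (l : ℕ) < k then g l else 0) = ∑ a : Head p k, g a.1 := by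
  rw [← tsum_fintype (L := .unconditional _)]
  rw [show (∑' a : Head p k, g a.1) = ∑' a : {l : Idx p | (l : ℕ) < k}, g a from rfl,
    tsum_subtype {l : Idx p | (l : ℕ) < k} g]
  exact tsum_congr fun l => by simp [Set.indicator_apply]

lemma tsum_eq_head_add_tail {k : ℕ} (g : Idx p → ℝ≥0∞) :
    ∑' l, g l = ∑ a : Head p k, g a.1 + ∑' l : Idx p, if k ≤ (l : ℕ) then g l else 0 := by
  rw [← tsum_head, ← ENNReal.tsum_add]
  refine tsum_congr fun l => ?_
  by_cases h : (l : ℕ) < k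
  · simp [h, not_le.2 h]
  · simp [h, not_lt.1 h]

/-- The sample matrix of the whitened head coordinates. -/
noncomputable def headMatrix (lam : Idx p → ℝ) (k : ℕ) (X : Fin n → Idx p → ℝ) :
    Matrix (Fin n) (Head p k) ℝ :=
  Matrix.of fun i a => headFeature lam k a (X i)

/-- The regularized Gram matrix is the tail part plus the head part. -/
lemma kernelRidge_zero_eq_head_add_tail (hμ : IsFeatureLaw lam μ) (k : ℕ) (s : ℝ)
    {X : Fin n → Idx p → ℝ} (hX : ∀ i, Summable fun l => X i l ^ 2) :
    kernelRidge (tailKernel 0) s X = kernelRidge (tailKernel k) s X +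
      headMatrix lam k X * diagonal (fun a : Head p k => lam a.1) * (headMatrix lam k X)ᵀ := by
  have key : ∀ i j, tailKernel 0 (X i) (X j) = tailKernel k (X i) (X j) +
      ∑ a : Head p k, X i a.1 * X j a.1 := by
    intro i j
    have hs := summable_mul_of_sq (hX i) (hX j)
    have h1 : ∑ a : Head p k, X i a.1 * X j a.1 =
        ∑' l : Idx p, if (l : ℕ) < k then X i l * X j l else 0 := by
      rw [← tsum_fintype (L := .unconditional _)]
      rw [show (∑' a : Head p k, X i a.1 * X j a.1) =
        ∑' a : {l : Idx p | (l : ℕ) < k}, (fun l => X i l * X j l) a from rfl,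
        tsum_subtype {l : Idx p | (l : ℕ) < k} fun l => X i l * X j l]
      exact tsum_congr fun l => by simp [Set.indicator_apply]
    rw [h1]
    simp only [tailKernel, tame_eq (hX _)]
    rw [← (summable_ite _ hs).tsum_add (summable_ite _ hs)]
    refine tsum_congr fun l => ?_
    by_cases h : (l : ℕ) < k
    · simp [h, not_le.2 h]
    · simp [h, not_lt.1 h]
  ext i j
  simp only [kernelRidge, headMatrix, Matrix.add_apply, of_apply, key, add_assoc]
  congr 2
  rw [Matrix.mul_apply]
  refine Finset.sum_congr rfl fun a _ => ?_
  rw [mul_diagonal, transpose_apply, of_apply, of_apply, headFeature_eq, headFeature_eq]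
  have h2 := Real.mul_self_sqrt (hμ.pos a.1).le
  have h1 := (Real.sqrt_pos.2 (hμ.pos a.1)).ne'
  calc X i a.1 * X j a.1 = X i a.1 * X j a.1 *
        (((√(lam a.1))⁻¹ * √(lam a.1)) * ((√(lam a.1))⁻¹ * √(lam a.1))) := by
        rw [inv_mul_cancel₀ h1]; ring
    _ = (√(lam a.1))⁻¹ * X i a.1 * (√(lam a.1) * √(lam a.1)) * ((√(lam a.1))⁻¹ * X j a.1) := by
        ring
    _ = _ := by rw [h2]

/-- The resolvent applied to a column of the sample matrix is short, because the regularized Gram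
matrix dominates the rank-one contribution of that column. -/
lemma normSq_inv_column_le {s : ℝ} (hs : 0 < s) {X : Fin n → Idx p → ℝ}
    (hX : ∀ i, Summable fun l => X i l ^ 2) (l : Idx p) :
    ((kernelRidge (tailKernel 0) s X)⁻¹ *ᵥ fun i => X i l) ⬝ᵥ
      ((kernelRidge (tailKernel 0) s X)⁻¹ *ᵥ fun i => X i l) ≤ 1 / s := by
  refine normSq_inv_mulVec_le (kernelRidge_posDef (isPSDKernel_tailKernel 0) hs X) hs _
    fun x => ?_
  have h1 := sq_le_sum_tailKernel 0 X x (l := l) (Nat.zero_le _)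
  have h3 : (fun i => X i l) ⬝ᵥ x = ∑ i, x i * tame (X i) l := by
    simp only [dotProduct, tame_eq (hX _)]
    exact Finset.sum_congr rfl fun i _ => mul_comm _ _
  rw [kernelRidge_quadratic, h3]
  linarith

/-- The variance is at most the trace of the inverse of a lower bound `Q` of the head covariance,
plus the tail trace divided by the ridge. -/
theorem varianceTerm_le (hμ : IsFeatureLaw lam μ) (hν : IsNoiseLaw ν σ) {ρ : ℝ}
    (hρ : 0 < (n : ℝ) * ρ) {X : Fin n → Idx p → ℝ} (hX : ∀ i, Summable fun l => X i l ^ 2) (k : ℕ)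
    {Q : Matrix (Head p k) (Head p k) ℝ} (hQ : Q.PosDef)
    (hQW : ∀ c, c ⬝ᵥ Q *ᵥ c ≤
      c ⬝ᵥ headCov (tailKernel k) (n * ρ) (headFeature lam k) X *ᵥ c) :
    varianceTerm μ ν ρ X ≤
      ENNReal.ofReal (σ ^ 2 * (Q⁻¹.trace + tailSum lam k / (n * ρ))) := by
  refine (varianceTerm_le_tsum hμ hν hρ hX).trans ?_
  rw [ENNReal.ofReal_mul (sq_nonneg _)]
  refine mul_le_mul_right ?_ _
  have hA := kernelRidge_posDef (isPSDKernel_tailKernel (p := p) 0) hρ X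
  have hG := kernelRidge_posDef (isPSDKernel_tailKernel (p := p) k) hρ X
  set A := kernelRidge (tailKernel 0) (n * ρ) X with hAdef
  have hAeq := kernelRidge_zero_eq_head_add_tail hμ k (n * ρ) hX
  rw [← hAdef] at hAeq
  set Z := headMatrix lam k X with hZ
  rw [tsum_eq_head_add_tail (k := k), ENNReal.ofReal_add hQ.inv.posSemidef.trace_nonneg
    (div_nonneg (tailSum_nonneg hμ k) hρ.le)]
  refine add_le_add ?_ ?_
  · have htr : Q⁻¹.trace = ∑ a, Q⁻¹ a a := rfl
    rw [htr, ENNReal.ofReal_sum_of_nonneg fun a _ => hQ.inv.posSemidef.diag_nonneg]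
    refine Finset.sum_le_sum fun a _ => ENNReal.ofReal_le_ofReal ?_
    have hcov : headCov (tailKernel k) (n * ρ) (headFeature lam k) X =
        (n * ρ) • (Zᵀ * (kernelRidge (tailKernel k) (n * ρ) X)⁻¹ * Z) := by
      ext a b
      simp only [headCov, of_apply, Matrix.smul_apply, smul_eq_mul]
      rw [Matrix.mul_assoc]
      rfl
    have h := head_resolvent_le hG hρ
      (kernelRidge_lower (isPSDKernel_tailKernel (p := p) k) X) Z (lam := fun a => lam a.1)
      (fun a => hμ.pos a.1) hQ (fun c => by
        have := hQW c
        rwa [hcov, smul_mulVec, dotProduct_smul, smul_eq_mul] at this) a (by rw [← hAeq]; exact hA)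
    rw [← hAeq] at h
    refine le_trans (le_of_eq ?_) h
    have hcol : (fun i => X i a.1) = √(lam a.1) • fun i => Z i a := by
      ext i
      simp only [hZ, headMatrix, of_apply, Pi.smul_apply, smul_eq_mul, headFeature_eq]
      rw [← mul_assoc, mul_inv_cancel₀ (Real.sqrt_pos.2 (hμ.pos a.1)).ne', one_mul]
    rw [hcol, mulVec_smul, smul_dotProduct, dotProduct_smul, smul_eq_mul, smul_eq_mul,
      ← mul_assoc (√(lam a.1)), Real.mul_self_sqrt (hμ.pos a.1).le]
    ring
  · rw [ENNReal.ofReal_div_of_pos hρ, ofReal_tailSum hμ, ENNReal.div_eq_inv_mul,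
      ← ENNReal.tsum_mul_left]
    refine ENNReal.tsum_le_tsum fun l => ?_
    split_ifs
    · rw [← ENNReal.ofReal_inv_of_pos hρ, ← ENNReal.ofReal_mul (inv_pos.2 hρ).le]
      refine ENNReal.ofReal_le_ofReal ?_
      rw [mul_comm]
      refine mul_le_mul_of_nonneg_right ?_ (hμ.pos l).le
      exact (normSq_inv_column_le hρ hX l).trans (one_div _).le
    · exact zero_le

end Variance

/-! ### Fourth moments of sums of independent variables -/

section FourthMoment

variable {Ω ι : Type*} [MeasurableSpace Ω] {P : Measure Ω} [IsProbabilityMeasure P]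

lemma integrable_pow_of_memLp_four {f : Ω → ℝ} (hf : MemLp f 4 P) {m : ℕ} (hm : m ≤ 4) :
    Integrable (fun ω => f ω ^ m) P := by
  have h4 : Integrable (fun ω => ‖f ω‖ ^ 4) P := hf.integrable_norm_pow (by norm_num)
  refine ((integrable_const (1 : ℝ)).add h4).mono' (hf.aestronglyMeasurable.pow m)
    (Eventually.of_forall fun ω => ?_)
  rw [norm_pow]
  simp only [Pi.add_apply]
  rcases le_total ‖f ω‖ 1 with h | h
  · have := pow_le_one₀ (n := m) (norm_nonneg _) h
    have : 0 ≤ ‖f ω‖ ^ 4 := by positivity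
    linarith
  · have := pow_le_pow_right₀ h hm
    linarith

/-- A centered sum of independent variables with `E V ^ 4 ≤ B v ^ 2` has the same property up to a
constant factor. -/
lemma fourth_moment_sum_le {V : ι → Ω → ℝ} (hind : iIndepFun V P) (hm : ∀ i, Measurable (V i))
    (hL : ∀ i, MemLp (V i) 4 P) (h1 : ∀ i, ∫ ω, V i ω ∂P = 0) {v : ι → ℝ} {B : ℝ} (hB : 1 ≤ B)
    (h2 : ∀ i, ∫ ω, V i ω ^ 2 ∂P ≤ v i) (h4 : ∀ i, ∫ ω, V i ω ^ 4 ∂P ≤ B * v i ^ 2)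
    (t : Finset ι) :
    MemLp (fun ω => ∑ i ∈ t, V i ω) 4 P ∧ ∫ ω, ∑ i ∈ t, V i ω ∂P = 0 ∧
      ∫ ω, (∑ i ∈ t, V i ω) ^ 2 ∂P ≤ ∑ i ∈ t, v i ∧
      ∫ ω, (∑ i ∈ t, V i ω) ^ 4 ∂P ≤ 3 * B * (∑ i ∈ t, v i) ^ 2 := by
  classical
  have hv : ∀ i, 0 ≤ v i := fun i => (integral_nonneg fun ω => sq_nonneg _).trans (h2 i)
  induction t using Finset.induction_on with
  | empty => simp
  | insert j t hj ih =>
    obtain ⟨iL, i1, i2, i4⟩ := ih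
    simp only [Finset.sum_insert hj]
    set S : Ω → ℝ := fun ω => ∑ i ∈ t, V i ω with hS
    have hSV : IndepFun S (V j) P := by
      have := hind.indepFun_finsetSum_of_notMem hm hj
      have e : (∑ i ∈ t, V i) = S := by ext ω; simp [hS]
      rwa [e] at this
    have hA : 0 ≤ ∑ i ∈ t, v i := Finset.sum_nonneg fun i _ => hv i
    set A := ∑ i ∈ t, v i with hAdef
    have hpow : ∀ a b : ℕ, IndepFun (fun ω => S ω ^ a) (fun ω => V j ω ^ b) P := fun a b =>
      hSV.comp (measurable_id.pow_const a) (measurable_id.pow_const b)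
    have hSi : ∀ {a : ℕ}, a ≤ 4 → Integrable (fun ω => S ω ^ a) P := fun h =>
      integrable_pow_of_memLp_four iL h
    have hVi : ∀ {a : ℕ}, a ≤ 4 → Integrable (fun ω => V j ω ^ a) P := fun h =>
      integrable_pow_of_memLp_four (hL j) h
    have hprod : ∀ {a b : ℕ}, a ≤ 4 → b ≤ 4 → Integrable (fun ω => S ω ^ a * V j ω ^ b) P :=
      fun ha hb => (hpow _ _).integrable_mul (hSi ha) (hVi hb)
    have hval : ∀ {a b : ℕ}, a ≤ 4 → b ≤ 4 → ∫ ω, S ω ^ a * V j ω ^ b ∂P =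
        (∫ ω, S ω ^ a ∂P) * ∫ ω, V j ω ^ b ∂P := fun ha hb =>
      (hpow _ _).integral_fun_mul_eq_mul_integral (hSi ha).aestronglyMeasurable
        (hVi hb).aestronglyMeasurable
    have hS1 : ∫ ω, S ω ^ 1 ∂P = 0 := by simpa using i1
    have hV1 : ∫ ω, V j ω ^ 1 ∂P = 0 := by simpa using h1 j
    have hS2 : 0 ≤ ∫ ω, S ω ^ 2 ∂P := integral_nonneg fun ω => sq_nonneg _
    have hV2 : 0 ≤ ∫ ω, V j ω ^ 2 ∂P := integral_nonneg fun ω => sq_nonneg _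
    refine ⟨(hL j).add iL, ?_, ?_, ?_⟩
    · have hSi1 := hSi (a := 1) (by norm_num)
      have hVi1 := hVi (a := 1) (by norm_num)
      simp only [pow_one] at hSi1 hVi1
      rw [integral_add hVi1 hSi1, h1, i1, add_zero]
    · have e : ∀ ω, (V j ω + S ω) ^ 2 = V j ω ^ 2 + (2 * (S ω ^ 1 * V j ω ^ 1) + S ω ^ 2) := by
        intro ω; ring
      have hi1 : Integrable (fun ω => 2 * (S ω ^ 1 * V j ω ^ 1)) P :=
        (hprod (by norm_num) (by norm_num)).const_mul 2
      change ∫ ω, (V j ω + S ω) ^ 2 ∂P ≤ _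
      simp only [e]
      have hi2 : Integrable (fun ω => S ω ^ 2) P := hSi (by norm_num)
      have hi12 : Integrable (fun ω => 2 * (S ω ^ 1 * V j ω ^ 1) + S ω ^ 2) P := hi1.add hi2
      rw [integral_add (hVi (by norm_num)) hi12, integral_add hi1 hi2, integral_const_mul,
        hval (by norm_num) (by norm_num), hS1, zero_mul, mul_zero, zero_add]
      exact add_le_add (h2 j) i2
    · have e : ∀ ω, (V j ω + S ω) ^ 4 = V j ω ^ 4 + (4 * (S ω ^ 1 * V j ω ^ 3) +
          (6 * (S ω ^ 2 * V j ω ^ 2) + (4 * (S ω ^ 3 * V j ω ^ 1) + S ω ^ 4))) := by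
        intro ω; ring
      have hi1 : Integrable (fun ω => 4 * (S ω ^ 1 * V j ω ^ 3)) P :=
        (hprod (by norm_num) (by norm_num)).const_mul 4
      have hi2 : Integrable (fun ω => 6 * (S ω ^ 2 * V j ω ^ 2)) P :=
        (hprod (by norm_num) (by norm_num)).const_mul 6
      have hi3 : Integrable (fun ω => 4 * (S ω ^ 3 * V j ω ^ 1)) P :=
        (hprod (by norm_num) (by norm_num)).const_mul 4
      have hi4 : Integrable (fun ω => S ω ^ 4) P := hSi le_rfl
      have hi34 : Integrable (fun ω => 4 * (S ω ^ 3 * V j ω ^ 1) + S ω ^ 4) P := hi3.add hi4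
      have hi234 : Integrable (fun ω => 6 * (S ω ^ 2 * V j ω ^ 2) +
        (4 * (S ω ^ 3 * V j ω ^ 1) + S ω ^ 4)) P := hi2.add hi34
      have hi1234 : Integrable (fun ω => 4 * (S ω ^ 1 * V j ω ^ 3) + (6 * (S ω ^ 2 * V j ω ^ 2) +
        (4 * (S ω ^ 3 * V j ω ^ 1) + S ω ^ 4))) P := hi1.add hi234
      change ∫ ω, (V j ω + S ω) ^ 4 ∂P ≤ _
      simp only [e]
      rw [integral_add (hVi le_rfl) hi1234, integral_add hi1 hi234,
        integral_add hi2 hi34, integral_add hi3 hi4, integral_const_mul, integral_const_mul,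
        integral_const_mul, hval (by norm_num) (by norm_num), hval (by norm_num) (by norm_num),
        hval (by norm_num) (by norm_num), hS1, hV1]
      have hx : (∫ ω, S ω ^ 2 ∂P) * ∫ ω, V j ω ^ 2 ∂P ≤ A * v j := mul_le_mul i2 (h2 j) hV2 hA
      have hAv : 0 ≤ A * v j := mul_nonneg hA (hv j)
      have hb : A * v j ≤ B * (A * v j) := le_mul_of_one_le_left hAv hB
      have hB2 : 0 ≤ B * v j ^ 2 := by positivity
      have := h4 j
      nlinarith

/-- The same for orthonormal variables which need not be centered: the mean of the sum is
controlled by its second moment. -/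
lemma fourth_moment_linear_le [Fintype ι] [DecidableEq ι] {Y : ι → Ω → ℝ} (hind : iIndepFun Y P)
    (hm : ∀ i, Measurable (Y i)) (hL : ∀ i, MemLp (Y i) 4 P)
    (h2 : ∀ i j, ∫ ω, Y i ω * Y j ω ∂P = if i = j then 1 else 0) {D : ℝ}
    (hD : 1 ≤ D) (h4 : ∀ i, ∫ ω, Y i ω ^ 4 ∂P ≤ D) (w : ι → ℝ) :
    Integrable (fun ω => (∑ i, w i * Y i ω) ^ 2) P ∧
      Integrable (fun ω => (∑ i, w i * Y i ω) ^ 4) P ∧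
      ∫ ω, (∑ i, w i * Y i ω) ^ 2 ∂P = ∑ i, w i ^ 2 ∧
      ∫ ω, (∑ i, w i * Y i ω) ^ 4 ∂P ≤ 392 * D * (∑ i, w i ^ 2) ^ 2 := by
  set m : ι → ℝ := fun i => ∫ ω, Y i ω ∂P with hmdef
  have hYi : ∀ i, Integrable (Y i) P := fun i => by
    have := integrable_pow_of_memLp_four (hL i) (m := 1) (by norm_num)
    simpa using this
  have hY2i : ∀ i, Integrable (fun ω => Y i ω ^ 2) P := fun i =>
    integrable_pow_of_memLp_four (hL i) (by norm_num)
  have hY4i : ∀ i, Integrable (fun ω => Y i ω ^ 4) P := fun i =>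
    integrable_pow_of_memLp_four (hL i) le_rfl
  have hY2 : ∀ i, ∫ ω, Y i ω ^ 2 ∂P = 1 := fun i => by
    have := h2 i i
    simpa [sq] using this
  have hvar : ∀ {f : Ω → ℝ}, Integrable f P → Integrable (fun ω => f ω ^ 2) P →
      ∫ ω, (f ω - ∫ ω', f ω' ∂P) ^ 2 ∂P = ∫ ω, f ω ^ 2 ∂P - (∫ ω, f ω ∂P) ^ 2 := by
    intro f hf hf2
    set b := ∫ ω, f ω ∂P with hb
    have e : ∀ ω, (f ω - b) ^ 2 = f ω ^ 2 - (2 * b) * f ω + b ^ 2 := by intro ω; ring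
    simp only [e]
    have hd : Integrable (fun ω => f ω ^ 2 - (2 * b) * f ω) P := hf2.sub (hf.const_mul _)
    rw [integral_add hd (integrable_const _), integral_sub hf2 (hf.const_mul _),
      integral_const_mul, ← hb]
    simp
    ring
  have hm2 : ∀ i, m i ^ 2 ≤ 1 := by
    intro i
    have h := hvar (hYi i) (hY2i i)
    have h0 : 0 ≤ ∫ ω, (Y i ω - ∫ ω', Y i ω' ∂P) ^ 2 ∂P := integral_nonneg fun ω => sq_nonneg _
    rw [h, hY2] at h0
    linarith
  set V : ι → Ω → ℝ := fun i ω => w i * (Y i ω - m i) with hV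
  have hVind : iIndepFun V P :=
    hind.comp (fun i y => w i * (y - m i)) fun i => (measurable_id.sub_const _).const_mul _
  have hVm : ∀ i, Measurable (V i) := fun i => ((hm i).sub_const _).const_mul _
  have hVL : ∀ i, MemLp (V i) 4 P := fun i => ((hL i).sub (memLp_const _)).const_mul _
  have hV1 : ∀ i, ∫ ω, V i ω ∂P = 0 := by
    intro i
    simp only [hV]
    rw [integral_const_mul, integral_sub (hYi i) (integrable_const _)]
    simp [hmdef]
  have hV2 : ∀ i, ∫ ω, V i ω ^ 2 ∂P ≤ w i ^ 2 := by
    intro i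
    simp only [hV, mul_pow]
    rw [integral_const_mul, hvar (hYi i) (hY2i i), hY2]
    nlinarith [sq_nonneg (w i), sq_nonneg (∫ ω, Y i ω ∂P),
      mul_nonneg (sq_nonneg (w i)) (sq_nonneg (∫ ω, Y i ω ∂P))]
  have hV4 : ∀ i, ∫ ω, V i ω ^ 4 ∂P ≤ 16 * D * (w i ^ 2) ^ 2 := by
    intro i
    have hle : ∀ ω, (Y i ω - m i) ^ 4 ≤ 8 * Y i ω ^ 4 + 8 := by
      intro ω
      have h1 : (Y i ω - m i) ^ 2 ≤ 2 * Y i ω ^ 2 + 2 * m i ^ 2 := by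
        nlinarith [sq_nonneg (Y i ω + m i)]
      have h3 : (Y i ω - m i) ^ 2 ≤ 2 * Y i ω ^ 2 + 2 := by linarith [hm2 i]
      nlinarith [sq_nonneg (Y i ω - m i), sq_nonneg (Y i ω ^ 2 - 1)]
    have hi : Integrable (fun ω => (Y i ω - m i) ^ 4) P :=
      integrable_pow_of_memLp_four ((hL i).sub (memLp_const _)) le_rfl
    have h5 : ∫ ω, (Y i ω - m i) ^ 4 ∂P ≤ 16 * D := by
      refine (integral_mono hi (((hY4i i).const_mul 8).add (integrable_const 8)) hle).trans ?_
      have e : ∫ ω, (fun ω => 8 * Y i ω ^ 4) ω + (fun _ : Ω => (8 : ℝ)) ω ∂P =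
          8 * ∫ ω, Y i ω ^ 4 ∂P + 8 := by
        rw [integral_add ((hY4i i).const_mul 8) (integrable_const 8), integral_const_mul]
        simp
      refine (le_of_eq e).trans ?_
      linarith [h4 i]
    simp only [hV, mul_pow]
    rw [integral_const_mul]
    calc w i ^ 4 * ∫ ω, (Y i ω - m i) ^ 4 ∂P ≤ w i ^ 4 * (16 * D) :=
          mul_le_mul_of_nonneg_left h5 (by positivity)
      _ = _ := by ring
  obtain ⟨sL, s1, s2, s4⟩ := fourth_moment_sum_le hVind hVm hVL hV1 (B := 16 * D) (by linarith)
    hV2 hV4 Finset.univ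
  set S : Ω → ℝ := fun ω => ∑ i, V i ω with hS
  set M : ℝ := ∑ i, w i * m i with hM
  have hr : ∀ ω, ∑ i, w i * Y i ω = S ω + M := by
    intro ω
    rw [hS, hM, ← Finset.sum_add_distrib]
    exact Finset.sum_congr rfl fun i _ => by simp only [hV]; ring
  have hrL : MemLp (fun ω => S ω + M) 4 P := sL.add (memLp_const _)
  have hr2i : Integrable (fun ω => (S ω + M) ^ 2) P :=
    integrable_pow_of_memLp_four hrL (by norm_num)
  have hr4i : Integrable (fun ω => (S ω + M) ^ 4) P := integrable_pow_of_memLp_four hrL le_rfl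
  have hsecond : ∫ ω, (∑ i, w i * Y i ω) ^ 2 ∂P = ∑ i, w i ^ 2 := by
    have hi : ∀ i j, Integrable (fun ω => (w i * w j) * (Y i ω * Y j ω)) P := fun i j =>
      (MemLp.integrable_mul ((hL i).mono_exponent (p := 2) (by norm_num))
        ((hL j).mono_exponent (p := 2) (by norm_num))).const_mul _
    have e1 : ∀ ω, (∑ i, w i * Y i ω) ^ 2 = ∑ i, ∑ j, (w i * w j) * (Y i ω * Y j ω) := by
      intro ω
      rw [sq, Finset.sum_mul_sum]
      exact Finset.sum_congr rfl fun i _ => Finset.sum_congr rfl fun j _ => by ring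
    simp only [e1]
    rw [integral_finsetSum _ fun i _ => integrable_finsetSum _ fun j _ => hi i j]
    refine Finset.sum_congr rfl fun i _ => ?_
    rw [integral_finsetSum _ fun j _ => hi i j]
    simp only [integral_const_mul, h2]
    simp [sq]
  have hA : 0 ≤ ∑ i, w i ^ 2 := Finset.sum_nonneg fun i _ => sq_nonneg _
  set A := ∑ i, w i ^ 2 with hAdef
  have hMA : M ^ 2 ≤ A := by
    have hSi : Integrable (fun ω => S ω + M) P := by
      have := integrable_pow_of_memLp_four hrL (m := 1) (by norm_num)
      simpa using this
    have h := hvar hSi hr2i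
    have h0 : 0 ≤ ∫ ω, (S ω + M - ∫ ω', (S ω' + M) ∂P) ^ 2 ∂P :=
      integral_nonneg fun ω => sq_nonneg _
    have hSi' : Integrable S P := by
      have := integrable_pow_of_memLp_four sL (m := 1) (by norm_num)
      simpa using this
    have hmean : ∫ ω, (S ω + M) ∂P = M := by
      rw [integral_add hSi' (integrable_const _), s1]
      simp
    rw [h, hmean] at h0
    simp only [hr] at hsecond
    rw [hsecond] at h0
    linarith
  refine ⟨by simpa only [hr] using hr2i, by simpa only [hr] using hr4i, hsecond, ?_⟩
  simp only [hr]
  have hS4i : Integrable (fun ω => S ω ^ 4) P := integrable_pow_of_memLp_four sL le_rfl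
  have hle : ∀ ω, (S ω + M) ^ 4 ≤ 8 * S ω ^ 4 + 8 * M ^ 4 := by
    intro ω
    have h1 : (S ω + M) ^ 2 ≤ 2 * S ω ^ 2 + 2 * M ^ 2 := by nlinarith [sq_nonneg (S ω - M)]
    nlinarith [sq_nonneg (S ω + M), sq_nonneg (S ω ^ 2 - M ^ 2)]
  refine (integral_mono hr4i ((hS4i.const_mul 8).add (integrable_const _)) hle).trans ?_
  have e : ∫ ω, (fun ω => 8 * S ω ^ 4) ω + (fun _ : Ω => 8 * M ^ 4) ω ∂P =
      8 * ∫ ω, S ω ^ 4 ∂P + 8 * M ^ 4 := by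
    rw [integral_add (hS4i.const_mul 8) (integrable_const _), integral_const_mul]
    simp
  refine (le_of_eq e).trans ?_
  have hM4 : M ^ 4 ≤ A ^ 2 := by
    have : M ^ 4 = (M ^ 2) ^ 2 := by ring
    rw [this]
    exact pow_le_pow_left₀ (sq_nonneg _) hMA 2
  have hA2 : 0 ≤ A ^ 2 := sq_nonneg _
  nlinarith

end FourthMoment

/-! ### Sub-Gaussian variables -/

section SubGaussian

variable {Ω : Type*} [MeasurableSpace Ω] {P : Measure Ω}

lemma lintegral_exp_sq_le_two {Y : Ω → ℝ} {G : ℝ} (hG : 0 < G)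
    (h : psi2Norm Y P ≤ ENNReal.ofReal G) :
    ∫⁻ ω, ENNReal.ofReal (Real.exp (Y ω ^ 2 / (2 * G) ^ 2)) ∂P ≤ 2 := by
  have hlt : psi2Norm Y P < ENNReal.ofReal (2 * G) :=
    h.trans_lt ((ENNReal.ofReal_lt_ofReal_iff (by linarith)).2 (by linarith))
  obtain ⟨s, ⟨t, ht, rfl, hexp⟩, hst⟩ := sInf_lt_iff.1 hlt
  have htG : t < 2 * G := (ENNReal.ofReal_lt_ofReal_iff (by linarith)).1 hst
  refine (lintegral_mono fun ω => ENNReal.ofReal_le_ofReal (Real.exp_le_exp.2 ?_)).trans hexp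
  exact div_le_div_of_nonneg_left (sq_nonneg _) (by positivity)
    (pow_le_pow_left₀ ht.le htG.le 2)

lemma memLp_four_of_exp_sq {Y : Ω → ℝ} (hY : Measurable Y) {t : ℝ} (ht : 0 < t)
    (h : ∫⁻ ω, ENNReal.ofReal (Real.exp (Y ω ^ 2 / t ^ 2)) ∂P ≤ 2) :
    MemLp Y 4 P ∧ ∫ ω, Y ω ^ 4 ∂P ≤ 4 * t ^ 4 := by
  have hexpm : Measurable fun ω => Real.exp (Y ω ^ 2 / t ^ 2) := ((hY.pow_const 2).div_const _).exp
  have hexpi : Integrable (fun ω => Real.exp (Y ω ^ 2 / t ^ 2)) P := by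
    refine ⟨hexpm.aestronglyMeasurable, ?_⟩
    rw [hasFiniteIntegral_iff_ofReal (Eventually.of_forall fun ω => (Real.exp_pos _).le)]
    exact h.trans_lt (by norm_num)
  have hexp2 : ∫ ω, Real.exp (Y ω ^ 2 / t ^ 2) ∂P ≤ 2 := by
    rw [integral_eq_lintegral_of_nonneg_ae (Eventually.of_forall fun ω => (Real.exp_pos _).le)
      hexpm.aestronglyMeasurable]
    exact ENNReal.toReal_le_of_le_ofReal (by norm_num) (by simpa using h)
  have hpt : ∀ ω, Y ω ^ 4 ≤ 2 * t ^ 4 * Real.exp (Y ω ^ 2 / t ^ 2) := by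
    intro ω
    have h1 := Real.quadratic_le_exp_of_nonneg (x := Y ω ^ 2 / t ^ 2) (by positivity)
    have h2 : Y ω ^ 4 = t ^ 4 * (Y ω ^ 2 / t ^ 2) ^ 2 := by field_simp
    rw [h2]
    have h3 : 0 ≤ Y ω ^ 2 / t ^ 2 := by positivity
    have ht4 : 0 < t ^ 4 := by positivity
    nlinarith
  have hi4 : Integrable (fun ω => Y ω ^ 4) P := by
    refine (hexpi.const_mul (2 * t ^ 4)).mono' (hY.pow_const 4).aestronglyMeasurable
      (Eventually.of_forall fun ω => ?_)
    rw [Real.norm_eq_abs, abs_of_nonneg (by positivity)]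
    exact hpt ω
  refine ⟨?_, ?_⟩
  · rw [← integrable_norm_rpow_iff hY.aestronglyMeasurable (by norm_num) (by norm_num)]
    refine hi4.congr (Eventually.of_forall fun ω => ?_)
    have : (4 : ℝ≥0∞).toReal = ((4 : ℕ) : ℝ) := by norm_num
    simp only [this, Real.rpow_natCast]
    rw [Real.norm_eq_abs, Even.pow_abs (by decide)]
  · refine (integral_mono hi4 (hexpi.const_mul _) hpt).trans ?_
    rw [integral_const_mul]
    have ht4 : 0 < t ^ 4 := by positivity
    nlinarith

end SubGaussian

/-! ### Polynomial decay and generic features -/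

section Features

variable {p : ℕ∞} {lam : Idx p → ℝ} {μ : Measure (Idx p → ℝ)}

/-- Comparison of `(m + 1) ^ (-1 - a)` with the integral of `t ^ (-1 - a)` over `[m, m + 1]`. -/
lemma rpow_le_sub_rpow {a : ℝ} (ha : 0 < a) {m : ℕ} (hm : 1 ≤ m) :
    (m + 1 : ℝ) ^ (-1 - a) ≤ (1 / a) * ((m : ℝ) ^ (-a) - ((m + 1 : ℕ) : ℝ) ^ (-a)) := by
  have hm0 : (0 : ℝ) < m := by exact_mod_cast hm
  have ht : (0 : ℝ) < m + 1 := by linarith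
  push_cast
  have h1 : (m : ℝ) ^ (-a) = (m + 1 : ℝ) ^ (-a) * Real.exp (a * Real.log ((m + 1) / m)) := by
    rw [Real.rpow_def_of_pos hm0, Real.rpow_def_of_pos ht, ← Real.exp_add,
      Real.log_div ht.ne' hm0.ne']
    ring_nf
  have h2 : (m + 1 : ℝ) ^ (-1 - a) = (m + 1 : ℝ) ^ (-a) * (1 / (m + 1)) := by
    rw [show -1 - a = -a - 1 by ring, Real.rpow_sub_one ht.ne']
    ring
  have h3 : 1 / (m + 1 : ℝ) ≤ Real.log ((m + 1) / m) := by
    have := Real.one_sub_inv_le_log_of_pos (x := (m + 1 : ℝ) / m) (by positivity)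
    refine le_trans (le_of_eq ?_) this
    field_simp
    ring
  have h4 : a * (1 / (m + 1)) ≤ Real.exp (a * Real.log ((m + 1) / m)) - 1 := by
    have := Real.add_one_le_exp (a * Real.log ((m + 1 : ℝ) / m))
    have := mul_le_mul_of_nonneg_left h3 ha.le
    linarith
  have h5 : 0 ≤ (m + 1 : ℝ) ^ (-a) := by positivity
  rw [h1, h2]
  calc (m + 1 : ℝ) ^ (-a) * (1 / (m + 1)) =
        (1 / a) * ((m + 1 : ℝ) ^ (-a) * (a * (1 / (m + 1)))) := by field_simp
    _ ≤ (1 / a) * ((m + 1 : ℝ) ^ (-a) * (Real.exp (a * Real.log ((m + 1) / m)) - 1)) := by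
        gcongr
    _ = _ := by ring

lemma tailSum_le {a c C : ℝ} (ha : 0 < a) (hC : 0 ≤ C) (h : PolyDecay a c C lam) {k : ℕ}
    (hk : 1 ≤ k) : tailSum lam k ≤ C / a * (k : ℝ) ^ (-a) := by
  classical
  set φ : ℕ → ℝ := fun m => C / a * (m : ℝ) ^ (-a) with hφ
  have hφ0 : ∀ m, 0 ≤ φ m := fun m => by positivity
  set g : ℕ → ℝ := fun m => if k ≤ m then φ m - φ (m + 1) else 0 with hg
  have hle : ∀ m : ℕ, k ≤ m → C * (m + 1 : ℝ) ^ (-1 - a) ≤ φ m - φ (m + 1) := by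
    intro m hm
    have := mul_le_mul_of_nonneg_left (rpow_le_sub_rpow ha (hk.trans hm)) hC
    refine this.trans (le_of_eq ?_)
    simp only [hφ]
    ring
  have hg0 : ∀ m, 0 ≤ g m := by
    intro m
    simp only [hg]
    split_ifs with hm
    · exact (mul_nonneg hC (by positivity)).trans (hle m hm)
    · exact le_rfl
  refine tsum_le_of_sum_le' (hφ0 k) fun t => ?_
  have h1 : ∑ l ∈ t, (if k ≤ (l : ℕ) then lam l else 0) ≤ ∑ l ∈ t, g (l : ℕ) := by
    refine Finset.sum_le_sum fun l _ => ?_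
    simp only [hg]
    split_ifs with hl
    · exact (h l).2.trans (hle _ hl)
    · exact le_rfl
  refine h1.trans ?_
  obtain ⟨N, hN⟩ := (t.image fun l : Idx p => (l : ℕ)).exists_nat_subset_range
  have h2 : ∑ l ∈ t, g (l : ℕ) ≤ ∑ m ∈ Finset.range (N + k), g m := by
    rw [← Finset.sum_image (f := g) (g := fun l : Idx p => (l : ℕ))
      (fun x _ y _ hxy => Subtype.ext hxy)]
    refine Finset.sum_le_sum_of_subset_of_nonneg (hN.trans ?_) fun m _ _ => hg0 m
    exact Finset.range_mono (Nat.le_add_right _ _)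
  refine h2.trans ?_
  have h3 : ∑ m ∈ Finset.range (N + k), g m = ∑ m ∈ Finset.Ico k (N + k), (φ m - φ (m + 1)) := by
    simp only [hg]
    rw [← Finset.sum_filter]
    refine Finset.sum_congr ?_ fun _ _ => rfl
    ext m
    simp [and_comm]
  rw [h3, Finset.sum_Ico_eq_sum_range, Nat.add_sub_cancel]
  have h4 := Finset.sum_range_sub' (fun i => φ (k + i)) N
  simp only [← add_assoc] at h4
  rw [h4]
  have := hφ0 (k + N)
  simp only [add_zero]
  linarith

lemma ae_le_of_betaCoef {j : ℕ} {C : ℝ} (hC : 0 < C)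
    (h : betaCoef lam μ j ≤ ENNReal.ofReal C) :
    ∀ᵐ x ∂μ, headNormSq j (whiten lam x) ≤ ENNReal.ofReal C * j ∧
      tailNormSq lam 1 j (whiten lam x) ≤ ENNReal.ofReal C * tailTrace lam 1 j := by
  have hC0 : ENNReal.ofReal C ≠ 0 := by simpa using hC
  filter_upwards [ENNReal.ae_le_essSup (μ := μ) fun x =>
    max (headNormSq j (whiten lam x) / (j : ℝ≥0∞))
      (max (tailNormSq lam 1 j (whiten lam x) / tailTrace lam 1 j)
        (tailNormSq lam 2 j (whiten lam x) / tailTrace lam 2 j))] with x hx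
  have hx' := hx.trans h
  have h1 := (le_max_left _ _).trans hx'
  have h2 := ((le_max_left _ _).trans (le_max_right _ _)).trans hx'
  exact ⟨(ENNReal.div_le_iff_le_mul (Or.inr ENNReal.ofReal_ne_top) (Or.inr hC0)).1 h1,
    (ENNReal.div_le_iff_le_mul (Or.inr ENNReal.ofReal_ne_top) (Or.inr hC0)).1 h2⟩

lemma headNormSq_whiten (k : ℕ) (x : Idx p → ℝ) :
    headNormSq k (whiten lam x) =
      ENNReal.ofReal (∑ a : Head p k, headFeature lam k a x ^ 2) := by
  rw [headNormSq, tsum_head (k := k) fun l => ENNReal.ofReal (whiten lam x l ^ 2),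
    ENNReal.ofReal_sum_of_nonneg fun a _ => sq_nonneg _]
  rfl

lemma lam_mul_whiten_sq (hμ : IsFeatureLaw lam μ) (x : Idx p → ℝ) (l : Idx p) :
    lam l ^ 1 * whiten lam x l ^ 2 = x l ^ 2 := by
  rw [whiten, div_pow, Real.sq_sqrt (hμ.pos l).le, pow_one, mul_div_cancel₀ _ (hμ.pos l).ne']

lemma tailTrace_one (hμ : IsFeatureLaw lam μ) (k : ℕ) :
    tailTrace lam 1 k = ENNReal.ofReal (tailSum lam k) := by
  simp only [tailTrace, ofReal_tailSum hμ, pow_one]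

/-- Almost sure size of the head and of the tail of a generic feature vector. Truncation levels
`k ≥ p`, about which the hypothesis says nothing, are covered by the level `p - 1`. -/
lemma GenericFeatures.ae_bound (hμ : IsFeatureLaw lam μ) {c C : ℝ} (hC : 0 < C)
    (h : GenericFeatures c C lam μ) (k : ℕ) :
    ∀ᵐ x ∂μ, ∑ a : Head p k, headFeature lam k a x ^ 2 ≤ C * k ∧
      tailKernel k x x ≤ C * tailSum lam k := by
  have hmul : ∀ r : ℝ, ENNReal.ofReal C * ENNReal.ofReal r = ENNReal.ofReal (C * r) := fun r =>
    (ENNReal.ofReal_mul hC.le).symm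
  by_cases hkp : (k : ℕ∞) < p
  · filter_upwards [ae_le_of_betaCoef hC (h k hkp).2.2, ae_sqSummable hμ] with x hx hxs
    obtain ⟨h1, h2⟩ := hx
    refine ⟨?_, ?_⟩
    · rw [headNormSq_whiten, ← ENNReal.ofReal_natCast, hmul] at h1
      exact (ENNReal.ofReal_le_ofReal_iff (by positivity)).1 h1
    · rw [tailTrace_one hμ, hmul, tailNormSq] at h2
      simp only [lam_mul_whiten_sq hμ] at h2
      rw [← ofReal_tailKernel_self k hxs] at h2
      exact (ENNReal.ofReal_le_ofReal_iff (mul_nonneg hC.le (tailSum_nonneg hμ k))).1 h2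
  · have hlt : ∀ l : Idx p, (l : ℕ) < k := fun l => by
      have := l.2.trans_le (not_lt.1 hkp)
      exact_mod_cast this
    have hker : ∀ x : Idx p → ℝ, tailKernel k x x = 0 := fun x => by
      simp [tailKernel, not_le.2 (hlt _)]
    have htail : tailSum lam k = 0 := by simp [tailSum, not_le.2 (hlt _)]
    simp only [hker, htail, mul_zero, le_refl, and_true]
    rcases isEmpty_or_nonempty (Idx p) with hE | hE
    · refine Eventually.of_forall fun x => ?_
      rw [Fintype.sum_empty]
      positivity
    have hpt : p ≠ ⊤ := fun hp => hkp (hp ▸ ENat.natCast_lt_top k)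
    obtain ⟨q, rfl⟩ := ENat.ne_top_iff_exists.1 hpt
    have hq : 0 < q := by
      obtain ⟨l⟩ := hE
      have := l.2
      exact lt_of_le_of_lt (Nat.zero_le _) (by exact_mod_cast this)
    have hqk : q ≤ k := by exact_mod_cast not_lt.1 hkp
    set last : Idx (q : ℕ∞) := ⟨q - 1, by exact_mod_cast Nat.sub_lt hq one_pos⟩ with hlast
    have hle : ∀ l : Idx (q : ℕ∞), q - 1 ≤ (l : ℕ) ↔ l = last := by
      intro l
      have : (l : ℕ) < q := by exact_mod_cast l.2
      rw [Subtype.ext_iff, hlast]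
      simp only
      omega
    have hltl : ∀ l : Idx (q : ℕ∞), (l : ℕ) < q - 1 ↔ l ≠ last := fun l => by
      rw [Ne, ← hle, not_le]
    filter_upwards [ae_le_of_betaCoef hC (h (q - 1) last.2).2.2] with x hx
    obtain ⟨h1, h2⟩ := hx
    simp only [tailNormSq, tailTrace, hle, tsum_ite_eq, pow_one] at h2
    rw [hmul] at h2
    have h3 := (ENNReal.ofReal_le_ofReal_iff (mul_nonneg hC.le (hμ.pos _).le)).1 h2
    have h4 : whiten lam x last ^ 2 ≤ C := by
      rw [mul_comm] at h3
      exact le_of_mul_le_mul_right h3 (hμ.pos _)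
    rw [← ENNReal.ofReal_le_ofReal_iff (by positivity), ← headNormSq_whiten]
    have h5 : headNormSq k (whiten lam x) =
        headNormSq (q - 1) (whiten lam x) + ENNReal.ofReal (whiten lam x last ^ 2) := by
      have e : ENNReal.ofReal (whiten lam x last ^ 2) = ∑' l : Idx (q : ℕ∞),
          if l = last then ENNReal.ofReal (whiten lam x l ^ 2) else 0 := by rw [tsum_ite_eq]
      rw [e]
      unfold headNormSq
      rw [← ENNReal.tsum_add]
      refine tsum_congr fun l => ?_
      by_cases hl : l = last
      · simp [hlt, hltl, hl]
      · simp [hlt, hltl, hl]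
    rw [h5]
    refine (add_le_add h1 (ENNReal.ofReal_le_ofReal h4)).trans ?_
    rw [← ENNReal.ofReal_natCast, hmul, ← ENNReal.ofReal_add (by positivity) hC.le]
    refine ENNReal.ofReal_le_ofReal ?_
    have h6 : ((q - 1 : ℕ) : ℝ) + 1 ≤ k := by
      have : q - 1 + 1 ≤ k := by omega
      exact_mod_cast this
    calc C * ((q - 1 : ℕ) : ℝ) + C = C * (((q - 1 : ℕ) : ℝ) + 1) := by ring
      _ ≤ C * k := by gcongr

end Features

/-! ### Independent features -/

section Independent

variable {p : ℕ∞} {lam : Idx p → ℝ} {μ : Measure (Idx p → ℝ)}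

lemma measurable_whiten (l : Idx p) : Measurable fun x : Idx p → ℝ => whiten lam x l :=
  (measurable_pi_apply l).div_const _

lemma integral_whiten_mul (hμ : IsFeatureLaw lam μ) (i j : Idx p) :
    ∫ x, whiten lam x i * whiten lam x j ∂μ = if i = j then 1 else 0 := by
  have e : ∀ x : Idx p → ℝ, whiten lam x i * whiten lam x j =
      (√(lam i) * √(lam j))⁻¹ * (x i * x j) := by
    intro x
    simp only [whiten]
    rw [div_mul_div_comm, div_eq_inv_mul]
  simp only [e]
  rw [integral_const_mul, hμ.cov]
  by_cases h : i = j
  · subst h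
    rw [if_pos rfl, if_pos rfl, Real.mul_self_sqrt (hμ.pos i).le, inv_mul_cancel₀ (hμ.pos i).ne']
  · rw [if_neg h, if_neg h, mul_zero]

/-- The average of the squared head coordinates has a bounded exponential moment. -/
lemma lintegral_exp_head_le_two {G : ℝ} (hG : 0 < G) (h : IndependentFeatures G lam μ) (k : ℕ)
    [IsProbabilityMeasure μ] [Nonempty (Head p k)] :
    ∫⁻ x, ENNReal.ofReal (Real.exp (∑ a : Head p k, (Fintype.card (Head p k) : ℝ)⁻¹ *
      (headFeature lam k a x ^ 2 / (2 * G) ^ 2))) ∂μ ≤ 2 := by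
  have hc : (0 : ℝ) < Fintype.card (Head p k) := by exact_mod_cast Fintype.card_pos
  set m : ℝ := (Fintype.card (Head p k) : ℝ)⁻¹ with hm
  have hm0 : 0 < m := inv_pos.2 hc
  have hsum : ∑ _a : Head p k, m = 1 := by
    rw [Finset.sum_const, Finset.card_univ, nsmul_eq_mul, hm, mul_inv_cancel₀ hc.ne']
  have hmeas : ∀ a : Head p k, Measurable fun x : Idx p → ℝ =>
      ENNReal.ofReal (Real.exp (headFeature lam k a x ^ 2 / (2 * G) ^ 2)) := fun a =>
    ((((measurable_whiten a.1).pow_const 2).div_const _).exp).ennreal_ofReal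
  have hpt : ∀ x : Idx p → ℝ, ENNReal.ofReal (Real.exp (∑ a : Head p k, m *
      (headFeature lam k a x ^ 2 / (2 * G) ^ 2))) ≤ ∑ a : Head p k, ENNReal.ofReal m *
        ENNReal.ofReal (Real.exp (headFeature lam k a x ^ 2 / (2 * G) ^ 2)) := by
    intro x
    have := convexOn_exp.map_sum_le (t := Finset.univ) (w := fun _ : Head p k => m)
      (p := fun a => headFeature lam k a x ^ 2 / (2 * G) ^ 2) (fun _ _ => hm0.le) hsum
      fun _ _ => Set.mem_univ _
    simp only [smul_eq_mul] at this
    refine (ENNReal.ofReal_le_ofReal this).trans (le_of_eq ?_)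
    rw [ENNReal.ofReal_sum_of_nonneg fun a _ => by positivity]
    exact Finset.sum_congr rfl fun a _ => ENNReal.ofReal_mul hm0.le
  refine (lintegral_mono hpt).trans ?_
  rw [lintegral_finsetSum _ fun a _ => (hmeas a).const_mul _]
  have h2 : ∀ a : Head p k, ∫⁻ x, ENNReal.ofReal m *
      ENNReal.ofReal (Real.exp (headFeature lam k a x ^ 2 / (2 * G) ^ 2)) ∂μ ≤
        ENNReal.ofReal m * 2 := fun a => by
    rw [lintegral_const_mul _ (hmeas a)]
    exact mul_le_mul_right (lintegral_exp_sq_le_two hG (h.2 a.1)) _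
  refine (Finset.sum_le_sum fun a _ => h2 a).trans (le_of_eq ?_)
  rw [← Finset.sum_mul, ← ENNReal.ofReal_sum_of_nonneg fun _ _ => hm0.le, hsum]
  simp

variable [Fintype (Idx p)]

/-- With finitely many coordinates, the residual of a head feature is a linear form in the whitened
vector, whose head coefficients are unchanged. -/
lemma exists_residual_eq_linear (hμ : IsFeatureLaw lam μ) (k : ℕ) (s : ℝ) {n : ℕ}
    (X : Fin n → Idx p → ℝ) (u : Head p k → ℝ) :
    ∃ w : Idx p → ℝ, u ⬝ᵥ u ≤ ∑ l, w l ^ 2 ∧ ∀ x : Idx p → ℝ,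
      kernelResidual (tailKernel k) s (fun x => ∑ a, u a * headFeature lam k a x) X x =
        ∑ l, w l * whiten lam x l := by
  classical
  set y := (kernelRidge (tailKernel k) s X)⁻¹ *ᵥ fun i => ∑ a, u a * headFeature lam k a (X i)
  have hsplit : ∀ g : Idx p → ℝ, ∑ l, g l =
      ∑ a : Head p k, g a.1 + ∑ l : {l : Idx p // ¬ (l : ℕ) < k}, g l.1 := by
    intro g
    rw [← Fintype.sum_subtype_add_sum_subtype (fun l : Idx p => (l : ℕ) < k) g]
    congr 1
    exact Finset.sum_congr (by ext; simp) fun _ _ => rfl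
  set w : Idx p → ℝ := fun l => if h : (l : ℕ) < k then u ⟨l, h⟩ else
    -(√(lam l) * ∑ i, y i * X i l) with hw
  have hwh : ∀ a : Head p k, w a.1 = u a := fun a => by simp [hw, a.2]
  have hwt : ∀ l : {l : Idx p // ¬ (l : ℕ) < k}, w l.1 = -(√(lam l.1) * ∑ i, y i * X i l.1) :=
    fun l => by simp [hw, l.2]
  refine ⟨w, ?_, fun x => ?_⟩
  · rw [hsplit]
    simp only [hwh]
    have : 0 ≤ ∑ l : {l : Idx p // ¬ (l : ℕ) < k}, w l.1 ^ 2 :=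
      Finset.sum_nonneg fun _ _ => sq_nonneg _
    simp only [dotProduct, ← sq]
    linarith
  · have hker : ∀ i, tailKernel k x (X i) =
        ∑ l : {l : Idx p // ¬ (l : ℕ) < k}, x l.1 * X i l.1 := by
      intro i
      rw [tailKernel, tsum_fintype, hsplit]
      simp only [tame_eq Summable.of_finite]
      rw [Finset.sum_eq_zero fun a _ => if_neg (not_le.2 a.2), zero_add]
      exact Finset.sum_congr rfl fun l _ => if_pos (not_lt.1 l.2)
    rw [kernelResidual, hsplit]
    simp only [hwh, hwt]
    change ∑ a, u a * headFeature lam k a x - (fun i => tailKernel k x (X i)) ⬝ᵥ y = _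
    rw [sub_eq_add_neg]
    congr 1
    simp only [dotProduct, hker, Finset.sum_mul]
    rw [Finset.sum_comm, ← Finset.sum_neg_distrib]
    refine Finset.sum_congr rfl fun l _ => ?_
    have h0 := (Real.sqrt_pos.2 (hμ.pos l.1)).ne'
    rw [whiten, Finset.mul_sum, neg_mul, Finset.sum_mul]
    congr 1
    refine Finset.sum_congr rfl fun i _ => ?_
    field_simp

/-- A bound for the ratio of the fourth moment to the squared second moment of a linear form in
independent features with sub-Gaussian norms at most `G`. -/
noncomputable def kurtosisBound (G : ℝ) : ℝ := 392 * max 1 (4 * (2 * G) ^ 4)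

lemma one_le_kurtosisBound (G : ℝ) : 1 ≤ kurtosisBound G := by
  have := le_max_left 1 (4 * (2 * G) ^ 4)
  unfold kurtosisBound
  linarith

/-- A fixed direction of the head covariance is large with overwhelming probability. -/
lemma measure_headCov_direction_le (hμ : IsFeatureLaw lam μ) {G : ℝ} (hG : 0 < G)
    (h : IndependentFeatures G lam μ) {k : ℕ} {s : ℝ} (hs : 0 < s)
    (htail : tailSum lam k / s ≤ 7 / (64 * kurtosisBound G)) {u : Head p k → ℝ}
    (hu : 1 / 4 ≤ u ⬝ᵥ u) (n : ℕ) :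
    (Measure.pi fun _ : Fin n => μ)
      {X | u ⬝ᵥ headCov (tailKernel k) s (headFeature lam k) X *ᵥ u ≤
        n / (32 * kurtosisBound G)} ≤
      ENNReal.ofReal (Real.exp (-(n / (32 * kurtosisBound G)))) := by
  have := hμ.prob
  simp only [dotProduct_headCov_mulVec]
  have h4 : ∀ l, MemLp (fun x : Idx p → ℝ => whiten lam x l) 4 μ ∧
      ∫ x, whiten lam x l ^ 4 ∂μ ≤ max 1 (4 * (2 * G) ^ 4) := by
    intro l
    have := memLp_four_of_exp_sq (measurable_whiten l) (by positivity : 0 < 2 * G)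
      (lintegral_exp_sq_le_two hG (h.2 l))
    exact ⟨this.1, this.2.trans (le_max_right _ _)⟩
  refine measure_resolventForm_le (isPSDKernel_tailKernel k) (measurable_tailKernel k) hs
    (f := fun x => ∑ a, u a * headFeature lam k a x) ?_ (one_le_kurtosisBound G)
    (integrable_tailKernel_self hμ k) (by rwa [integral_tailKernel_self hμ k]) ?_ n
  · exact Finset.measurable_sum _ fun a _ => (measurable_whiten a.1).const_mul _
  · intro j X
    obtain ⟨w, hw, hlin⟩ := exists_residual_eq_linear hμ k s X u
    obtain ⟨i2, i4, e2, e4⟩ := fourth_moment_linear_le (P := μ) h.1 measurable_whiten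
      (fun l => (h4 l).1) (integral_whiten_mul hμ) (le_max_left _ _) (fun l => (h4 l).2) w
    simp only [hlin]
    refine ⟨i2, i4, ?_, ?_⟩
    · rw [e2]
      exact hu.trans hw
    · rw [e2]
      exact e4

/-- The head covariance of independent features is at least a multiple of `n`, by a union bound over
a grid of directions. -/
theorem measure_headCov_lower_le (hμ : IsFeatureLaw lam μ) {G : ℝ} (hG : 0 < G)
    (h : IndependentFeatures G lam μ) {k : ℕ} {s : ℝ} (hs : 0 < s)
    (htail : tailSum lam k / s ≤ 7 / (64 * kurtosisBound G)) {M : ℕ} (hM : 0 < M)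
    (hM1 : 4 * (k : ℝ) ≤ (M : ℝ) ^ 2)
    (hM2 : 1024 * kurtosisBound G * G ^ 2 * (k : ℝ) ^ 2 ≤ (M : ℝ) ^ 2) (n : ℕ) :
    (Measure.pi fun _ : Fin n => μ)
      {X | ¬ ∀ v : Head p k → ℝ, n / (32 * kurtosisBound G) / 4 * (v ⬝ᵥ v) ≤
        v ⬝ᵥ headCov (tailKernel k) s (headFeature lam k) X *ᵥ v} ≤
      ENNReal.ofReal ((2 * M + 1 : ℝ) ^ k * Real.exp (-(n / (32 * kurtosisBound G))) +
        Real.exp (-n)) := by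
  classical
  have := hμ.prob
  rcases isEmpty_or_nonempty (Head p k) with hE | hE
  · have : {X : Fin n → Idx p → ℝ | ¬ ∀ v : Head p k → ℝ,
        n / (32 * kurtosisBound G) / 4 * (v ⬝ᵥ v) ≤
          v ⬝ᵥ headCov (tailKernel k) s (headFeature lam k) X *ᵥ v} = ∅ := by
      ext X
      simp [dotProduct]
    rw [this]
    simp
  set K := kurtosisBound G with hK
  have hK1 : 1 ≤ K := one_le_kurtosisBound G
  set hc : ℝ := (Fintype.card (Head p k) : ℝ) with hhc
  have hc0 : 0 < hc := Nat.cast_pos.2 Fintype.card_pos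
  have hck : hc ≤ k := Nat.cast_le.2 (card_head_le k)
  set S : Finset (Head p k → ℤ) :=
    (Fintype.piFinset fun _ : Head p k => Finset.Icc (-(M : ℤ)) M).filter
      fun m => 1 / 4 ≤ gridPoint M m ⬝ᵥ gridPoint M m with hS
  set w : (Idx p → ℝ) → ℝ := fun x => ∑ a : Head p k, hc⁻¹ *
      (headFeature lam k a x ^ 2 / (2 * G) ^ 2) with hw
  have hwm : Measurable w := Finset.measurable_sum _ fun a _ =>
    (((measurable_whiten a.1).pow_const 2).div_const _).const_mul _
  have hsub : {X : Fin n → Idx p → ℝ | ¬ ∀ v : Head p k → ℝ, n / (32 * K) / 4 * (v ⬝ᵥ v) ≤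
        v ⬝ᵥ headCov (tailKernel k) s (headFeature lam k) X *ᵥ v} ⊆
      (⋃ m ∈ S, {X | gridPoint M m ⬝ᵥ headCov (tailKernel k) s (headFeature lam k) X *ᵥ
        gridPoint M m ≤ n / (32 * K)}) ∪ {X | 2 * (n : ℝ) ≤ ∑ i, w (X i)} := by
    intro X hX
    by_contra hnot
    simp only [Set.mem_union, Set.mem_iUnion, Set.mem_ofPred_eq, not_or, not_exists, not_le] at hnot
    obtain ⟨hg, hsum⟩ := hnot
    refine hX (headCov_lower_of_grid (isPSDKernel_tailKernel k) hs X hM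
      (R := 8 * G ^ 2 * hc * n) ?_ (by linarith) ?_ fun m hm hm4 => ?_)
    · have e : ∑ i, ∑ a, headFeature lam k a (X i) ^ 2 =
          hc * (2 * G) ^ 2 * ∑ i, w (X i) := by
        simp only [hw, Finset.mul_sum]
        refine Finset.sum_congr rfl fun i _ => Finset.sum_congr rfl fun a _ => ?_
        field_simp
      rw [e]
      calc hc * (2 * G) ^ 2 * ∑ i, w (X i) ≤ hc * (2 * G) ^ 2 * (2 * n) := by gcongr
        _ = _ := by ring
    · have h1 : 1024 * K * G ^ 2 * hc ^ 2 ≤ (M : ℝ) ^ 2 :=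
        le_trans (by gcongr) hM2
      rw [div_mul_eq_mul_div, le_div_iff₀ (by positivity)]
      calc 4 * (8 * G ^ 2 * hc * n) * hc * (32 * K) = n * (1024 * K * G ^ 2 * hc ^ 2) := by ring
        _ ≤ n * (M : ℝ) ^ 2 := by gcongr
    · exact (hg m (Finset.mem_filter.2 ⟨hm, hm4⟩)).le
  refine (measure_mono hsub).trans ((measure_union_le _ _).trans ?_)
  rw [ENNReal.ofReal_add (by positivity) (Real.exp_pos _).le]
  refine add_le_add ?_ (measure_two_mul_le_sum hwm (lintegral_exp_head_le_two hG h k) n)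
  refine (measure_biUnion_finset_le _ _).trans ?_
  refine (Finset.sum_le_sum fun m hm => measure_headCov_direction_le hμ hG h hs htail
    (Finset.mem_filter.1 hm).2 n).trans ?_
  rw [Finset.sum_const, nsmul_eq_mul, ENNReal.ofReal_mul (by positivity)]
  refine mul_le_mul_left ?_ _
  rw [← ENNReal.ofReal_natCast]
  refine ENNReal.ofReal_le_ofReal ?_
  have hcard : S.card ≤ (2 * M + 1) ^ k := by
    refine (Finset.card_filter_le _ _).trans ?_
    rw [Fintype.card_piFinset]
    simp only [Int.card_Icc, Finset.prod_const, Finset.card_univ]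
    have : ((M : ℤ) + 1 - -(M : ℤ)).toNat = 2 * M + 1 := by omega
    rw [this]
    exact Nat.pow_le_pow_right (by omega) (card_head_le k)
  exact_mod_cast hcard

end Independent

/-! ### From a lower bound on the head covariance to the variance -/

/-- `S` dominates a positive definite matrix whose inverse has trace at most `τ`. -/
def HasInverseTraceBound {H : Type*} [Fintype H] [DecidableEq H] (S : Matrix H H ℝ) (τ : ℝ) :
    Prop :=
  ∃ Q : Matrix H H ℝ, Q.PosDef ∧ (∀ c, c ⬝ᵥ Q *ᵥ c ≤ c ⬝ᵥ S *ᵥ c) ∧ Q⁻¹.trace ≤ τ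

section Reduction

lemma inv_smul_posDef {H : Type*} [Fintype H] [DecidableEq H] {A : Matrix H H ℝ} (hA : A.PosDef)
    {r : ℝ} (hr : 0 < r) : (r • A)⁻¹ = r⁻¹ • A⁻¹ := by
  refine Matrix.inv_eq_right_inv ?_
  rw [smul_mul_smul_comm, mul_inv_cancel₀ hr.ne', one_smul,
    Matrix.mul_nonsing_inv _ ((Matrix.isUnit_iff_isUnit_det _).1 hA.isUnit)]

/-- The exceptional set of the variance bound is, up to samples which are not square summable,
contained in that of the head covariance. -/
lemma measure_varianceTerm_gt_le {p : ℕ∞} {lam : Idx p → ℝ} {μ : Measure (Idx p → ℝ)}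
    {ν : Measure ℝ} {σ : ℝ} (hμ : IsFeatureLaw lam μ) (hν : IsNoiseLaw ν σ) {n : ℕ} {ρ : ℝ}
    (hρ : 0 < (n : ℝ) * ρ) (k : ℕ) {τ T : ℝ} (hT : τ + tailSum lam k / (n * ρ) ≤ T) :
    sampleLaw μ n {X | ¬ varianceTerm μ ν ρ X ≤ ENNReal.ofReal (σ ^ 2 * T)} ≤
      (Measure.pi fun _ : Fin n => μ) {X | ¬ HasInverseTraceBound
        (headCov (tailKernel k) (n * ρ) (headFeature lam k) X) τ} := by
  have := hμ.prob
  have hrows : ∀ᵐ X ∂(Measure.pi fun _ : Fin n => μ), ∀ i, Summable fun l => X i l ^ 2 :=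
    ae_all_iff.2 fun i => (Measure.quasiMeasurePreserving_eval (fun _ : Fin n => μ) i).ae
      (ae_sqSummable hμ)
  refine measure_mono_ae ?_
  filter_upwards [hrows] with X hX hV hQ
  obtain ⟨Q, hQ, hQW, hτ⟩ := hQ
  refine hV ?_
  exact (varianceTerm_le hμ hν hρ hX k hQ hQW).trans (ENNReal.ofReal_le_ofReal
    (mul_le_mul_of_nonneg_left ((add_le_add_left hτ _).trans hT) (sq_nonneg σ)))

variable {E H : Type*} [Fintype H] [DecidableEq H] {κ : E → E → ℝ} {s : ℝ} {z : H → E → ℝ}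

/-- If the inverse of the barrier matrix `L + W` is at most `1 / (2 L)`, then `W` is at least half
of the barrier matrix. -/
lemma half_barrier_le (hκ : IsPSDKernel κ) (hs : 0 < s) {L : ℝ} (hL : 0 < L) {n : ℕ}
    (X : Fin n → E)
    (hY : ∀ c : H → ℝ, c ⬝ᵥ (L • (1 : Matrix H H ℝ) + headCov κ s z X)⁻¹ *ᵥ c ≤
      1 / (2 * L) * (c ⬝ᵥ c)) (c : H → ℝ) :
    c ⬝ᵥ ((1 / 2 : ℝ) • (L • (1 : Matrix H H ℝ) + headCov κ s z X)) *ᵥ c ≤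
      c ⬝ᵥ headCov κ s z X *ᵥ c := by
  have hB := barrier_posDef (z := z) hκ hs hL X
  set B := L • (1 : Matrix H H ℝ) + headCov κ s z X with hBdef
  have hBt := transpose_eq_of_posDef hB
  -- positivity of `B` at `c - 2 L B⁻¹ c`
  have h1 : 0 ≤ (c - (2 * L) • (B⁻¹ *ᵥ c)) ⬝ᵥ B *ᵥ (c - (2 * L) • (B⁻¹ *ᵥ c)) := by
    simpa using hB.posSemidef.dotProduct_mulVec_nonneg (c - (2 * L) • (B⁻¹ *ᵥ c))
  have h2 : (B⁻¹ *ᵥ c) ⬝ᵥ B *ᵥ c = c ⬝ᵥ c := by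
    rw [symm_dotProduct_mulVec hBt, mulVec_inv_mulVec hB]
  have h3 : (B⁻¹ *ᵥ c) ⬝ᵥ c = c ⬝ᵥ B⁻¹ *ᵥ c := dotProduct_comm _ _
  simp only [mulVec_sub, mulVec_smul, mulVec_inv_mulVec hB, sub_dotProduct, dotProduct_sub,
    smul_dotProduct, dotProduct_smul, smul_eq_mul, h2, h3] at h1
  have h4 := mul_le_mul_of_nonneg_left (hY c) (by positivity : 0 ≤ 4 * L ^ 2)
  have h5 : 4 * L ^ 2 * (1 / (2 * L) * (c ⬝ᵥ c)) = 2 * L * (c ⬝ᵥ c) := by field_simp; ring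
  have h6 : c ⬝ᵥ B *ᵥ c = L * (c ⬝ᵥ c) + c ⬝ᵥ headCov κ s z X *ᵥ c := by
    rw [hBdef, add_mulVec, smul_mulVec, one_mulVec, dotProduct_add, dotProduct_smul, smul_eq_mul]
  rw [smul_mulVec, dotProduct_smul, smul_eq_mul]
  nlinarith

variable [MeasurableSpace E] {μ : Measure E}

/-- Two barrier potentials are used: the one with exponent `q` gives the spectral lower bound which
makes the shift `L` harmless, and the one with exponent `1` then gives the trace. -/
theorem measure_not_hasInverseTraceBound_le [Nonempty H] [IsProbabilityMeasure μ]
    (hm : IsHeadTailModel μ κ z) (hs : 0 < s) {L : ℝ} (hL : 0 < L) {q : ℕ} (hq : 1 ≤ q) {d : ℝ}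
    (hd0 : 0 < d) (hd1 : d ≤ 1) (hd : ∀ᵐ x ∂μ, (∑ a, z a x ^ 2) / L + κ x x / s ≤ d) {n : ℕ}
    (hn : 1 ≤ n) (hLq : 16 * q * (Fintype.card H : ℝ) ^ (1 / (q : ℝ)) * L ≤ n) :
    (Measure.pi fun _ : Fin n => μ)
      {X | ¬ HasInverseTraceBound (headCov κ s z X) (16 * Fintype.card H / n)} ≤
      ENNReal.ofReal (2 * Real.exp (-(1 / d))) := by
  have hn0 : (0 : ℝ) < n := by exact_mod_cast hn
  have hq0 : (0 : ℝ) < q := by exact_mod_cast hq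
  have hc0 : (0 : ℝ) < Fintype.card H := Nat.cast_pos.2 Fintype.card_pos
  have h1 := measure_barrierPotential_le hm hs hL le_rfl hd0 hd1 hd hn
  have h2 := measure_barrierPotential_le hm hs hL hq hd0 hd1 hd hn
  rw [two_mul, ENNReal.ofReal_add (Real.exp_pos _).le (Real.exp_pos _).le]
  refine le_trans (measure_mono ?_) ((measure_union_le _ _).trans (add_le_add h1 h2))
  intro X hX
  by_contra hnot
  simp only [Set.mem_union, Set.mem_ofPred_eq, not_or, not_le] at hnot
  obtain ⟨hΦ1, hΦq⟩ := hnot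
  refine hX ?_
  have hB := barrier_posDef (z := z) hm.psd hs hL X
  have hpos : ∀ m, 0 < barrierPotential κ s z L m X := fun m =>
    barrierPotential_pos hm.psd hs hL X
  -- inverting the two lower bounds
  have hinv : ∀ m : ℕ, 1 ≤ m → n * (Fintype.card H : ℝ) ^ (-(1 / (m : ℝ))) / (8 * m) <
      barrierPotential κ s z L m X ^ (-(1 / (m : ℝ))) →
      barrierPotential κ s z L m X ^ (1 / (m : ℝ)) ≤
        8 * m * (Fintype.card H : ℝ) ^ (1 / (m : ℝ)) / n := by
    intro m hm1 h
    have hm0 : (0 : ℝ) < m := by exact_mod_cast hm1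
    rw [Real.rpow_neg (hpos m).le, Real.rpow_neg hc0.le] at h
    have hp := Real.rpow_pos_of_pos (hpos m) (1 / (m : ℝ))
    have hcp := Real.rpow_pos_of_pos hc0 (1 / (m : ℝ))
    have := (lt_inv_comm₀ (by positivity) hp).1 h
    refine this.le.trans (le_of_eq ?_)
    field_simp
  have hq1 := hinv q hq hΦq
  have ht1 := hinv 1 le_rfl hΦ1
  simp only [Nat.cast_one, div_one, Real.rpow_one, mul_one] at ht1
  have htr : barrierPotential κ s z L 1 X =
      ((L • (1 : Matrix H H ℝ) + headCov κ s z X)⁻¹).trace := by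
    rw [barrierPotential, pow_one]
  rw [htr] at ht1
  refine ⟨(1 / 2 : ℝ) • (L • (1 : Matrix H H ℝ) + headCov κ s z X), hB.smul (by norm_num),
    half_barrier_le hm.psd hs hL X fun c => ?_, ?_⟩
  · refine (dotProduct_mulVec_le_rpow_trace hB.inv.posSemidef hq c).trans ?_
    refine mul_le_mul_of_nonneg_right (hq1.trans ?_)
      (Finset.sum_nonneg fun _ _ => mul_self_nonneg _)
    rw [div_le_div_iff₀ hn0 (by positivity)]
    linarith
  · rw [inv_smul_posDef hB (by norm_num), trace_smul, smul_eq_mul]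
    norm_num
    calc 2 * ((L • (1 : Matrix H H ℝ) + headCov κ s z X)⁻¹).trace ≤
          2 * (8 * Fintype.card H / n) := by linarith
      _ = _ := by ring

end Reduction

/-! ### Asymptotics -/

lemma eventually_le_rpow {γ : ℝ} (hγ : 0 < γ) (A : ℝ) : ∀ᶠ n : ℕ in atTop, A ≤ (n : ℝ) ^ γ :=
  ((tendsto_rpow_atTop hγ).comp tendsto_natCast_atTop_atTop).eventually_ge_atTop A

/-- The truncation level `⌈n ^ s⌉`, at which the tail eigenvalues are comparable to the ridge when
`s = b / (1 + a)`. -/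
noncomputable def truncationLevel (s : ℝ) (n : ℕ) : ℕ := ⌈(n : ℝ) ^ s⌉₊

lemma rpow_le_truncationLevel (s : ℝ) (n : ℕ) : (n : ℝ) ^ s ≤ truncationLevel s n := Nat.le_ceil _

lemma truncationLevel_le {s : ℝ} (hs : 0 < s) {n : ℕ} (hn : 1 ≤ n) :
    (truncationLevel s n : ℝ) ≤ 2 * (n : ℝ) ^ s := by
  have h1 : (1 : ℝ) ≤ (n : ℝ) ^ s := Real.one_le_rpow (by exact_mod_cast hn) hs.le
  have := (Nat.ceil_lt_add_one (zero_le_one.trans h1)).le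
  unfold truncationLevel
  linarith

lemma one_le_truncationLevel (s : ℝ) {n : ℕ} (hn : 1 ≤ n) : 1 ≤ truncationLevel s n :=
  Nat.one_le_ceil_iff.2 (Real.rpow_pos_of_pos (by exact_mod_cast hn) _)

section Asymptotics

variable {p : ℕ∞} {lam : Idx p → ℝ} {a b c C : ℝ}

lemma tailSum_div_le (ha : 0 < a) (hc : 0 < c) (hC : 0 < C) (h : PolyDecay a c C lam)
    {n : ℕ} (hn : 1 ≤ n) {ρ : ℝ} (hρ : c * (n : ℝ) ^ (-b) ≤ ρ) :
    tailSum lam (truncationLevel (b / (1 + a)) n) / (n * ρ) ≤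
      C / (a * c) * (n : ℝ) ^ (b / (1 + a) - 1) := by
  have hn0 : (0 : ℝ) < n := by exact_mod_cast hn
  set s := b / (1 + a) with hs
  have hsb : s * (1 + a) = b := div_mul_cancel₀ b (by linarith)
  have hnb : 0 < (n : ℝ) ^ (-b) := Real.rpow_pos_of_pos hn0 _
  have hk0 : 0 < (n : ℝ) ^ s := Real.rpow_pos_of_pos hn0 _
  have h1 : tailSum lam (truncationLevel s n) ≤ C / a * (n : ℝ) ^ (-(s * a)) := by
    refine (tailSum_le ha hC.le h (one_le_truncationLevel s hn)).trans ?_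
    refine mul_le_mul_of_nonneg_left ?_ (by positivity)
    rw [show -(s * a) = s * (-a) by ring, Real.rpow_mul hn0.le]
    exact Real.rpow_le_rpow_of_nonpos hk0 (rpow_le_truncationLevel s n) (by linarith)
  have h2 : 0 < n * (c * (n : ℝ) ^ (-b)) := by positivity
  have h3 : n * (c * (n : ℝ) ^ (-b)) ≤ n * ρ := mul_le_mul_of_nonneg_left hρ hn0.le
  calc tailSum lam (truncationLevel s n) / (n * ρ) ≤
        C / a * (n : ℝ) ^ (-(s * a)) / (n * (c * (n : ℝ) ^ (-b))) := by gcongr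
    _ = C / (a * c) * ((n : ℝ) ^ (-(s * a)) / (n * (n : ℝ) ^ (-b))) := by field_simp
    _ = _ := by
        have h4 : n * (n : ℝ) ^ (-b) = (n : ℝ) ^ (1 - b) := by
          rw [sub_eq_add_neg, Real.rpow_add hn0, Real.rpow_one]
        rw [h4, ← Real.rpow_sub hn0]
        congr 2
        rw [← hsb]
        ring

end Asymptotics

/-! ### The variance bounds -/

section GenericBound

variable {a b c C : ℝ}

/-- The barrier estimate for generic features, with `L = n ^ ((1 + s) / 2)`, between the dimension
`n ^ s` of the head and the number `n` of samples, and with any exponent `q > 2 s / (1 - s)`. The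
two summands of `D` account for the head and for the tail of a sample. -/
lemma measure_generic_le {p : ℕ∞} {lam : Idx p → ℝ} {μ : Measure (Idx p → ℝ)} (ha : 0 < a)
    (hb : 0 < b) (hba : b < 1 + a) (hc : 0 < c) (hC : 0 < C) (hμ : IsFeatureLaw lam μ)
    (h : PolyDecay a c C lam) (hGF : GenericFeatures c C lam μ) {n : ℕ} (hn : 1 ≤ n) {ρ : ℝ}
    (hρ : c * (n : ℝ) ^ (-b) ≤ ρ) {q : ℕ} (hq : 1 ≤ q) {s D : ℝ} (hs : s = b / (1 + a))
    (hD : D = 2 * C + C * (C / (a * c))) (hnD : D ≤ (n : ℝ) ^ ((1 - s) / 2))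
    (hnq : 32 * (q : ℝ) ≤ (n : ℝ) ^ ((1 - s) / 2 - s / q)) :
    (Measure.pi fun _ : Fin n => μ) {X | ¬ HasInverseTraceBound
        (headCov (tailKernel (truncationLevel s n)) (n * ρ)
          (headFeature lam (truncationLevel s n)) X) (32 * (n : ℝ) ^ (s - 1))} ≤
      ENNReal.ofReal (2 * Real.exp (-(1 / D) * (n : ℝ) ^ ((1 - s) / 2))) := by
  have := hμ.prob
  have hn0 : (0 : ℝ) < n := by exact_mod_cast hn
  have hn1 : (1 : ℝ) ≤ n := by exact_mod_cast hn
  have hs0 : 0 < s := by rw [hs]; positivity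
  have hs1 : s < 1 := by rw [hs, div_lt_one (by linarith)]; exact hba
  have hρ0 : 0 < ρ := lt_of_lt_of_le (by positivity) hρ
  have hD0 : 0 < D := by rw [hD]; positivity
  set k := truncationLevel s n with hk
  have hk2 : (k : ℝ) ≤ 2 * (n : ℝ) ^ s := truncationLevel_le hs0 hn
  rcases isEmpty_or_nonempty (Head p k) with hE | hE
  · refine le_trans (le_of_eq ?_) zero_le
    convert measure_empty (μ := Measure.pi fun _ : Fin n => μ)
    ext X
    simp only [Set.mem_ofPred_eq, Set.mem_empty_iff_false, iff_false, not_not]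
    refine ⟨1, PosDef.one, fun c => by simp [dotProduct], ?_⟩
    rw [trace, Finset.univ_eq_empty, Finset.sum_empty]
    positivity
  set L : ℝ := (n : ℝ) ^ ((1 + s) / 2) with hL
  have hL0 : 0 < L := Real.rpow_pos_of_pos hn0 _
  set d : ℝ := D * (n : ℝ) ^ ((s - 1) / 2) with hd
  have hd0 : 0 < d := by positivity
  have hinv : (n : ℝ) ^ ((s - 1) / 2) = ((n : ℝ) ^ ((1 - s) / 2))⁻¹ := by
    rw [← Real.rpow_neg hn0.le]; congr 1; ring
  have hd1 : d ≤ 1 := by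
    rw [hd, hinv, ← div_eq_mul_inv, div_le_one (by positivity)]
    exact hnD
  have hae : ∀ᵐ x ∂μ, (∑ a, headFeature lam k a x ^ 2) / L + tailKernel k x x / (n * ρ) ≤ d := by
    filter_upwards [hGF.ae_bound hμ hC k] with x hx
    have h1 : (∑ a, headFeature lam k a x ^ 2) / L ≤ 2 * C * (n : ℝ) ^ ((s - 1) / 2) := by
      rw [div_le_iff₀ hL0, hL, mul_assoc, ← Real.rpow_add hn0,
        show (s - 1) / 2 + (1 + s) / 2 = s by ring]
      refine hx.1.trans ?_
      calc C * k ≤ C * (2 * (n : ℝ) ^ s) := by gcongr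
        _ = _ := by ring
    have h2 : tailKernel k x x / (n * ρ) ≤ C * (C / (a * c)) * (n : ℝ) ^ ((s - 1) / 2) := by
      have h3 := tailSum_div_le ha hc hC h hn hρ
      rw [← hs] at h3
      calc tailKernel k x x / (n * ρ) ≤ C * tailSum lam k / (n * ρ) := by
            gcongr
            exact hx.2
        _ = C * (tailSum lam k / (n * ρ)) := by ring
        _ ≤ C * (C / (a * c) * (n : ℝ) ^ (s - 1)) := by gcongr
        _ ≤ C * (C / (a * c) * (n : ℝ) ^ ((s - 1) / 2)) := by
            have h4 := Real.rpow_le_rpow_of_exponent_le hn1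
              (show s - 1 ≤ (s - 1) / 2 by linarith)
            gcongr
        _ = _ := by ring
    rw [hd, hD]
    linarith
  have hcard : (Fintype.card (Head p k) : ℝ) ≤ 2 * (n : ℝ) ^ s :=
    (Nat.cast_le.2 (card_head_le k)).trans hk2
  have hq0 : (1 : ℝ) ≤ q := by exact_mod_cast hq
  have hLq : 16 * q * (Fintype.card (Head p k) : ℝ) ^ (1 / (q : ℝ)) * L ≤ n := by
    have h1 : (Fintype.card (Head p k) : ℝ) ^ (1 / (q : ℝ)) ≤ 2 * (n : ℝ) ^ (s / q) := by
      refine (Real.rpow_le_rpow (Nat.cast_nonneg _) hcard (by positivity)).trans ?_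
      rw [Real.mul_rpow (by norm_num) (by positivity), ← Real.rpow_mul hn0.le, mul_one_div]
      gcongr
      calc (2 : ℝ) ^ (1 / (q : ℝ)) ≤ 2 ^ (1 : ℝ) :=
            Real.rpow_le_rpow_of_exponent_le (by norm_num)
              ((div_le_one (by linarith)).2 hq0)
        _ = 2 := Real.rpow_one 2
    calc 16 * q * (Fintype.card (Head p k) : ℝ) ^ (1 / (q : ℝ)) * L ≤
          16 * q * (2 * (n : ℝ) ^ (s / q)) * L := by gcongr
      _ = 32 * q * ((n : ℝ) ^ (s / q) * (n : ℝ) ^ ((1 + s) / 2)) := by rw [hL]; ring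
      _ ≤ (n : ℝ) ^ ((1 - s) / 2 - s / q) * ((n : ℝ) ^ (s / q) * (n : ℝ) ^ ((1 + s) / 2)) := by
          gcongr
      _ = n := by
          rw [← Real.rpow_add hn0, ← Real.rpow_add hn0]
          ring_nf
          exact Real.rpow_one _
  have key := measure_not_hasInverseTraceBound_le (isHeadTailModel hμ k) (by positivity) hL0 hq hd0
    hd1 hae hn hLq
  refine le_trans (measure_mono ?_) (key.trans (le_of_eq ?_))
  · intro X hX hQ
    obtain ⟨Q, hQ, hQW, hτ⟩ := hQ
    refine hX ?_
    refine ⟨Q, hQ, hQW, hτ.trans ?_⟩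
    rw [div_le_iff₀ hn0, mul_assoc]
    nth_rw 2 [← Real.rpow_one (n : ℝ)]
    rw [← Real.rpow_add hn0, sub_add_cancel]
    linarith
  · rw [hd, hinv]
    congr 3
    field_simp

theorem variance_generic (ha : 0 < a) (hb : 0 < b) (hba : b < 1 + a) (hc : 0 < c) (hC : 0 < C) :
    ∃ K : ℝ, 0 < K ∧ ∃ δ : ℕ → ℝ, δ =o[atTop] (fun n : ℕ => 1 / (n : ℝ)) ∧
      ∀ᶠ n : ℕ in atTop,
        ∀ (p : ℕ∞) (lam : Idx p → ℝ) (μ : Measure (Idx p → ℝ)) (ν : Measure ℝ) (σ ridge : ℝ),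
          IsFeatureLaw lam μ → IsNoiseLaw ν σ → PolyDecay a c C lam →
          c * (n : ℝ) ^ (-b) ≤ ridge → GenericFeatures c C lam μ →
          sampleLaw μ n {X | ¬ varianceTerm μ ν ridge X ≤
              ENNReal.ofReal (K * σ ^ 2 * (n : ℝ) ^ (b / (1 + a) - 1))} ≤
            ENNReal.ofReal (δ n) := by
  set s := b / (1 + a) with hs
  have hs0 : 0 < s := by rw [hs]; positivity
  have hs1 : s < 1 := by rw [hs, div_lt_one (by linarith)]; exact hba
  set D := 2 * C + C * (C / (a * c)) with hD
  have hD0 : 0 < D := by rw [hD]; positivity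
  have hγ : 0 < (1 - s) / 2 := by linarith
  refine ⟨32 + C / (a * c), by positivity,
    fun n => 2 * Real.exp (-(1 / D) * (n : ℝ) ^ ((1 - s) / 2)), ?_, ?_⟩
  · -- the substitution `y = n ^ ((1 - s) / 2)` turns `1 / n` into a power of `y`
    have h1 := (isLittleO_exp_neg_mul_rpow_atTop (a := 1 / D) (by positivity)
      (-(1 / ((1 - s) / 2)))).comp_tendsto
        ((tendsto_rpow_atTop hγ).comp tendsto_natCast_atTop_atTop)
    refine (h1.const_mul_left 2).congr' (Eventually.of_forall fun n => rfl) ?_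
    filter_upwards with n
    simp only [Function.comp_apply]
    rw [← Real.rpow_mul (Nat.cast_nonneg n), mul_neg, mul_one_div, div_self hγ.ne',
      Real.rpow_neg_one, one_div]
  · -- `q` is so large that `n ^ (s / q) * L = o (n)`
    obtain ⟨q, hq⟩ := exists_nat_gt (max 1 (s / ((1 - s) / 2)))
    have hq1 : (1 : ℝ) < q := (le_max_left _ _).trans_lt hq
    have hq2 : s / q < (1 - s) / 2 := by
      have := (le_max_right _ _).trans_lt hq
      rw [div_lt_iff₀ hγ] at this
      rw [div_lt_iff₀ (by linarith)]
      linarith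
    filter_upwards [eventually_ge_atTop 1, eventually_le_rpow hγ D,
      eventually_le_rpow (sub_pos.2 hq2) (32 * q)] with n hn hnD hnq
    intro p lam μ ν σ ρ hμ hν hdec hρ hGF
    have hn0 : (0 : ℝ) < n := by exact_mod_cast hn
    have hρ0 : 0 < (n : ℝ) * ρ := mul_pos hn0 (lt_of_lt_of_le (by positivity) hρ)
    have hT : 32 * (n : ℝ) ^ (s - 1) + tailSum lam (truncationLevel s n) / (n * ρ) ≤
        (32 + C / (a * c)) * (n : ℝ) ^ (s - 1) := by
      rw [add_mul]
      exact add_le_add_right (tailSum_div_le ha hc hC hdec hn hρ) _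
    rw [show (32 + C / (a * c)) * σ ^ 2 * (n : ℝ) ^ (s - 1) =
      σ ^ 2 * ((32 + C / (a * c)) * (n : ℝ) ^ (s - 1)) by ring]
    exact (measure_varianceTerm_gt_le hμ hν hρ0 (truncationLevel s n) hT).trans
      (measure_generic_le ha hb hba hc hC hμ hdec hGF hn hρ (by exact_mod_cast hq1.le) hs hD hnD
        hnq)

end GenericBound

section IndependentBound

variable {a b c C : ℝ}

/-- The union bound over the grid costs only a factor `exp (o n)`. -/
lemma eventually_grid_le {s : ℝ} (hs0 : 0 < s) (hs1 : s < 1) (N : ℕ) {K : ℝ} (hK : 0 < K) :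
    ∀ᶠ n : ℕ in atTop, (2 * (N * truncationLevel s n : ℕ) + 1 : ℝ) ^ truncationLevel s n ≤
      Real.exp (n / (64 * K)) := by
  have hε : 0 < (1 - s) / 2 := by linarith
  filter_upwards [eventually_ge_atTop 1, eventually_le_rpow hε
    (64 * K * (2 * ((4 * N + 1 : ℝ) ^ ((1 - s) / 2) / ((1 - s) / 2))))] with n hn hlarge
  have hn0 : (0 : ℝ) < n := by exact_mod_cast hn
  have hn1 : (1 : ℝ) ≤ n := by exact_mod_cast hn
  set k := truncationLevel s n with hk
  have hk2 : (k : ℝ) ≤ 2 * (n : ℝ) ^ s := truncationLevel_le hs0 hn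
  have hkn : (k : ℝ) ≤ 2 * n := by
    refine hk2.trans ?_
    gcongr
    exact (Real.rpow_le_rpow_of_exponent_le hn1 hs1.le).trans (Real.rpow_one _).le
  set y : ℝ := 2 * (N * k : ℕ) + 1 with hy
  have hy0 : 0 < y := by positivity
  have hyn : y ≤ (4 * N + 1) * n := by
    rw [hy]
    push_cast
    have : (N : ℝ) * k ≤ N * (2 * n) := by gcongr
    linarith
  rw [← Real.rpow_natCast, Real.rpow_def_of_pos hy0, Real.exp_le_exp, mul_comm]
  have hN0 : (0 : ℝ) ≤ 4 * N + 1 := by positivity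
  have hlog : Real.log y ≤ (4 * N + 1 : ℝ) ^ ((1 - s) / 2) * (n : ℝ) ^ ((1 - s) / 2) /
      ((1 - s) / 2) := by
    refine (Real.log_le_rpow_div hy0.le hε).trans ?_
    rw [← Real.mul_rpow hN0 hn0.le]
    gcongr
  have hlog0 : 0 ≤ Real.log y := Real.log_nonneg (by
    rw [hy]
    have : (0 : ℝ) ≤ (N * k : ℕ) := Nat.cast_nonneg _
    linarith)
  rw [le_div_iff₀ (by positivity)]
  calc k * Real.log y * (64 * K) ≤ 2 * (n : ℝ) ^ s * ((4 * N + 1 : ℝ) ^ ((1 - s) / 2) *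
        (n : ℝ) ^ ((1 - s) / 2) / ((1 - s) / 2)) * (64 * K) := by gcongr
    _ = 64 * K * (2 * ((4 * N + 1 : ℝ) ^ ((1 - s) / 2) / ((1 - s) / 2))) *
        ((n : ℝ) ^ s * (n : ℝ) ^ ((1 - s) / 2)) := by ring
    _ ≤ (n : ℝ) ^ ((1 - s) / 2) * ((n : ℝ) ^ s * (n : ℝ) ^ ((1 - s) / 2)) := by gcongr
    _ = n := by
        rw [← Real.rpow_add hn0, ← Real.rpow_add hn0]
        ring_nf
        exact Real.rpow_one _

theorem variance_independent (ha : 0 < a) (hb : 0 < b) (hba : b < 1 + a) (hc : 0 < c) (hC : 0 < C)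
    {G : ℝ} (hG : 0 < G) :
    ∃ K : ℝ, 0 < K ∧ ∃ c₁ : ℝ, 0 < c₁ ∧
      ∀ᶠ n : ℕ in atTop,
        ∀ (p : ℕ) (lam : Idx (p : ℕ∞) → ℝ) (μ : Measure (Idx (p : ℕ∞) → ℝ)) (ν : Measure ℝ)
          (σ ridge : ℝ),
          IsFeatureLaw lam μ → IsNoiseLaw ν σ → PolyDecay a c C lam →
          c * (n : ℝ) ^ (-b) ≤ ridge → IndependentFeatures G lam μ →
          sampleLaw μ n {X | ¬ varianceTerm μ ν ridge X ≤
              ENNReal.ofReal (K * σ ^ 2 * (n : ℝ) ^ (b / (1 + a) - 1))} ≤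
            ENNReal.ofReal (3 * Real.exp (-(c₁ * (n : ℝ)))) := by
  set s := b / (1 + a) with hs
  have hs0 : 0 < s := by rw [hs]; positivity
  have hs1 : s < 1 := by rw [hs, div_lt_one (by linarith)]; exact hba
  set K := kurtosisBound G with hK
  have hK1 : 1 ≤ K := one_le_kurtosisBound G
  -- the grid has mesh `1 / (N k)`
  obtain ⟨N, hN⟩ := exists_nat_ge (max 2 (1024 * K * G ^ 2))
  have hN2 : (2 : ℝ) ≤ N := (le_max_left _ _).trans hN
  have hNK : 1024 * K * G ^ 2 ≤ N := (le_max_right _ _).trans hN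
  refine ⟨256 * K + C / (a * c), by positivity, 1 / (64 * K), by positivity, ?_⟩
  filter_upwards [eventually_ge_atTop 1, eventually_grid_le hs0 hs1 N (by linarith : 0 < K),
    eventually_le_rpow (sub_pos.2 hs1) (C / (a * c) * (64 * K / 7))] with n hn hgrid hsmall
  intro p lam μ ν σ ρ hμ hν hdec hρ hIF
  have hn0 : (0 : ℝ) < n := by exact_mod_cast hn
  have hρ0 : 0 < (n : ℝ) * ρ := mul_pos hn0 (lt_of_lt_of_le (by positivity) hρ)
  have : Finite (Idx (p : ℕ∞)) := Finite.of_injective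
    (fun l : Idx (p : ℕ∞) => (⟨l.1, by exact_mod_cast l.2⟩ : Fin p))
    fun x y hxy => Subtype.ext (congrArg Fin.val hxy)
  have := Fintype.ofFinite (Idx (p : ℕ∞))
  have htail := tailSum_div_le ha hc hC hdec hn hρ
  rw [← hs] at htail
  set k := truncationLevel s n with hk
  have hk1 : (1 : ℝ) ≤ k := by exact_mod_cast one_le_truncationLevel s hn
  have hk2 : (k : ℝ) ≤ 2 * (n : ℝ) ^ s := truncationLevel_le hs0 hn
  have htail' : tailSum lam k / (n * ρ) ≤ 7 / (64 * K) := by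
    refine htail.trans ?_
    rw [show s - 1 = -(1 - s) by ring, Real.rpow_neg hn0.le, ← div_eq_mul_inv,
      div_le_iff₀ (by positivity)]
    calc C / (a * c) = 7 / (64 * K) * (C / (a * c) * (64 * K / 7)) := by field_simp
      _ ≤ _ := by gcongr
  have hM : 0 < N * k := by
    have : (0 : ℝ) < N * k := by nlinarith
    exact_mod_cast this
  have hM1 : 4 * (k : ℝ) ≤ ((N * k : ℕ) : ℝ) ^ 2 := by
    push_cast
    have h1 : 2 * (k : ℝ) ≤ N * k := by gcongr
    nlinarith
  have hM2 : 1024 * K * G ^ 2 * (k : ℝ) ^ 2 ≤ ((N * k : ℕ) : ℝ) ^ 2 := by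
    push_cast
    rw [mul_pow]
    refine mul_le_mul_of_nonneg_right (hNK.trans ?_) (sq_nonneg _)
    nlinarith
  have hprob := measure_headCov_lower_le hμ hG hIF hρ0 htail' hM hM1 hM2 n
  have hT : 256 * K * (n : ℝ) ^ (s - 1) + tailSum lam k / (n * ρ) ≤
      (256 * K + C / (a * c)) * (n : ℝ) ^ (s - 1) := by
    rw [add_mul]
    exact add_le_add_right htail _
  rw [show (256 * K + C / (a * c)) * σ ^ 2 * (n : ℝ) ^ (s - 1) =
    σ ^ 2 * ((256 * K + C / (a * c)) * (n : ℝ) ^ (s - 1)) by ring]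
  refine (measure_varianceTerm_gt_le hμ hν hρ0 k hT).trans (le_trans (measure_mono ?_)
    (hprob.trans (ENNReal.ofReal_le_ofReal ?_)))
  · intro X hX hv
    refine hX ?_
    have hr : 0 < n / (32 * K) / 4 := by positivity
    refine ⟨(n / (32 * K) / 4) • 1, PosDef.one.smul hr, fun v => ?_, ?_⟩
    · rw [smul_mulVec, one_mulVec, dotProduct_smul, smul_eq_mul]
      exact hv v
    · rw [inv_smul_posDef PosDef.one hr, inv_one, trace_smul, trace_one, smul_eq_mul]
      have hcard : (Fintype.card (Head (p : ℕ∞) k) : ℝ) ≤ 2 * (n : ℝ) ^ s :=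
        (Nat.cast_le.2 (card_head_le k)).trans hk2
      rw [Real.rpow_sub_one hn0.ne']
      calc (n / (32 * K) / 4)⁻¹ * (Fintype.card (Head (p : ℕ∞) k) : ℝ) ≤
            (n / (32 * K) / 4)⁻¹ * (2 * (n : ℝ) ^ s) := by gcongr
        _ = _ := by field_simp; ring
  · have h1 : (2 * (N * k : ℕ) + 1 : ℝ) ^ k * Real.exp (-(n / (32 * K))) ≤
        Real.exp (-(1 / (64 * K) * n)) := by
      refine (mul_le_mul_of_nonneg_right hgrid (Real.exp_pos _).le).trans (le_of_eq ?_)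
      rw [← Real.exp_add]
      congr 1
      field_simp
      ring
    have h2 : Real.exp (-n) ≤ Real.exp (-(1 / (64 * K) * n)) := by
      rw [Real.exp_le_exp, neg_le_neg_iff]
      refine mul_le_of_le_one_left hn0.le ?_
      rw [div_le_one (by positivity)]
      linarith
    have h3 := Real.exp_pos (-(1 / (64 * K) * (n : ℝ)))
    linarith

end IndependentBound

end RidgeRegression

theorem mainTheorem5 (a b c C : ℝ) (ha : 0 < a) (hb : 0 < b) (hba : b < 1 + a) (hc : 0 < c) :
    -- generic features, feature dimension `p ∈ ℕ ∪ {∞}`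
    (∃ K : ℝ, 0 < K ∧ ∃ δ : ℕ → ℝ, δ =o[atTop] (fun n : ℕ => 1 / (n : ℝ)) ∧
      ∀ᶠ n : ℕ in atTop,
        ∀ (p : ℕ∞) (lam : RidgeRegression.Idx p → ℝ)
          (μ : Measure (RidgeRegression.Idx p → ℝ)) (ν : Measure ℝ) (σ ridge : ℝ),
          RidgeRegression.IsFeatureLaw lam μ →
          RidgeRegression.IsNoiseLaw ν σ →
          RidgeRegression.PolyDecay a c C lam →
          c * (n : ℝ) ^ (-b) ≤ ridge → ridge ≤ C * (n : ℝ) ^ (-b) →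
          RidgeRegression.GenericFeatures c C lam μ →
          RidgeRegression.sampleLaw μ n
            {X | ¬ RidgeRegression.varianceTerm μ ν ridge X ≤
              ENNReal.ofReal (K * σ ^ 2 * (n : ℝ) ^ (b / (1 + a) - 1))}
            ≤ ENNReal.ofReal (δ n)) ∧
    -- independent features, feature dimension `p ∈ ℕ` with `p > η n`
    (∀ G η : ℝ, 0 < G → 1 < η →
      ∃ K : ℝ, 0 < K ∧ ∃ c₁ : ℝ, 0 < c₁ ∧
      ∀ᶠ n : ℕ in atTop,
        ∀ (p : ℕ) (lam : RidgeRegression.Idx (p : ℕ∞) → ℝ)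
          (μ : Measure (RidgeRegression.Idx (p : ℕ∞) → ℝ)) (ν : Measure ℝ) (σ ridge : ℝ),
          η * (n : ℝ) < (p : ℝ) →
          RidgeRegression.IsFeatureLaw lam μ →
          RidgeRegression.IsNoiseLaw ν σ →
          RidgeRegression.PolyDecay a c C lam →
          c * (n : ℝ) ^ (-b) ≤ ridge → ridge ≤ C * (n : ℝ) ^ (-b) →
          RidgeRegression.IndependentFeatures G lam μ →
          RidgeRegression.sampleLaw μ n
            {X | ¬ RidgeRegression.varianceTerm μ ν ridge X ≤
              ENNReal.ofReal (K * σ ^ 2 * (n : ℝ) ^ (b / (1 + a) - 1))}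
            ≤ ENNReal.ofReal (3 * Real.exp (-(c₁ * (n : ℝ))))) := by
  rcases lt_or_ge 0 C with hC | hC
  · refine ⟨?_, fun G η hG _ => ?_⟩
    · obtain ⟨K, hK, δ, hδ, h⟩ := RidgeRegression.variance_generic ha hb hba hc hC
      refine ⟨K, hK, δ, hδ, ?_⟩
      filter_upwards [h] with n hn
      intro p lam μ ν σ ridge hμ hν hdec h1 _ hGF
      exact hn p lam μ ν σ ridge hμ hν hdec h1 hGF
    · obtain ⟨K, hK, c₁, hc₁, h⟩ := RidgeRegression.variance_independent ha hb hba hc hC hG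
      refine ⟨K, hK, c₁, hc₁, ?_⟩
      filter_upwards [h] with n hn
      intro p lam μ ν σ ridge _ hμ hν hdec h1 _ hIF
      exact hn p lam μ ν σ ridge hμ hν hdec h1 hIF
  · -- no ridge satisfies both bounds if `C ≤ 0`
    have hno : ∀ n : ℕ, 1 ≤ n → ∀ r : ℝ, c * (n : ℝ) ^ (-b) ≤ r → ¬ r ≤ C * (n : ℝ) ^ (-b) := by
      intro n hn r h1 h2
      have hn0 : 0 < (n : ℝ) ^ (-b) := Real.rpow_pos_of_pos (by exact_mod_cast hn) _
      nlinarith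
    refine ⟨⟨1, one_pos, fun _ => 0, isLittleO_zero _ _, ?_⟩,
      fun G η _ _ => ⟨1, one_pos, 1, one_pos, ?_⟩⟩
    · filter_upwards [eventually_ge_atTop 1] with n hn
      intro p lam μ ν σ ridge _ _ _ h1 h2
      exact absurd h2 (hno n hn ridge h1)
    · filter_upwards [eventually_ge_atTop 1] with n hn
      intro p lam μ ν σ ridge _ _ _ _ h1 h2
      exact absurd h2 (hno n hn ridge h1)
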